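/- **Corollary 6.3 (Frobenius algebras with diagonalisable Nakayama automorphism).** Let $k$ be a field (for instance, an algebraically closed one) and let $A$ be a Frobenius algebra over $k$, that is, a unital associative $k$-algebra with a linear functional $\varepsilon\colon A\to k$ such that $A\to A^*=\mathrm{Hom}_k(A,k)$, $a\mapsto\varepsilon(a\,\cdot\,)$, is bijective. Let $\sigma\in\mathrm{Aut}_k(A)$ be its Nakayama automorphism, determined by $\varepsilon(ab)=\varepsilon(\sigma(b)a)$ for all $a,b\in A$. Assume that $\sigma$ is diagonalisable over $k$: there is a subset $\Sigma\subseteq k\setminus\{0\}$ with $A=\bigoplus_{\lambda\in\Sigma}A_\lambda$, where $A_\lambda=\{a\in A\mid\sigma(a)=\lambda a\}$. Then the Hochschild cohomology $H^\bullet(A,A)=\bigoplus_{p\ge 0}H^p(A,A)$, the cohomology of the Hochschild cochain complex $C^p(A,A)=\mathrm{Hom}_k(A^{\otimes p},A)$, is a Batalin–Vilkovisky algebra. Explicitly: * The cup product $(f\smile g)(a_1,\dots,a_{p+q})=f(a_1,\dots,a_p)\,g(a_{p+1},\dots,a_{p+q})$ and the Gerstenhaber bracket $\{f,g\}=f\circ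 g-(-1)^{(p-1)(q-1)}g\circ f$, for $f\in C^p(A,A)$ and $g\in C^q(A,A)$, where $$f\circ g=\sum_{i=1}^{p}(-1)^{(p-i)(q-1)}f\bigl(a_1,\dots,a_{i-1},g(a_i,\dots,a_{i+q-1}),a_{i+q},\dots,a_{p+q-1}\bigr),$$ induce on $H^\bullet(A,A)$ the structure of a Gerstenhaber algebra: $\smile$ is an associative, unital, graded commutative product; $\{\cdot,\cdot\}$ has degree $-1$ and is a graded Lie bracket on the desuspension of $H^\bullet(A,A)$ (also in the strict sense: $\{x,x\}=0$ for $x$ of odd degree and $\{x,\{x,x\}\}=0$ for $x$ of even degree); and $\{\gamma,\alpha\smile\beta\}=\{\gamma,\alpha\}\smile\beta+(-1)^{(r-1)p}\alpha\smile\{\gamma,\beta\}$ for $\gamma\in H^r(A,A)$, $\alpha\in H^p(A,A)$ and $\beta\in H^\bullet(A,A)$. * There is a $k$-linear map $B\colon H^n(A,A)\to H^{n-1}(A,A)$, $n\ge 0$ (with $H^{-1}(A,A)=0$), such that $B\circ B=0$ and, for all $\alpha\in H^p(A,A)$ and $\beta\in H^\bullet(A,A)$, $$\{\alpha,\beta\}=(-1)^p\bigl(B(\alpha\smile\beta)-B(\alpha)\smile\beta-(-1)^p\alpha\smile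 B(\beta)\bigr).$$ -/

import Mathlib

open scoped DirectSum

/-! ### Gerstenhaber and Batalin-Vilkovisky algebras -/

/-- A Gerstenhaber algebra structure on the `k`-module `V = ⨁_{p ≥ 0} 𝒱 p`. All laws are stated on
homogeneous elements wherever a degree enters. The bracket has degree `-1`, i.e. `𝒱 p` sits in Lie
degree `p - 1`; exponents `p - 1` of `-1` are written `p + 1`. -/
structure GerstenhaberAlgebra (k V : Type*) [CommRing k] [AddCommGroup V] [Module k V]
    (𝒱 : ℕ → Submodule k V) where
  /-- the product `x ⌣ y` -/
  mul : V →ₗ[k] V →ₗ[k] V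
  /-- the unit of the product -/
  one : V
  /-- the bracket `{x, y}` -/
  bracket : V →ₗ[k] V →ₗ[k] V
  isInternal : DirectSum.IsInternal 𝒱
  one_mem : one ∈ 𝒱 0
  mul_mem : ∀ {p q : ℕ} {x y : V}, x ∈ 𝒱 p → y ∈ 𝒱 q → mul x y ∈ 𝒱 (p + q)
  one_mul : ∀ x : V, mul one x = x
  mul_one : ∀ x : V, mul x one = x
  mul_assoc : ∀ x y z : V, mul (mul x y) z = mul x (mul y z)
  mul_comm : ∀ {p q : ℕ} {x y : V}, x ∈ 𝒱 p → y ∈ 𝒱 q →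
    mul x y = (-1 : k) ^ (p * q) • mul y x
  bracket_mem : ∀ {p q r : ℕ} {x y : V}, p + q = r + 1 → x ∈ 𝒱 p → y ∈ 𝒱 q → bracket x y ∈ 𝒱 r
  /-- the target degree is `-1` here -/
  bracket_zero_zero : ∀ {x y : V}, x ∈ 𝒱 0 → y ∈ 𝒱 0 → bracket x y = 0
  bracket_antisymm : ∀ {p q : ℕ} {x y : V}, x ∈ 𝒱 p → y ∈ 𝒱 q →
    bracket x y = -((-1 : k) ^ ((p + 1) * (q + 1)) • bracket y x)
  /-- follows from antisymmetry if `2` is invertible -/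
  bracket_self : ∀ {p : ℕ} {x : V}, Odd p → x ∈ 𝒱 p → bracket x x = 0
  jacobi : ∀ {p q : ℕ} {x y : V}, x ∈ 𝒱 p → y ∈ 𝒱 q → ∀ z : V,
    bracket x (bracket y z) =
      bracket (bracket x y) z + (-1 : k) ^ ((p + 1) * (q + 1)) • bracket y (bracket x z)
  /-- follows from the Jacobi identity if `3` is invertible -/
  bracket_bracket_self : ∀ {p : ℕ} {x : V}, Even p → x ∈ 𝒱 p → bracket x (bracket x x) = 0
  leibniz : ∀ {r p : ℕ} {z x : V}, z ∈ 𝒱 r → x ∈ 𝒱 p → ∀ y : V,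
    bracket z (mul x y) = mul (bracket z x) y + (-1 : k) ^ ((r + 1) * p) • mul x (bracket z y)

/-- A Batalin-Vilkovisky algebra: a Gerstenhaber algebra with a differential `B` of degree `-1`
that generates the bracket. -/
structure BVAlgebra (k V : Type*) [CommRing k] [AddCommGroup V] [Module k V]
    (𝒱 : ℕ → Submodule k V) extends GerstenhaberAlgebra k V 𝒱 where
  /-- the BV operator -/
  B : V →ₗ[k] V
  B_mem : ∀ {n : ℕ} {x : V}, x ∈ 𝒱 (n + 1) → B x ∈ 𝒱 n
  B_zero : ∀ {x : V}, x ∈ 𝒱 0 → B x = 0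
  B_B : ∀ x : V, B (B x) = 0
  bracket_eq : ∀ {p : ℕ} {x : V}, x ∈ 𝒱 p → ∀ y : V,
    bracket x y = (-1 : k) ^ p • (B (mul x y) - mul (B x) y - (-1 : k) ^ p • mul x (B y))

/-! ### The Hochschild complex -/

namespace Hochschild

variable (k : Type*) (A : Type*) [CommRing k] [Ring A] [Algebra k A]

/-- Hochschild cochains `C^n(A, A) = Hom_k(A^{⊗ n}, A)`. -/
abbrev Cochain (n : ℕ) := MultilinearMap k (fun _ : Fin n => A) A

/-- Shortcut for instance search; this is Mathlib's instance. -/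
instance (n : ℕ) : AddCommGroup (Cochain k A n) := MultilinearMap.instAddCommGroup

variable {k A}

/-- The arguments of the outer cochain in `f ∘_i g`:
`(a_0, …, a_{i-1}, g (a_i, …, a_{i+q-1}), a_{i+q}, …, a_{r-1})`, where `p + q = r + 1`. -/
def insertArg {p q r : ℕ} (h : p + q = r + 1) (i : Fin p) (g : (Fin q → A) → A) (a : Fin r → A) :
    Fin p → A := fun j =>
  if hlt : j < i then a ⟨j, by have := Fin.lt_def.1 hlt; omega⟩
  else if heq : j = i then g (fun l => a ⟨i + l, by omega⟩)
  else a ⟨j + q - 1, by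
    have h1 : (j : ℕ) ≠ i := fun e => heq (Fin.ext e)
    have h2 : ¬ (j : ℕ) < i := fun e => hlt (Fin.lt_def.2 e)
    omega⟩

theorem insertArg_update {p q r : ℕ} (h : p + q = r + 1) (i : Fin p) (g : Cochain k A q)
    (a : Fin r → A) (m : Fin r) :
    ∃ (j : Fin p) (L : A →ₗ[k] A), ∀ x,
      insertArg h i g (Function.update a m x) = Function.update (insertArg h i g a) j (L x) := by
  by_cases h1 : (m : ℕ) < i
  · refine ⟨⟨m, by omega⟩, LinearMap.id, fun x => ?_⟩
    funext j
    simp only [insertArg, Function.update_apply, Fin.ext_iff, Fin.lt_def, LinearMap.id_apply]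
    by_cases hj : (j : ℕ) < i
    · simp [hj]
    · have hjm : ¬ (j : ℕ) = m := by omega
      by_cases hji : (j : ℕ) = i
      · simp only [hji, dif_pos]
        rw [if_neg (by omega)]
        simp only [lt_self_iff_false, dif_neg, not_false_eq_true]
        congr 1
        funext l
        rw [if_neg (by omega)]
      · simp only [hj, hji, dif_neg, not_false_eq_true]
        rw [if_neg (by omega), if_neg hjm]
  · by_cases h2 : (m : ℕ) < i + q
    · have hml : (m : ℕ) - i < q := by omega
      refine ⟨i, g.toLinearMap (fun l => a ⟨i + l, by omega⟩) ⟨m - i, hml⟩, fun x => ?_⟩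
      funext j
      simp only [insertArg, Function.update_apply, Fin.ext_iff, Fin.lt_def,
        MultilinearMap.toLinearMap_apply]
      by_cases hj : (j : ℕ) < i
      · simp only [hj, dif_pos]
        rw [if_neg (by omega), if_neg (by omega)]
      · by_cases hji : (j : ℕ) = i
        · simp only [hji, lt_self_iff_false, dif_neg, dif_pos, not_false_eq_true, if_true]
          congr 1
          funext l
          simp only [Function.update_apply, Fin.ext_iff]
          by_cases hl : (l : ℕ) = m - i
          · rw [if_pos (by omega), if_pos hl]
          · rw [if_neg (by omega), if_neg hl]
        · simp only [hj, hji, dif_neg, not_false_eq_true, if_false]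
          rw [if_neg (by omega)]
    · refine ⟨⟨m + 1 - q, by omega⟩, LinearMap.id, fun x => ?_⟩
      funext j
      simp only [insertArg, Function.update_apply, Fin.ext_iff, Fin.lt_def, LinearMap.id_apply]
      by_cases hj : (j : ℕ) < i
      · simp only [hj, dif_pos]
        rw [if_neg (by omega), if_neg (by omega)]
      · by_cases hji : (j : ℕ) = i
        · simp only [hji, lt_self_iff_false, dif_neg, dif_pos, not_false_eq_true]
          rw [if_neg (by omega)]
          congr 1
          funext l
          rw [if_neg (by omega)]
        · simp only [hj, hji, dif_neg, not_false_eq_true]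
          by_cases hjm : (j : ℕ) = m + 1 - q
          · rw [if_pos (by omega), if_pos hjm]
          · rw [if_neg (by omega), if_neg hjm]

/-- The insertion `f ∘_i g`, with `i` counted from `0` and from the left:
`(f ∘_i g)(a_0, …, a_{r-1}) = f (a_0, …, a_{i-1}, g (a_i, …, a_{i+q-1}), a_{i+q}, …, a_{r-1})`. -/
def insertion {p q r : ℕ} (h : p + q = r + 1) (i : Fin p) (f : Cochain k A p) (g : Cochain k A q) :
    Cochain k A r :=
  MultilinearMap.mk' (fun a => f (insertArg h i g a))
    (fun a m x y => by
      obtain ⟨j, L, hL⟩ := insertArg_update h i g a m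
      simp only [hL, map_add, MultilinearMap.map_update_add])
    (fun a m c x => by
      obtain ⟨j, L, hL⟩ := insertArg_update h i g a m
      simp only [hL, map_smul, MultilinearMap.map_update_smul])

variable (k A) in
/-- The multiplication of `A` as a 2-cochain `μ (a, b) = a b`. -/
def mulCochain : Cochain k A 2 := MultilinearMap.mkPiAlgebraFin k 2 A

/-- `(a_0, …, a_n) ↦ a_0 f (a_1, …, a_n)` -/
def firstFace {n : ℕ} (f : Cochain k A n) : Cochain k A (n + 1) :=
  LinearMap.uncurryLeft (M := fun _ : Fin (n + 1) => A)
    { toFun := fun a => (LinearMap.mulLeft k a).compMultilinearMap f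
      map_add' := fun a b => by ext v; simp [add_mul]
      map_smul' := fun c a => by ext v; simp }

/-- `(a_0, …, a_n) ↦ f (a_0, …, a_{n-1}) a_n` -/
def lastFace {n : ℕ} (f : Cochain k A n) : Cochain k A (n + 1) :=
  MultilinearMap.uncurryRight (M := fun _ : Fin (n + 1) => A)
    ((LinearMap.mul k A).compMultilinearMap f)

/-- The Hochschild differential `C^n(A, A) → C^{n+1}(A, A)`,
`(d f)(a_0, …, a_n) = a_0 f (a_1, …, a_n) + ∑_{i < n} (-1)^{i+1} f (…, a_i a_{i+1}, …)
  + (-1)^{n+1} f (a_0, …, a_{n-1}) a_n`. -/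
def d (n : ℕ) : Cochain k A n →ₗ[k] Cochain k A (n + 1) where
  toFun f := firstFace f
    + ∑ i : Fin n, (-1 : k) ^ ((i : ℕ) + 1) • insertion (p := n) (q := 2) (r := n + 1) rfl i f (mulCochain k A)
    + (-1 : k) ^ (n + 1) • lastFace f
  map_add' f g := by
    ext a
    simp only [firstFace, insertion, lastFace, _root_.add_apply, _root_.sum_apply,
      _root_.smul_apply, MultilinearMap.mk'_apply, LinearMap.uncurryLeft_apply,
      MultilinearMap.uncurryRight_apply, LinearMap.coe_mk, AddHom.coe_mk,
      LinearMap.compMultilinearMap_apply, LinearMap.mulLeft_apply, LinearMap.mul_apply', mul_add,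
      add_mul, smul_add, Finset.sum_add_distrib]
    abel
  map_smul' c f := by
    ext a
    simp only [firstFace, insertion, lastFace, _root_.add_apply, _root_.sum_apply,
      _root_.smul_apply, MultilinearMap.mk'_apply, LinearMap.uncurryLeft_apply,
      MultilinearMap.uncurryRight_apply, LinearMap.coe_mk, AddHom.coe_mk,
      LinearMap.compMultilinearMap_apply, LinearMap.mulLeft_apply, LinearMap.mul_apply',
      smul_add, RingHom.id_apply, Finset.smul_sum, mul_smul_comm, smul_mul_assoc]
    simp only [smul_comm c]

/-- The cup product `(f ⌣ g)(a_0, …, a_{p+q-1}) = f (a_0, …, a_{p-1}) g (a_p, …, a_{p+q-1})`. -/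
def cup {p q : ℕ} (f : Cochain k A p) (g : Cochain k A q) : Cochain k A (p + q) :=
  ((LinearMap.mul' k A).compMultilinearMap (f.domCoprod g)).domDomCongr finSumFinEquiv

/-- The circle product `∑_{i=1}^{p} (-1)^{(p-i)(q-1)} f ∘_i g`, where `∘_i` is insertion into the
`i`-th slot from the left. Numbering the slots from the right instead, the sign is
`(-1)^{(i-1)(q-1)}`. The summation index below is `i - 1`; only parities of exponents matter. -/
def circ {p q r : ℕ} (h : p + q = r + 1) (f : Cochain k A p) (g : Cochain k A q) : Cochain k A r :=
  ∑ i : Fin p, (-1 : k) ^ ((p + 1 + (i : ℕ)) * (q + 1)) • insertion h i f g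

/-- The Gerstenhaber bracket `{f, g} = f ∘ g - (-1)^{(p-1)(q-1)} g ∘ f` of cochains, of degree
`r = p + q - 1`. With the signs of `circ` it induces on cohomology a left graded Lie bracket
satisfying the left Leibniz rule for the (unsigned) cup product. -/
def gBracket {p q r : ℕ} (h : p + q = r + 1) (f : Cochain k A p) (g : Cochain k A q) :
    Cochain k A r :=
  circ h f g - (-1 : k) ^ ((p + 1) * (q + 1)) • circ ((add_comm q p).trans h) g f

/-! Evaluation formulas. -/

theorem mulCochain_apply (a : Fin 2 → A) : mulCochain k A a = a 0 * a 1 := by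
  simp [mulCochain]

theorem insertion_apply {p q r : ℕ} (h : p + q = r + 1) (i : Fin p) (f : Cochain k A p)
    (g : Cochain k A q) (a : Fin r → A) : insertion h i f g a = f (insertArg h i g a) := rfl

theorem cup_apply {p q : ℕ} (f : Cochain k A p) (g : Cochain k A q) (a : Fin (p + q) → A) :
    cup f g a = f (fun i => a (Fin.castAdd q i)) * g (fun j => a (Fin.natAdd p j)) := by
  simp [cup]

theorem d_apply (n : ℕ) (f : Cochain k A n) (a : Fin (n + 1) → A) :
    d n f a = a 0 * f (Fin.tail a)
      + ∑ i : Fin n, (-1 : k) ^ ((i : ℕ) + 1) •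
          f (insertArg (p := n) (q := 2) (r := n + 1) rfl i (mulCochain k A) a)
      + (-1 : k) ^ (n + 1) • (f (Fin.init a) * a (Fin.last n)) := by
  simp [d, firstFace, lastFace, insertion]

/-! ### Hochschild cohomology -/

variable (k A)

/-- Hochschild cocycles. -/
def cocycles (n : ℕ) : Submodule k (Cochain k A n) := LinearMap.ker (d n)

/-- Hochschild coboundaries. -/
def coboundaries : (n : ℕ) → Submodule k (Cochain k A n)
  | 0 => ⊥
  | n + 1 => LinearMap.range (d n)

/-- The Hochschild cohomology group `H^n(A, A)`: cocycles modulo coboundaries. -/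
def HH (n : ℕ) := cocycles k A n ⧸ (coboundaries k A n).submoduleOf (cocycles k A n)

instance (n : ℕ) : AddCommGroup (HH k A n) :=
  inferInstanceAs
    (AddCommGroup (cocycles k A n ⧸ (coboundaries k A n).submoduleOf (cocycles k A n)))

instance (n : ℕ) : Module k (HH k A n) :=
  inferInstanceAs (Module k (cocycles k A n ⧸ (coboundaries k A n).submoduleOf (cocycles k A n)))

/-- The total Hochschild cohomology `⨁_n H^n(A, A)`. -/
abbrev TotalHH := ⨁ n : ℕ, HH k A n

/-- `H^n(A, A)` as a submodule of the total cohomology. -/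
def grading (n : ℕ) : Submodule k (TotalHH k A) :=
  LinearMap.range (DirectSum.lof k ℕ (HH k A) n)

variable {k A}

/-- The projection from cocycles to cohomology. -/
def proj (n : ℕ) : cocycles k A n →ₗ[k] HH k A n :=
  ((coboundaries k A n).submoduleOf (cocycles k A n)).mkQ

/-- The cohomology class of a cocycle, in the total cohomology. -/
def cls {n : ℕ} (f : cocycles k A n) : TotalHH k A :=
  DirectSum.lof k ℕ (HH k A) n (proj n f)

/-- The given Gerstenhaber algebra structure on Hochschild cohomology is the canonical one: its
product is induced by the cup product, its bracket by the Gerstenhaber bracket (and its unit is the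
class of `1 ∈ A = C^0(A, A)`). -/
structure IsCanonical (S : GerstenhaberAlgebra k (TotalHH k A) (grading k A)) : Prop where
  one_eq : ∃ h : MultilinearMap.constOfIsEmpty k (fun _ : Fin 0 => A) (1 : A) ∈ cocycles k A 0,
    S.one = cls ⟨_, h⟩
  mul_cls : ∀ {p q : ℕ} (f : cocycles k A p) (g : cocycles k A q),
    ∃ h : cup (f : Cochain k A p) (g : Cochain k A q) ∈ cocycles k A (p + q),
      S.mul (cls f) (cls g) = cls ⟨_, h⟩
  bracket_cls : ∀ {p q r : ℕ} (e : p + q = r + 1) (f : cocycles k A p) (g : cocycles k A q),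
    ∃ h : gBracket e (f : Cochain k A p) (g : Cochain k A q) ∈ cocycles k A r,
      S.bracket (cls f) (cls g) = cls ⟨_, h⟩

end Hochschild

/-! ### Frobenius algebras -/

section Frobenius

variable {k : Type*} {A : Type*} [Field k] [Ring A] [Algebra k A]

/-- `ε` is a Frobenius functional on `A`: the map `A → A^*`, `a ↦ ε (a · )`, is bijective. -/
def IsFrobeniusFunctional (ε : A →ₗ[k] k) : Prop :=
  Function.Bijective (fun a : A => (ε ∘ₗ LinearMap.mulLeft k a : Module.Dual k A))

/-- `σ` is the Nakayama automorphism of `A` belonging to `ε`: `ε (a b) = ε (σ(b) a)`. -/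
def IsNakayamaAutomorphism (ε : A →ₗ[k] k) (σ : A ≃ₐ[k] A) : Prop :=
  ∀ a b : A, ε (a * b) = ε (σ b * a)

open Classical in
/-- `σ` is diagonalisable over `k`: `A` is the direct sum of the eigenspaces
`A_λ = {a | σ a = λ a}`, `λ ∈ Σ`, for a set `Σ` of nonzero scalars. -/
def IsDiagonalisable (σ : A ≃ₐ[k] A) : Prop :=
  ∃ S : Set k, (0 : k) ∉ S ∧
    DirectSum.IsInternal (fun c : S => Module.End.eigenspace (σ.toLinearMap : Module.End k A) c)

end Frobenius

/-! The Frobenius functional identifies an `n`-cochain `h` with the `(n + 1)`-linear form `ε (h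
(x_0, …, x_{n-1}) x_n)` (`form`). By the Nakayama relation the Hochschild differential becomes a
cyclic differential in which an argument carried around the end picks up `σ⁻¹` (`form_dS`). Hence a
Connes type operator is available: the signed sum of all rotations `ε (h (x_u, …, x_{n-1}, σ⁻¹ x_0,
…, σ⁻¹ x_{u-1}))` is an `n`-linear form (`rotSum`), and thus the form of an `(n - 1)`-cochain `b`,
which represents `B h` up to sign.

A full turn applies `σ⁻¹` to every argument, so the rotation sum is compatible with the differential
only up to conjugation by `σ` (`dForm_rotSum`). This defect is used twice. On `σ`-invariant cochains
it vanishes, so `B` is defined there. On all cocycles it shows that conjugation acts trivially on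
cohomology (`isBoundary_twist_sub`). Diagonalisability makes conjugation semisimple on cochains:
with `D` denoting conjugation minus the identity, cochains split into the kernel and the image of
`D`. Hence every class has an invariant representative (`exists_invariant_cocycle`), and an
invariant coboundary has an invariant primitive (`exists_invariant_cochain`). So `B` descends to all
of cohomology.

The square of `B` vanishes because the form of `b` is cyclically invariant up to sign: this
identifies `rotSum b`, up to sign, with the rotation sum of the differential of `b (1, ·)`
(`isBoundary_rotSum_rotSum`). For the bracket, each rotation of `f ⌣ g` leaves the arguments of `f`
or those of `g` in one piece (`rotSum_cupS`). A homotopy built from rotations of the insertions `f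
∘_v g` compares each half with one circle product and one cup product with `B f` or `B g`
(`dForm_rotHomotopy`); together they give the BV relation (`isBoundary_rotSum_cupS`).

The Gerstenhaber structure is the classical one and uses neither `ε` nor `σ`. The differential of `f
∘_v g` is computed by sorting cofaces (`dS_pcomp`); summing over `v` telescopes and yields the
homotopy for graded commutativity (`dS_circS`). The circle product is pre-Lie (`circS_circS`), which
gives the Jacobi identity on cochains, and a double insertion gives the Leibniz rule up to homotopy
(`dS_leibnizHomotopy`).

Cochains are handled as functions of infinite sequences that see only an initial segment. Degrees
then stay out of the types, and no identity needs a transport between different `Fin n`. -/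

namespace Hochschild

/-! ### Cochains as functions of infinite sequences -/

section SeqFun

/-- Functions of a sequence; a cochain of degree `n` is seen as a function of the first `n` terms. -/
abbrev SeqFun (A : Type*) := (ℕ → A) → A

/-- Replace the terms `v, …, v + q - 1` of `x` by the single term `y`. -/
def ins {A : Type*} (q v : ℕ) (y : A) (x : ℕ → A) : ℕ → A := fun j =>
  if j < v then x j else if j = v then y else x (j + q - 1)

/-- The partial composition `f ∘_v g`, where `g` has arity `q`. -/
def pcomp {A : Type*} (q v : ℕ) (f g : SeqFun A) : SeqFun A := fun x =>
  f (ins q v (g fun l => x (v + l)) x)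

/-- `g` only depends on the first `q` terms. -/
def HasArity {A : Type*} (q : ℕ) (g : SeqFun A) : Prop :=
  ∀ x y : ℕ → A, (∀ l < q, x l = y l) → g x = g y

/-- Nested insertion: `h` goes into a slot that belongs to `g`. Together with the parallel law
below, this is all of the operad structure that the proof needs. -/
theorem pcomp_pcomp_seq {A : Type*} {q i j : ℕ} (r : ℕ) {m : ℕ} (hm : m + 1 = q + r) (hj : j < q)
    (f g h : SeqFun A) :
    pcomp r (i + j) (pcomp q i f g) h = pcomp m i f (pcomp r j g h) := by
  funext x
  simp only [pcomp]
  congr 1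
  funext l
  simp only [ins]
  rcases lt_trichotomy l i with hl | hl | hl
  · simp [hl, show l < i + j by omega]
  · subst hl
    simp only [lt_irrefl, if_false, if_true]
    congr 1
    funext a
    simp only [ins, add_assoc]
    rcases lt_trichotomy a j with ha | ha | ha
    · simp [ha]
    · simp [ha]
    · rw [if_neg (by omega), if_neg (by omega), if_neg (by omega), if_neg (by omega)]
      congr 1
      omega
  · rw [if_neg (by omega), if_neg (by omega), if_neg (by omega), if_neg (by omega),
      if_neg (by omega), if_neg (by omega)]
    congr 1
    omega

theorem pcomp_pcomp_par {A : Type*} {q i j : ℕ} (r : ℕ) {m : ℕ} (hm : m + 1 = j + q) (hij : i < j)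
    (f h : SeqFun A) {g : SeqFun A} (hg : HasArity q g) :
    pcomp r m (pcomp q i f g) h = pcomp q i (pcomp r j f h) g := by
  funext x
  simp only [pcomp]
  congr 1
  funext l
  simp only [ins]
  rcases lt_trichotomy l i with hl | hl | hl
  · simp [hl, show l < j by omega, show l < m by omega]
  · subst hl
    simp only [lt_irrefl, if_false, if_true, hij]
    -- Beyond its first `q` terms the sequence fed to `g` runs into the value of `h`; the arity of
    -- `g` makes this invisible.
    apply hg
    intro a ha
    rw [if_pos (by omega)]
  · rw [if_neg (by omega), if_neg (by omega)]
    rcases lt_trichotomy l j with hl' | hl' | hl'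
    · rw [if_pos (by omega), if_pos hl', if_neg (by omega), if_neg (by omega)]
    · rw [if_neg (by omega), if_pos (by omega), if_neg (by omega), if_pos hl']
      congr 1
      funext a
      rw [if_neg (by omega), if_neg (by omega)]
      congr 1
      omega
    · rw [if_neg (by omega), if_neg (by omega), if_neg (by omega), if_neg (by omega),
        if_neg (by omega), if_neg (by omega)]
      congr 1
      omega

variable {k A : Type*} [CommRing k] [Ring A] [Algebra k A]

/-- The multiplication as a function of sequences. -/
def mulS (A : Type*) [Ring A] : SeqFun A := fun x => x 0 * x 1

theorem hasArity_mulS : HasArity 2 (mulS A) := fun x y h => by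
  simp [mulS, h 0, h 1]

variable (k) in
/-- Partial composition is linear in the outer function. -/
def pcompL (q v : ℕ) (g : SeqFun A) : SeqFun A →ₗ[k] SeqFun A where
  toFun f := pcomp q v f g
  map_add' _ _ := rfl
  map_smul' _ _ := rfl

theorem pcompL_apply (q v : ℕ) (f g : SeqFun A) : pcompL k q v g f = pcomp q v f g := rfl

/-- The cup product of functions of sequences; `f` has arity `p`. -/
def cupS (p : ℕ) (f g : SeqFun A) : SeqFun A := fun x => f x * g fun l => x (p + l)

variable (k) in
/-- The cofaces of the Hochschild complex. -/
def coface (n i : ℕ) : SeqFun A →ₗ[k] SeqFun A where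
  toFun f := if i = 0 then pcomp n 1 (mulS A) f else
    if i = n + 1 then pcomp n 0 (mulS A) f else pcomp 2 (i - 1) f (mulS A)
  map_add' f g := by
    split_ifs
    · funext x; simp [pcomp, ins, mulS, mul_add]
    · funext x; simp [pcomp, ins, mulS, add_mul]
    · rfl
  map_smul' c f := by
    split_ifs
    · funext x; simp [pcomp, ins, mulS]
    · funext x; simp [pcomp, ins, mulS]
    · rfl

theorem coface_zero (n : ℕ) (f : SeqFun A) : coface k n 0 f = pcomp n 1 (mulS A) f := by
  simp [coface]

theorem coface_last (n : ℕ) (f : SeqFun A) : coface k n (n + 1) f = pcomp n 0 (mulS A) f := by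
  simp [coface]

theorem coface_succ {n i : ℕ} (h : i < n) (f : SeqFun A) :
    coface k n (i + 1) f = pcomp 2 i f (mulS A) := by
  simp [coface, h.ne]

theorem coface_zero_apply (n : ℕ) (f : SeqFun A) (x : ℕ → A) :
    coface k n 0 f x = x 0 * f fun l => x (1 + l) := by
  simp [coface_zero, pcomp, ins, mulS]

theorem coface_last_apply (n : ℕ) (f : SeqFun A) (x : ℕ → A) :
    coface k n (n + 1) f x = f x * x n := by
  simp [coface_last, pcomp, ins, mulS]

variable (k) in
/-- The part `∑_{i ≤ w} (-1)^i δ_i` of the Hochschild differential. -/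
def lowD (n w : ℕ) : SeqFun A →ₗ[k] SeqFun A :=
  ∑ i ∈ Finset.range (w + 1), (-1 : k) ^ i • coface k n i

variable (k) in
/-- The Hochschild differential on functions of sequences. -/
def dS (n : ℕ) : SeqFun A →ₗ[k] SeqFun A := lowD k n (n + 1)

theorem lowD_apply (n w : ℕ) (f : SeqFun A) :
    lowD k n w f = ∑ i ∈ Finset.range (w + 1), (-1 : k) ^ i • coface k n i f := by
  simp [lowD]

theorem lowD_zero (n : ℕ) (f : SeqFun A) : lowD k n 0 f = coface k n 0 f := by
  simp [lowD_apply]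

theorem lowD_succ (n w : ℕ) (f : SeqFun A) :
    lowD k n (w + 1) f = lowD k n w f + (-1 : k) ^ (w + 1) • coface k n (w + 1) f := by
  rw [lowD_apply, lowD_apply, Finset.sum_range_succ]

theorem dS_eq (n : ℕ) (f : SeqFun A) : dS k n f = pcomp n 1 (mulS A) f
    + ∑ i ∈ Finset.range n, (-1 : k) ^ (i + 1) • pcomp 2 i f (mulS A)
    + (-1 : k) ^ (n + 1) • pcomp n 0 (mulS A) f := by
  rw [dS, lowD_apply, Finset.sum_range_succ, Finset.sum_range_succ', coface_last, coface_zero]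
  rw [pow_zero, one_smul, add_comm (pcomp n 1 _ _)]
  congr 2
  exact Finset.sum_congr rfl fun i hi => by rw [coface_succ (Finset.mem_range.1 hi)]

/-! Compatibility of cofaces and partial compositions. -/

/-- Every coface is a partial composition with the multiplication, so this identity and the next
four are cases of the two associativity laws. They sort cofaces into those left of, inside and right
of the slot of `g`; the outer cofaces of `g` match the coface `v + 1` of `f`, seen from slot `v + 1`
or `v`. -/
theorem pcomp_coface_lt {p q n i v : ℕ} (hn : p + q = n + 1) (hi : i ≤ v) (hv : v < p)
    (f g : SeqFun A) :
    pcomp q (v + 1) (coface k p i f) g = coface k n i (pcomp q v f g) := by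
  rcases i with _ | i
  · rw [coface_zero, coface_zero, add_comm v, pcomp_pcomp_seq q hn.symm hv]
  · rw [coface_succ (by omega), coface_succ (by omega),
      pcomp_pcomp_par (j := v) (m := v + 1) q (by omega) (by omega) _ _ hasArity_mulS]

theorem pcomp_coface_self {p q v : ℕ} (hv : v < p) (f g : SeqFun A) :
    pcomp q (v + 1) (coface k p (v + 1) f) g = pcomp (q + 1) v f (coface k q 0 g) := by
  rw [coface_succ hv, coface_zero, pcomp_pcomp_seq q (m := q + 1) (by omega) (by omega)]

theorem pcomp_coface_succ {p q v : ℕ} (hv : v < p) (f g : SeqFun A) :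
    pcomp q v (coface k p (v + 1) f) g = pcomp (q + 1) v f (coface k q (q + 1) g) := by
  have := pcomp_pcomp_seq (i := v) (j := 0) q (m := q + 1) (by omega) two_pos f (mulS A) g
  rw [coface_succ hv, coface_last, ← this, add_zero]

theorem pcomp_coface_gt {p q n i v : ℕ} (hn : p + q = n + 1) (hi : v + 1 ≤ i) (hip : i ≤ p)
    (f : SeqFun A) {g : SeqFun A} (hg : HasArity q g) :
    pcomp q v (coface k p (i + 1) f) g = coface k n (i + q) (pcomp q v f g) := by
  rcases hip.eq_or_lt with rfl | hip
  · rw [hn, coface_last, coface_last]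
    have := pcomp_pcomp_seq (i := 0) (j := v) q hn.symm hi (mulS A) f g
    rwa [zero_add] at this
  · obtain ⟨j, rfl⟩ : ∃ j, i = j + 1 := ⟨i - 1, by omega⟩
    rw [coface_succ hip, show j + 1 + q = (j + q) + 1 by omega, coface_succ (by omega)]
    exact (pcomp_pcomp_par 2 (by omega) (by omega) _ _ hg).symm

theorem pcomp_coface_right {p q n i v : ℕ} (hn : p + q = n + 1) (hi : i < q) (hv : v < p)
    (f g : SeqFun A) :
    pcomp (q + 1) v f (coface k q (i + 1) g) = coface k n (v + i + 1) (pcomp q v f g) := by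
  rw [coface_succ hi, coface_succ (by omega), pcomp_pcomp_seq 2 (m := q + 1) (by omega) hi]

/-- Here and in the next lemma an outer coface has a slot outside `f`. Filling it with `g` produces
a cup product, and this is how cup products enter the boundary terms of all telescoping sums. -/
theorem pcomp_coface_zero_zero (p q : ℕ) (f g : SeqFun A) :
    pcomp q 0 (coface k p 0 f) g = cupS q g f := by
  funext x
  simp only [coface_zero, pcomp, ins, mulS, cupS]
  simp only [lt_irrefl, if_false, zero_lt_one, if_true, one_ne_zero, zero_add]
  congr 2
  funext l
  rw [if_neg (by omega), if_neg (by omega)]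
  congr 1; omega

theorem pcomp_coface_last_last {p : ℕ} (q : ℕ) {f : SeqFun A} (hf : HasArity p f) (g : SeqFun A) :
    pcomp q p (coface k p (p + 1) f) g = cupS p f g := by
  funext x
  simp only [coface_last, pcomp, ins, mulS, cupS]
  simp only [lt_irrefl, if_false, one_ne_zero, zero_add, if_true, add_tsub_cancel_left]
  congr 1
  apply hf
  intro l hl
  simp [hl]

end SeqFun

/-! ### Cochains -/

section Cochains

variable {k A : Type*} [CommRing k] [Ring A] [Algebra k A]

/-- A cochain as a function of sequences. -/
def ev (n : ℕ) : Cochain k A n →ₗ[k] SeqFun A where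
  toFun f := fun x => f fun i => x i
  map_add' _ _ := rfl
  map_smul' _ _ := rfl

theorem ev_apply {n : ℕ} (f : Cochain k A n) (x : ℕ → A) : ev n f x = f fun i => x i := rfl

/-- Extend a finite sequence by zero. -/
def padZero {n : ℕ} (a : Fin n → A) : ℕ → A := fun j => if h : j < n then a ⟨j, h⟩ else 0

theorem padZero_apply {n : ℕ} (a : Fin n → A) (i : Fin n) : padZero a i = a i := by
  simp [padZero]

theorem ev_padZero {n : ℕ} (f : Cochain k A n) (a : Fin n → A) : ev n f (padZero a) = f a := by
  simp [ev_apply, padZero_apply]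

theorem ev_injective (n : ℕ) : Function.Injective (ev (k := k) (A := A) n) := fun f g h => by
  ext a
  rw [← ev_padZero, h, ev_padZero]

theorem hasArity_ev {n : ℕ} (f : Cochain k A n) : HasArity n (ev n f) := fun x y h => by
  simp only [ev_apply]
  congr 1
  funext i
  exact h i i.2

theorem ev_insertion {p q r : ℕ} (h : p + q = r + 1) (i : Fin p) (f : Cochain k A p)
    (g : Cochain k A q) : ev r (insertion h i f g) = pcomp q i (ev p f) (ev q g) := by
  funext x
  simp only [ev_apply, insertion_apply, pcomp]
  congr 1
  funext j
  simp only [insertArg, ins, Fin.lt_def, Fin.ext_iff]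
  split_ifs <;> rfl

theorem ev_mulCochain : ev 2 (mulCochain k A) = mulS A := by
  funext x
  simp [ev_apply, mulCochain_apply, mulS]

theorem ev_cup {p q : ℕ} (f : Cochain k A p) (g : Cochain k A q) :
    ev (p + q) (cup f g) = cupS p (ev p f) (ev q g) := by
  funext x
  simp [ev_apply, cup_apply, cupS]

theorem ev_d {n : ℕ} (f : Cochain k A n) : ev (n + 1) (d n f) = dS k n (ev n f) := by
  rw [dS_eq, d]
  simp only [LinearMap.coe_mk, AddHom.coe_mk, map_add, map_sum, map_smul, ev_insertion,
    ev_mulCochain]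
  rw [Finset.sum_range fun i => (-1 : k) ^ (i + 1) • pcomp 2 i (ev n f) (mulS A)]
  congr 1
  · congr 1
    funext x
    simp only [ev_apply, firstFace, pcomp, ins, mulS]
    simp [add_comm]
    rfl
  · congr 1
    funext x
    simp only [ev_apply, lastFace, pcomp, ins, mulS]
    simp
    rfl

/-- Linearity in the inner function, unlike that in the outer one, rests on the multilinearity of
`f`. The existential form supplies a linear map to which `map_sum` and `map_smul` apply. -/
theorem pcomp_ev_linear {p : ℕ} (f : Cochain k A p) (q : ℕ) {v : ℕ} (hv : v < p) :
    ∃ L : SeqFun A →ₗ[k] SeqFun A, ∀ g, L g = pcomp q v (ev p f) g := by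
  have key : ∀ (y : A) (x : ℕ → A), ev p f (ins q v y x)
      = f (Function.update (fun i : Fin p => ins q v 0 x i) ⟨v, hv⟩ y) := fun y x => by
    simp only [ev_apply]
    congr 1
    funext i
    simp only [ins, Function.update_apply, Fin.ext_iff]
    split_ifs <;> first | rfl | omega
  refine ⟨{ toFun := pcomp q v (ev p f), map_add' := ?_, map_smul' := ?_ }, fun g => rfl⟩
  · intro g h; funext x; simp [pcomp, key]
  · intro c g; funext x; simp [pcomp, key]

variable (k) in
/-- The function of sequences comes from a cochain. -/
def IsCochain (p : ℕ) (F : SeqFun A) : Prop := F ∈ LinearMap.range (ev (k := k) (A := A) p)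

theorem isCochain_ev {p : ℕ} (f : Cochain k A p) : IsCochain k p (ev p f) := ⟨f, rfl⟩

theorem IsCochain.hasArity {p : ℕ} {F : SeqFun A} (h : IsCochain k p F) : HasArity p F := by
  obtain ⟨f, rfl⟩ := h
  exact hasArity_ev f

theorem IsCochain.linear {p : ℕ} {F : SeqFun A} (h : IsCochain k p F) (q : ℕ) {v : ℕ}
    (hv : v < p) : ∃ L : SeqFun A →ₗ[k] SeqFun A, ∀ g, L g = pcomp q v F g := by
  obtain ⟨f, rfl⟩ := h
  exact pcomp_ev_linear f q hv

theorem IsCochain.pcomp {p q r v : ℕ} {F G : SeqFun A} (h : p + q = r + 1) (hv : v < p)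
    (hF : IsCochain k p F) (hG : IsCochain k q G) : IsCochain k r (pcomp q v F G) := by
  obtain ⟨f, rfl⟩ := hF
  obtain ⟨g, rfl⟩ := hG
  exact ⟨insertion h ⟨v, hv⟩ f g, ev_insertion h _ f g⟩

theorem IsCochain.cupS {p q r : ℕ} {F G : SeqFun A} (h : p + q = r)
    (hF : IsCochain k p F) (hG : IsCochain k q G) : IsCochain k r (cupS p F G) := by
  obtain ⟨f, rfl⟩ := hF
  obtain ⟨g, rfl⟩ := hG
  subst h
  exact ⟨cup f g, ev_cup f g⟩

theorem IsCochain.dS {n : ℕ} {F : SeqFun A} (hF : IsCochain k n F) :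
    IsCochain k (n + 1) (dS k n F) := by
  obtain ⟨f, rfl⟩ := hF
  exact ⟨d n f, ev_d f⟩

end Cochains

end Hochschild

/-! ### Homotopies for insertions and the pre-Lie identity. -/

namespace Hochschild

section Homotopies

variable {k A : Type*} [CommRing k] [Ring A] [Algebra k A]

theorem pcomp_lowD {p q n v : ℕ} (hn : p + q = n + 1) (hv : v < p) (f g : SeqFun A) :
    pcomp q (v + 1) (lowD k p v f) g = lowD k n v (pcomp q v f g) := by
  rw [← pcompL_apply (k := k), lowD_apply, lowD_apply, map_sum]
  refine Finset.sum_congr rfl fun i hi => ?_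
  rw [map_smul, pcompL_apply, pcomp_coface_lt hn (by simpa [Nat.lt_succ_iff] using hi) hv]

theorem pcomp_lowD_succ {p q n v : ℕ} (hn : p + q = n + 1) (hv : v < p) (f g : SeqFun A) :
    pcomp q (v + 1) (lowD k p (v + 1) f) g =
      lowD k n v (pcomp q v f g) - (-1 : k) ^ v • pcomp (q + 1) v f (coface k q 0 g) := by
  rw [lowD_succ, ← pcompL_apply (k := k), map_add, map_smul, pcompL_apply, pcompL_apply,
    pcomp_lowD hn hv, pcomp_coface_self hv]
  module

/-- The differential of a partial composition. -/
theorem dS_pcomp {p q n v : ℕ} (hn : p + q = n + 1) (hv : v < p) {f g : SeqFun A}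
    (hf : IsCochain k p f) (hg : HasArity q g) :
    dS k n (pcomp q v f g) = pcomp q (v + 1) (lowD k p (v + 1) f) g
      + (-1 : k) ^ (q + 1) • (pcomp q v (dS k p f) g - pcomp q v (lowD k p v f) g)
      + (-1 : k) ^ v • pcomp (q + 1) v f (dS k q g) := by
  obtain ⟨m, rfl⟩ : ∃ m, p = v + 1 + m := ⟨p - (v + 1), by omega⟩
  have e1 := pcomp_lowD_succ (k := k) hn hv f g
  -- The inner cofaces of `g` are the cofaces `v + 1, …, v + q` of the composite.
  have e2 : pcomp (q + 1) v f (dS k q g) = pcomp (q + 1) v f (coface k q 0 g)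
      + ∑ j ∈ Finset.range q, (-1 : k) ^ (j + 1) • coface k n (v + j + 1) (pcomp q v f g)
      + (-1 : k) ^ (q + 1) • pcomp (q + 1) v f (coface k q (q + 1) g) := by
    obtain ⟨L, hL⟩ := hf.linear (q + 1) hv
    rw [← hL, ← hL, ← hL, dS, lowD_apply, Finset.sum_range_succ, Finset.sum_range_succ',
      pow_zero, one_smul, map_add, map_add, map_smul L, map_sum, add_comm (L (coface k q 0 g))]
    congr 2
    refine Finset.sum_congr rfl fun j hj => ?_
    rw [map_smul, hL, pcomp_coface_right hn (Finset.mem_range.1 hj) hv]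
  -- Coface `v + 1` of `f` turns into the last coface of `g`; the later ones act on the composite to
  -- the right of the slot.
  have e3 : pcomp q v (dS k (v + 1 + m) f) g = pcomp q v (lowD k (v + 1 + m) v f) g
      + (-1 : k) ^ (v + 1) • pcomp (q + 1) v f (coface k q (q + 1) g)
      + ∑ j ∈ Finset.range (m + 1), (-1 : k) ^ (v + j) •
          coface k n (v + 1 + q + j) (pcomp q v f g) := by
    rw [← pcompL_apply (k := k), ← pcompL_apply (k := k), dS, lowD_apply,
      show v + 1 + m + 1 + 1 = v + 1 + 1 + (m + 1) by omega, Finset.sum_range_add,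
      ← lowD_apply, lowD_succ, map_add, map_add, map_smul, map_sum, pcompL_apply, pcompL_apply,
      pcomp_coface_succ hv]
    congr 1
    refine Finset.sum_congr rfl fun j hj => ?_
    have hj' := Finset.mem_range.1 hj
    rw [map_smul, pcompL_apply, show v + 1 + 1 + j = (v + 1 + j) + 1 by omega,
      pcomp_coface_gt hn (by omega) (by omega) f hg, show v + 1 + j + q = v + 1 + q + j by omega]
    congr 1
    ring
  -- The `n + 2` cofaces of the composite are the `v + 1` left of the slot, the `q` inside it and
  -- the `m + 1` right of it. The two outer cofaces of `g` cancel between `e1`, `e2` and `e3`.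
  rw [dS, lowD_apply, show n + 1 + 1 = v + 1 + q + (m + 1) by omega, Finset.sum_range_add,
    Finset.sum_range_add, ← lowD_apply, e1, e2, e3]
  have s2 : ∑ j ∈ Finset.range q, (-1 : k) ^ (v + 1 + j) • coface k n (v + 1 + j) (pcomp q v f g)
      = (-1 : k) ^ v • ∑ j ∈ Finset.range q,
        (-1 : k) ^ (j + 1) • coface k n (v + j + 1) (pcomp q v f g) := by
    rw [Finset.smul_sum]
    refine Finset.sum_congr rfl fun j _ => ?_
    rw [smul_smul, ← pow_add, show v + 1 + j = v + j + 1 by omega, add_assoc]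
  have s3 : ∑ j ∈ Finset.range (m + 1), (-1 : k) ^ (v + 1 + q + j) •
        coface k n (v + 1 + q + j) (pcomp q v f g)
      = (-1 : k) ^ (q + 1) • ∑ j ∈ Finset.range (m + 1),
        (-1 : k) ^ (v + j) • coface k n (v + 1 + q + j) (pcomp q v f g) := by
    rw [Finset.smul_sum]
    refine Finset.sum_congr rfl fun j _ => ?_
    rw [smul_smul, ← pow_add, show v + 1 + q + j = q + 1 + (v + j) by omega]
  rw [s2, s3]
  module

theorem neg_one_pow_mul_self (n : ℕ) : (-1 : k) ^ n * (-1) ^ n = 1 := by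
  rw [← pow_add, ← two_mul, pow_mul]; simp

/-- Signs only depend on the parity of the exponent. -/
theorem neg_one_pow_congr {m n : ℕ} (h : (m : ZMod 2) = n) : (-1 : k) ^ m = (-1) ^ n := by
  rw [neg_one_pow_eq_pow_mod_two, neg_one_pow_eq_pow_mod_two (n := n)]
  congr 1
  exact (ZMod.natCast_eq_natCast_iff' m n 2).1 h

/-- Telescoping a sum with signs. -/
theorem sum_telescope {M : Type*} [AddCommGroup M] [Module k M] {e : k} (he : e * e = 1)
    (P : ℕ → M) (n : ℕ) : ∑ v ∈ Finset.range n, e ^ v • (P (v + 1) - e • P v)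
      = e • (e ^ n • P n - P 0) := by
  have := Finset.sum_range_sub (fun v => e ^ v • P v) n
  rw [pow_zero, one_smul] at this
  rw [← this, Finset.smul_sum]
  refine Finset.sum_congr rfl fun v _ => ?_
  linear_combination (norm := module) (-he) • (e ^ v • P (v + 1))

variable (k) in
/-- The circle product on functions of sequences. -/
def circS (p q : ℕ) (f g : SeqFun A) : SeqFun A :=
  ∑ v ∈ Finset.range p, (-1 : k) ^ ((p + 1 + v) * (q + 1)) • pcomp q v f g

/-- With `e = (-1)^(q+1)` the signs form a geometric progression, the shape that `sum_telescope`
requires. -/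
theorem circS_eq (p q : ℕ) (f g : SeqFun A) : circS k p q f g =
    ((-1 : k) ^ (q + 1)) ^ (p + 1) •
      ∑ v ∈ Finset.range p, ((-1 : k) ^ (q + 1)) ^ v • pcomp q v f g := by
  rw [circS, Finset.smul_sum]
  refine Finset.sum_congr rfl fun v _ => ?_
  rw [smul_smul, ← pow_add, ← pow_mul, mul_comm (q + 1)]

theorem lowD_pcomp_last {p : ℕ} (q : ℕ) {f : SeqFun A} (hf : HasArity p f) (g : SeqFun A) :
    pcomp q p (lowD k p p f) g = pcomp q p (dS k p f) g + (-1 : k) ^ p • cupS p f g := by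
  rw [dS, lowD_succ, ← pcompL_apply (k := k) q p (_ + _), map_add, map_smul, pcompL_apply,
    pcompL_apply, pcomp_coface_last_last q hf]
  module

/-- The homotopy that makes the cup product graded commutative. -/
theorem dS_circS {p q n : ℕ} (hn : 0 < p → p + q = n + 1) {f g : SeqFun A}
    (hf : IsCochain k p f) (hg : HasArity q g) :
    dS k n (circS k p q f g) = circS k (p + 1) q (dS k p f) g
      + (-1 : k) ^ (p + 1) • circS k p (q + 1) f (dS k q g)
      + (-1 : k) ^ p • cupS p f g - (-1 : k) ^ ((q + 1) * p) • cupS q g f := by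
  have hd : ∀ v ∈ Finset.range p, _ := fun v hv =>
    dS_pcomp (v := v) (hn (by have := Finset.mem_range.1 hv; omega)) (Finset.mem_range.1 hv) hf hg
  have e4 : (-1 : k) ^ (q + 1 + 1) = (-1) * (-1 : k) ^ (q + 1) := by ring
  -- At its upper end `v = p` the telescope yields `± f ⌣ g` and the insertion into the last slot of
  -- `d f`. The latter is the missing summand of `(d f) ∘ g`, which has `p + 1` terms. The lower end
  -- `v = 0` yields `g ⌣ f`.
  have hlast := lowD_pcomp_last (k := k) q hf.hasArity g
  have hzero : pcomp q 0 (lowD k p 0 f) g = cupS q g f := by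
    rw [lowD_zero, pcomp_coface_zero_zero]
  rw [pow_mul]
  simp only [circS_eq, e4]
  have he := neg_one_pow_mul_self (k := k) (q + 1)
  have hs := neg_one_pow_mul_self (k := k) p
  generalize (-1 : k) ^ (q + 1) = e at *
  have hE : e ^ p * e ^ p = 1 := by rw [← mul_pow, he, one_pow]
  have key : ∑ v ∈ Finset.range p, e ^ v • dS k n (pcomp q v f g)
      = ∑ v ∈ Finset.range p, e ^ v • (pcomp q (v + 1) (lowD k p (v + 1) f) g
          - e • pcomp q v (lowD k p v f) g)
        + e • ∑ v ∈ Finset.range p, e ^ v • pcomp q v (dS k p f) g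
        + ∑ v ∈ Finset.range p, (-1 * e) ^ v • pcomp (q + 1) v f (dS k q g) := by
    rw [Finset.smul_sum, ← Finset.sum_add_distrib, ← Finset.sum_add_distrib]
    refine Finset.sum_congr rfl fun v hv => ?_
    rw [hd v hv, mul_pow]
    module
  rw [sum_telescope he fun v => pcomp q v (lowD k p v f) g] at key
  simp only [map_smul, map_sum]
  rw [key, hlast, hzero, Finset.sum_range_succ]
  generalize ∑ v ∈ Finset.range p, (-1 * e) ^ v • pcomp (q + 1) v f (dS k q g) = X
  simp only [pow_succ, mul_pow]
  generalize e ^ p = E at *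
  generalize (-1 : k) ^ p = s at *
  linear_combination (norm := module) (e * e * s * hE + s * he) • cupS p f g
    - (E * he) • cupS q g f
    + (-E * e * hs) • X

/-! ### The pre-Lie identity -/

variable (k) in
/-- The sum of the double compositions `(f ∘_i g) ∘_j h` with `j < i`. -/
def braceS (p q r : ℕ) (f g h : SeqFun A) : SeqFun A :=
  ∑ i ∈ Finset.range p, ∑ j ∈ Finset.range i,
    (((-1 : k) ^ (q + 1)) ^ (p + 1 + i) * ((-1 : k) ^ (r + 1)) ^ (p + q + j)) •
      pcomp r j (pcomp q i f g) h

/-- The second insertion lands left of `g`, inside `g` or right of `g`. Inside, the sequential law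
applies; on the right, the parallel law exchanges the two insertions, so that the one into the
leftmost slot is performed last. -/
theorem sum_pcomp_pcomp {p q r m n i : ℕ} (hn : p + q = n + 1)
    (hm : 0 < q → q + r = m + 1) (hi : i < p)
    (c : ℕ → k) (f h : SeqFun A) {g : SeqFun A} (hg : HasArity q g) :
    ∑ j ∈ Finset.range n, c j • pcomp r j (pcomp q i f g) h
      = ∑ j ∈ Finset.range i, c j • pcomp r j (pcomp q i f g) h
        + ∑ j ∈ Finset.range q, c (i + j) • pcomp m i f (pcomp r j g h)
        + ∑ j ∈ Finset.Ico (i + 1) p, c (j + q - 1) • pcomp q i (pcomp r j f h) g := by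
  rw [show n = i + q + (p - (i + 1)) by omega, Finset.sum_range_add, Finset.sum_range_add,
    Finset.sum_Ico_eq_sum_range]
  congr 1
  · congr 1
    refine Finset.sum_congr rfl fun j hj => ?_
    have := Finset.mem_range.1 hj
    rw [pcomp_pcomp_seq r (hm (by omega)).symm this]
  · refine Finset.sum_congr rfl fun j hj => ?_
    rw [pcomp_pcomp_par r (j := i + 1 + j) (by omega) (by omega) f h hg]
    congr 2
    omega

theorem circS_zero_left (q : ℕ) (f g : SeqFun A) : circS k 0 q f g = 0 := by
  simp [circS]

/-- The associator of the circle product consists of the insertions of `g` and `h` into different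
slots of `f`, hence is graded symmetric in `g` and `h`. The degree relations are conditional because
a circle product with outer degree `0` vanishes whatever degree is assigned to it. -/
theorem circS_circS {p q r m n : ℕ} (hn : 0 < p → p + q = n + 1)
    (hm : 0 < q → q + r = m + 1) {f g h : SeqFun A}
    (hf : IsCochain k p f) (hg : IsCochain k q g) :
    circS k n r (circS k p q f g) h = circS k p m f (circS k q r g h)
      + braceS k p q r f g h
      + (-1 : k) ^ ((q + 1) * (r + 1)) • braceS k p r q f h g := by
  rcases p.eq_zero_or_pos with rfl | hp
  · have h0 : circS k n r (0 : SeqFun A) h = 0 := by simp [circS_eq, ← pcompL_apply (k := k) r]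
    simp [circS_zero_left, h0, braceS]
  replace hn := hn hp
  have h1 : circS k n r (circS k p q f g) h = ∑ i ∈ Finset.range p,
      ((-1 : k) ^ (q + 1)) ^ (p + 1 + i) • ∑ j ∈ Finset.range n,
        ((-1 : k) ^ (r + 1)) ^ (p + q + j) • pcomp r j (pcomp q i f g) h := by
    simp only [circS_eq, ← pcompL_apply (k := k) r, map_smul, map_sum, Finset.smul_sum, ← hn]
    rw [Finset.sum_comm]
    refine Finset.sum_congr rfl fun i _ => Finset.sum_congr rfl fun j _ => ?_
    simp only [hn, pow_add _ _ i, pow_add _ _ j]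
    module
  have h2 : circS k p m f (circS k q r g h) = ∑ i ∈ Finset.range p,
      ((-1 : k) ^ (q + 1)) ^ (p + 1 + i) • ∑ j ∈ Finset.range q,
        ((-1 : k) ^ (r + 1)) ^ (p + q + (i + j)) • pcomp m i f (pcomp r j g h) := by
    -- For `q = 0` the inner circle product is zero and nothing is known about `m`, so the sign
    -- relation `hsgn` is available only for `q > 0`.
    rcases q.eq_zero_or_pos with rfl | hq
    · rw [circS_zero_left, circS_eq]
      refine (smul_eq_zero_of_right _ (Finset.sum_eq_zero fun i hi => ?_)).trans (by simp)
      obtain ⟨L, hL⟩ := hf.linear m (Finset.mem_range.1 hi)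
      rw [← hL, map_zero, smul_zero]
    have hsgn : (-1 : k) ^ (m + 1) = (-1 : k) ^ (q + 1) * (-1 : k) ^ (r + 1) := by
      rw [← hm hq]; ring
    rw [circS_eq, hsgn, Finset.smul_sum]
    refine Finset.sum_congr rfl fun i hi => ?_
    obtain ⟨L, hL⟩ := hf.linear m (Finset.mem_range.1 hi)
    simp only [← hL, circS_eq, map_smul, map_sum]
    simp only [Finset.smul_sum, smul_smul, ← pow_mul, ← pow_add]
    refine Finset.sum_congr rfl fun j _ => ?_
    congr 1
    -- Only parities of exponents matter, so the sign identity becomes a finite check over `ZMod 2`.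
    refine neg_one_pow_congr ?_
    push_cast
    generalize (p : ZMod 2) = p, (q : ZMod 2) = q, (r : ZMod 2) = r, (i : ZMod 2) = i,
      (j : ZMod 2) = j
    revert p q r i j
    decide
  have h3 : (-1 : k) ^ ((q + 1) * (r + 1)) • braceS k p r q f h g = ∑ i ∈ Finset.range p,
      ((-1 : k) ^ (q + 1)) ^ (p + 1 + i) • ∑ j ∈ Finset.Ico (i + 1) p,
        ((-1 : k) ^ (r + 1)) ^ (p + q + (j + q - 1)) • pcomp q i (pcomp r j f h) g := by
    simp only [Finset.smul_sum, braceS]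
    simp only [Finset.range_eq_Ico]
    -- Exchanging the sums makes the slot of `g` the outer index, as in the other two expansions.
    rw [Finset.sum_Ico_Ico_comm']
    refine Finset.sum_congr rfl fun j _ => Finset.sum_congr rfl fun i hi => ?_
    rw [smul_smul, smul_smul]
    congr 1
    obtain ⟨l, rfl⟩ : ∃ l, j = l + 1 := ⟨j - 1, by have := Finset.mem_Ico.1 hi; omega⟩
    rw [show l + 1 + q - 1 = l + q by omega]
    simp only [← pow_mul, ← pow_add]
    refine neg_one_pow_congr ?_
    push_cast
    generalize (p : ZMod 2) = p, (q : ZMod 2) = q, (r : ZMod 2) = r, (l : ZMod 2) = l,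
      (i : ZMod 2) = i
    revert p q r l i
    decide
  have h4 : braceS k p q r f g h = ∑ i ∈ Finset.range p,
      ((-1 : k) ^ (q + 1)) ^ (p + 1 + i) • ∑ j ∈ Finset.range i,
        ((-1 : k) ^ (r + 1)) ^ (p + q + j) • pcomp r j (pcomp q i f g) h := by
    simp only [Finset.smul_sum, braceS, smul_smul]
  rw [h1, h2, h3, h4, ← Finset.sum_add_distrib, ← Finset.sum_add_distrib]
  refine Finset.sum_congr rfl fun i hi => ?_
  rw [sum_pcomp_pcomp hn hm (Finset.mem_range.1 hi)
    (fun j => ((-1 : k) ^ (r + 1)) ^ (p + q + j)) f h hg.hasArity]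
  module

end Homotopies

end Hochschild

/-! ### The Gerstenhaber bracket and the cup product on cochains. -/

namespace Hochschild

section Bracket

variable {k A : Type*} [CommRing k] [Ring A] [Algebra k A]

theorem circS_linear_left (p q : ℕ) (g : SeqFun A) :
    ∃ L : SeqFun A →ₗ[k] SeqFun A, ∀ f, L f = circS k p q f g :=
  ⟨∑ v ∈ Finset.range p, (-1 : k) ^ ((p + 1 + v) * (q + 1)) • pcompL k q v g, fun f => by
    simp [circS, pcompL_apply]⟩

theorem IsCochain.circS_linear {p : ℕ} {f : SeqFun A} (hf : IsCochain k p f) (q : ℕ) :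
    ∃ L : SeqFun A →ₗ[k] SeqFun A, ∀ g, L g = circS k p q f g := by
  choose! L hL using fun v (hv : v < p) => hf.linear q hv
  refine ⟨∑ v ∈ Finset.range p, (-1 : k) ^ ((p + 1 + v) * (q + 1)) • L v, fun g => ?_⟩
  simp only [circS, LinearMap.sum_apply, LinearMap.smul_apply]
  exact Finset.sum_congr rfl fun v hv => by rw [hL v (Finset.mem_range.1 hv)]

theorem isCochain_sum {ι : Type*} {p : ℕ} (s : Finset ι) {F : ι → SeqFun A}
    (h : ∀ i ∈ s, IsCochain k p (F i)) : IsCochain k p (∑ i ∈ s, F i) :=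
  Submodule.sum_mem _ h

theorem IsCochain.smul {p : ℕ} {F : SeqFun A} (h : IsCochain k p F) (c : k) :
    IsCochain k p (c • F) := Submodule.smul_mem _ c h

theorem IsCochain.add {p : ℕ} {F G : SeqFun A} (hF : IsCochain k p F) (hG : IsCochain k p G) :
    IsCochain k p (F + G) := Submodule.add_mem _ hF hG

theorem IsCochain.sub {p : ℕ} {F G : SeqFun A} (hF : IsCochain k p F) (hG : IsCochain k p G) :
    IsCochain k p (F - G) := Submodule.sub_mem _ hF hG

theorem IsCochain.circS {p q n : ℕ} {f g : SeqFun A} (hn : 0 < p → p + q = n + 1)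
    (hf : IsCochain k p f) (hg : IsCochain k q g) : IsCochain k n (circS k p q f g) :=
  isCochain_sum _ fun v hv => by
    have := Finset.mem_range.1 hv
    exact (hf.pcomp (hn (by omega)) this hg).smul _

variable (k) in
/-- The Gerstenhaber bracket on functions of sequences. -/
def bracketS (p q : ℕ) (f g : SeqFun A) : SeqFun A :=
  circS k p q f g - (-1 : k) ^ ((p + 1) * (q + 1)) • circS k q p g f

theorem IsCochain.bracketS {p q n : ℕ} {f g : SeqFun A} (hn : 0 < p + q → p + q = n + 1)
    (hf : IsCochain k p f) (hg : IsCochain k q g) : IsCochain k n (bracketS k p q f g) :=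
  (hf.circS (fun _ => hn (by omega)) hg).sub ((hg.circS (fun _ => by omega) hf).smul _)

theorem ev_circ {p q r : ℕ} (h : p + q = r + 1) (f : Cochain k A p) (g : Cochain k A q) :
    ev r (circ h f g) = circS k p q (ev p f) (ev q g) := by
  rw [circ, circS, Finset.sum_range fun i => (-1 : k) ^ ((p + 1 + i) * (q + 1)) •
    pcomp q i (ev p f) (ev q g), map_sum]
  exact Finset.sum_congr rfl fun i _ => by rw [map_smul, ev_insertion]

theorem ev_gBracket {p q r : ℕ} (h : p + q = r + 1) (f : Cochain k A p) (g : Cochain k A q) :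
    ev r (gBracket h f g) = bracketS k p q (ev p f) (ev q g) := by
  rw [gBracket, map_sub, map_smul, ev_circ, ev_circ, bracketS]

theorem bracketS_zero_zero (f g : SeqFun A) : bracketS k 0 0 f g = 0 := by
  simp [bracketS, circS_zero_left]

theorem bracketS_antisymm (p q : ℕ) (f g : SeqFun A) :
    bracketS k p q f g = -((-1 : k) ^ ((p + 1) * (q + 1)) • bracketS k q p g f) := by
  rw [bracketS, bracketS, mul_comm (q + 1)]
  have := neg_one_pow_mul_self (k := k) ((p + 1) * (q + 1))
  generalize (-1 : k) ^ ((p + 1) * (q + 1)) = s at *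
  linear_combination (norm := module) (-this) • circS k p q f g

/-- For odd `p` the sign in the bracket is `+1` and the two circle products cancel, in every
characteristic. -/
theorem bracketS_self {p : ℕ} (hp : Odd p) (f : SeqFun A) : bracketS k p p f f = 0 := by
  have : Even ((p + 1) * (p + 1)) := (hp.add_one).mul_right _
  rw [bracketS, this.neg_one_pow, one_smul, sub_self]

/-- The differential is a derivation of the bracket. -/
theorem dS_bracketS {p q n : ℕ} (hn : 0 < p + q → p + q = n + 1) {f g : SeqFun A}
    (hf : IsCochain k p f) (hg : IsCochain k q g) :
    dS k n (bracketS k p q f g) = bracketS k (p + 1) q (dS k p f) g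
      + (-1 : k) ^ (p + 1) • bracketS k p (q + 1) f (dS k q g) := by
  -- The cup products in the two instances of `dS_circS` cancel.
  rw [bracketS, map_sub, map_smul, dS_circS (fun _ => hn (by omega)) hf hg.hasArity,
    dS_circS (fun _ => by omega) hg hf.hasArity, bracketS, bracketS]
  have e1 : (-1 : k) ^ ((p + 1 + 1) * (q + 1)) = (-1 : k) ^ ((p + 1) * (q + 1)) * (-1) ^ (q + 1) := by
    ring
  have e2 : (-1 : k) ^ ((p + 1) * (q + 1 + 1)) = (-1 : k) ^ ((p + 1) * (q + 1)) * (-1) ^ (p + 1) := by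
    ring
  have e3 : (-1 : k) ^ ((q + 1) * p) = (-1 : k) ^ ((p + 1) * (q + 1)) * (-1) ^ (q + 1) := by
    rw [← pow_add]; refine neg_one_pow_congr ?_
    push_cast
    generalize (p : ZMod 2) = p, (q : ZMod 2) = q
    revert p q; decide
  have e4 : (-1 : k) ^ ((p + 1) * q) = (-1 : k) ^ ((p + 1) * (q + 1)) * (-1) ^ (p + 1) := by
    rw [← pow_add]; refine neg_one_pow_congr ?_
    push_cast
    generalize (p : ZMod 2) = p, (q : ZMod 2) = q
    revert p q; decide
  have e5 := neg_one_pow_mul_self (k := k) ((p + 1) * (q + 1))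
  rw [e1, e2, e3, e4]
  simp only [pow_succ _ p, pow_succ _ q]
  have e6 := neg_one_pow_mul_self (k := k) p
  generalize (-1 : k) ^ ((p + 1) * (q + 1)) = s at *
  generalize (-1 : k) ^ p = a at *
  linear_combination (norm := module) (-a * e5) • cupS p f g
     + (s * e6) • circS k (q + 1) p (dS k q g) f

/-- Splits the sign of the outer bracket. For `q > 0` the subtraction in `q + r - 1` is not
truncated; for `q = 0` the inner circle product is zero. -/
theorem smul_circS_circS (p q r : ℕ) (x y z : SeqFun A) :
    (-1 : k) ^ ((p + 1) * (q + r - 1 + 1)) • circS k (q + r - 1) p (circS k q r y z) x =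
      ((-1 : k) ^ ((p + 1) * (q + 1)) * (-1 : k) ^ ((p + 1) * (r + 1))) •
        circS k (q + r - 1) p (circS k q r y z) x := by
  rcases q.eq_zero_or_pos with rfl | hq
  · obtain ⟨L, hL⟩ := circS_linear_left (k := k) (0 + r - 1) p x
    rw [circS_zero_left, ← hL, map_zero, smul_zero, smul_zero]
  · rw [Nat.sub_add_cancel (by omega)]
    congr 1
    rw [← pow_add]
    refine neg_one_pow_congr ?_
    push_cast
    generalize (p : ZMod 2) = p, (q : ZMod 2) = q, (r : ZMod 2) = r
    revert p q r; decide

theorem bracketS_bracketS_right {p q r : ℕ} {x : SeqFun A} (y z : SeqFun A)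
    (hx : IsCochain k p x) :
    bracketS k p (q + r - 1) x (bracketS k q r y z) =
      circS k p (q + r - 1) x (circS k q r y z)
      - (-1 : k) ^ ((q + 1) * (r + 1)) • circS k p (r + q - 1) x (circS k r q z y)
      - ((-1 : k) ^ ((p + 1) * (q + 1)) * (-1 : k) ^ ((p + 1) * (r + 1))) •
        (circS k (q + r - 1) p (circS k q r y z) x
          - (-1 : k) ^ ((q + 1) * (r + 1)) • circS k (r + q - 1) p (circS k r q z y) x) := by
  have h1 := smul_circS_circS (k := k) p q r x y z
  have h2 := smul_circS_circS (k := k) p r q x z y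
  obtain ⟨L, hL⟩ := hx.circS_linear (q + r - 1)
  obtain ⟨M, hM⟩ := circS_linear_left (k := k) (q + r - 1) p x
  rw [add_comm r q] at *
  simp only [bracketS, ← hL, ← hM, map_sub, map_smul] at *
  rw [smul_sub, h1, smul_comm, h2]
  module

theorem bracketS_bracketS_left {p q r : ℕ} (x y : SeqFun A) {z : SeqFun A}
    (hz : IsCochain k r z) :
    bracketS k (p + q - 1) r (bracketS k p q x y) z =
      circS k (p + q - 1) r (circS k p q x y) z
      - (-1 : k) ^ ((p + 1) * (q + 1)) • circS k (q + p - 1) r (circS k q p y x) z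
      - ((-1 : k) ^ ((p + 1) * (r + 1)) * (-1 : k) ^ ((q + 1) * (r + 1))) •
        (circS k r (p + q - 1) z (circS k p q x y)
          - (-1 : k) ^ ((p + 1) * (q + 1)) • circS k r (q + p - 1) z (circS k q p y x)) := by
  have key : ∀ (p q : ℕ) (x y : SeqFun A),
      (-1 : k) ^ ((p + q - 1 + 1) * (r + 1)) • circS k r (p + q - 1) z (circS k p q x y) =
      ((-1 : k) ^ ((p + 1) * (r + 1)) * (-1 : k) ^ ((q + 1) * (r + 1))) •
        circS k r (p + q - 1) z (circS k p q x y) := fun p q x y => by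
    rcases p.eq_zero_or_pos with rfl | hp
    · obtain ⟨L, hL⟩ := hz.circS_linear (0 + q - 1)
      rw [circS_zero_left, ← hL, map_zero, smul_zero, smul_zero]
    · rw [Nat.sub_add_cancel (by omega)]
      congr 1
      rw [← pow_add]
      refine neg_one_pow_congr ?_
      push_cast
      generalize (p : ZMod 2) = p, (q : ZMod 2) = q, (r : ZMod 2) = r
      revert p q r; decide
  have h1 := key p q x y
  have h2 := key q p y x
  obtain ⟨L, hL⟩ := hz.circS_linear (p + q - 1)
  obtain ⟨M, hM⟩ := circS_linear_left (k := k) (p + q - 1) r z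
  rw [add_comm q p] at *
  simp only [bracketS, ← hL, ← hM, map_sub, map_smul] at *
  rw [smul_sub, h1, smul_comm, h2]
  module

/-- The graded Jacobi identity. -/
theorem bracketS_jacobi {p q r : ℕ} {x y z : SeqFun A} (hx : IsCochain k p x)
    (hy : IsCochain k q y) (hz : IsCochain k r z) :
    bracketS k p (q + r - 1) x (bracketS k q r y z) =
      bracketS k (p + q - 1) r (bracketS k p q x y) z
      + (-1 : k) ^ ((p + 1) * (q + 1)) •
        bracketS k q (p + r - 1) y (bracketS k p r x z) := by
  rw [bracketS_bracketS_right _ _ hx, bracketS_bracketS_left _ _ hz,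
    bracketS_bracketS_right _ _ hy]
  -- The pre-Lie identity for all six orders of `x`, `y`, `z` replaces each `(a ∘ b) ∘ c` by `a ∘ (b
  -- ∘ c)` and braces; then everything cancels.
  rw [circS_circS (m := q + r - 1) (by omega) (by omega) hx hy,
    circS_circS (m := r + q - 1) (by omega) (by omega) hx hz,
    circS_circS (m := p + r - 1) (by omega) (by omega) hy hx,
    circS_circS (m := r + p - 1) (by omega) (by omega) hy hz,
    circS_circS (m := p + q - 1) (by omega) (by omega) hz hx,
    circS_circS (m := q + p - 1) (by omega) (by omega) hz hy]
  rw [mul_comm (q + 1) (p + 1), mul_comm (r + 1) (p + 1), mul_comm (r + 1) (q + 1)]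
  have h1 := neg_one_pow_mul_self (k := k) ((p + 1) * (q + 1))
  have h2 := neg_one_pow_mul_self (k := k) ((p + 1) * (r + 1))
  have h3 := neg_one_pow_mul_self (k := k) ((q + 1) * (r + 1))
  generalize (-1 : k) ^ ((p + 1) * (q + 1)) = u, (-1 : k) ^ ((p + 1) * (r + 1)) = v,
    (-1 : k) ^ ((q + 1) * (r + 1)) = w at *
  linear_combination (norm := module)
    (w * h1) • circS k p (r + q - 1) x (circS k r q z y)
    + (-v * w * h1) • circS k r (p + q - 1) z (circS k p q x y)
    + (w * w * h1 + h3) • braceS k p q r x y z + (w * h1) • braceS k p r q x z y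
    + (-u * h2) • braceS k q p r y x z + (-u * v * w * h1) • braceS k r q p z y x

/-- For even `p` the two braces in the pre-Lie identity cancel, so `(x ∘ x) ∘ x = x ∘ (x ∘ x)`
already on cochains. No division by `3` is involved. -/
theorem bracketS_bracketS_self {p : ℕ} (hp : Even p) {x : SeqFun A} (hx : IsCochain k p x) :
    bracketS k p (p + p - 1) x (bracketS k p p x x) = 0 := by
  rw [bracketS_bracketS_right _ _ hx, circS_circS (m := p + p - 1) (by omega) (by omega) hx hx,
    ((hp.add_one).mul hp.add_one).neg_one_pow]
  module

/-! ### Cup products -/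

theorem pcomp_cupS_left {p r n v : ℕ} (hn : r + p = n + 1) (hv : v < r) (f g h : SeqFun A) :
    pcomp p v (cupS r f g) h = cupS n (pcomp p v f h) g := by
  funext x
  simp only [pcomp, cupS]
  congr 2
  funext l
  simp only [ins]
  rw [if_neg (by omega), if_neg (by omega)]
  congr 1
  omega

theorem pcomp_cupS_right {p r v : ℕ} {f : SeqFun A} (hf : HasArity p f) (g h : SeqFun A) :
    pcomp r (p + v) (cupS p f g) h = cupS p f (pcomp r v g h) := by
  funext x
  simp only [pcomp, cupS]
  congr 1
  · refine hf _ _ fun l hl => ?_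
    simp [ins, show l < p + v by omega]
  · congr 1
    funext l
    simp only [ins, add_lt_add_iff_left, add_right_inj, add_assoc]
    split_ifs
    · rfl
    · rfl
    · congr 1; omega

theorem cupS_assoc (p q : ℕ) (f g h : SeqFun A) :
    cupS (p + q) (cupS p f g) h = cupS p f (cupS q g h) := by
  funext x
  simp [cupS, mul_assoc, add_assoc]

variable (k) in
/-- The cup product as a bilinear map. -/
def cupL (p : ℕ) : SeqFun A →ₗ[k] SeqFun A →ₗ[k] SeqFun A :=
  LinearMap.mk₂ k (cupS p) (fun _ _ _ => funext fun _ => add_mul _ _ _)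
    (fun _ _ _ => funext fun _ => smul_mul_assoc _ _ _)
    (fun _ _ _ => funext fun _ => mul_add _ _ _)
    (fun _ _ _ => funext fun _ => mul_smul_comm _ _ _)

theorem cupL_apply (p : ℕ) (f g : SeqFun A) : cupL k p f g = cupS p f g := rfl

/-- The differential is a derivation of the cup product. -/
theorem dS_cupS {p q : ℕ} {f g : SeqFun A} (hf : HasArity p f) :
    dS k (p + q) (cupS p f g) = cupS (p + 1) (dS k p f) g
      + (-1 : k) ^ p • cupS p f (dS k q g) := by
  have e1 : pcomp (p + q) 1 (mulS A) (cupS p f g) = cupS (p + 1) (pcomp p 1 (mulS A) f) g := by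
    funext x
    simp only [pcomp, ins, mulS, cupS]
    simp [mul_assoc, add_comm, add_left_comm]
    simp [add_assoc]
  have e2 : pcomp (p + q) 0 (mulS A) (cupS p f g) = cupS p f (pcomp q 0 (mulS A) g) := by
    funext x
    simp only [pcomp, ins, mulS, cupS]
    simp [mul_assoc]
  have e3 : cupS (p + 1) (pcomp p 0 (mulS A) f) g = cupS p f (pcomp q 1 (mulS A) g) := by
    funext x
    simp only [pcomp, ins, mulS, cupS]
    simp [mul_assoc, add_assoc]
  rw [dS_eq, dS_eq, dS_eq, Finset.sum_range_add, e1, e2]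
  simp only [← cupL_apply (k := k), map_add, map_smul, map_sum, LinearMap.add_apply,
    LinearMap.smul_apply, LinearMap.sum_apply]
  simp only [cupL_apply, e3]
  have s1 : ∑ i ∈ Finset.range p, (-1 : k) ^ (i + 1) • pcomp 2 i (cupS p f g) (mulS A)
      = ∑ i ∈ Finset.range p, (-1 : k) ^ (i + 1) • cupS (p + 1) (pcomp 2 i f (mulS A)) g :=
    Finset.sum_congr rfl fun i hi => by
      rw [pcomp_cupS_left (n := p + 1) (by omega) (Finset.mem_range.1 hi)]
  have s2 : ∑ i ∈ Finset.range q, (-1 : k) ^ (p + i + 1) • pcomp 2 (p + i) (cupS p f g) (mulS A)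
      = (-1 : k) ^ p • ∑ i ∈ Finset.range q, (-1 : k) ^ (i + 1) •
        cupS p f (pcomp 2 i g (mulS A)) := by
    rw [Finset.smul_sum]
    exact Finset.sum_congr rfl fun i _ => by
      rw [pcomp_cupS_right hf, smul_smul, ← pow_add, add_assoc]
  rw [s1, s2]
  module

/-! ### The Leibniz rule -/

/-- Each slot of `f ⌣ g` belongs to `f` or to `g`, so this half of the Leibniz rule is exact. Only
the insertion of a cup product into a cochain needs a homotopy. -/
theorem circS_cupS_left {p q r : ℕ} {f g h : SeqFun A} (hf : HasArity p f) {n : ℕ}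
    (hn : 0 < p → p + r = n + 1) :
    circS k (p + q) r (cupS p f g) h =
      (-1 : k) ^ ((r + 1) * q) • cupS n (circS k p r f h) g + cupS p f (circS k q r g h) := by
  rw [circS, Finset.sum_range_add, circS, circS]
  simp only [← cupL_apply (k := k), map_smul, map_sum, LinearMap.smul_apply, LinearMap.sum_apply,
    Finset.smul_sum, smul_smul]
  congr 1
  · refine Finset.sum_congr rfl fun v hv => ?_
    have hv := Finset.mem_range.1 hv
    rw [cupL_apply, cupL_apply, pcomp_cupS_left (hn (by omega)) hv, ← pow_add]
    congr 1
    refine neg_one_pow_congr ?_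
    push_cast
    ring
  · refine Finset.sum_congr rfl fun v hv => ?_
    rw [cupL_apply, cupL_apply, pcomp_cupS_right hf]
    congr 1
    refine neg_one_pow_congr ?_
    push_cast
    generalize (p : ZMod 2) = p, (q : ZMod 2) = q, (r : ZMod 2) = r, (v : ZMod 2) = v
    revert p q r v; decide

/-- Coface `v + 1` of `f` multiplies the neighbouring slots `v` and `v + 1`; filling them with `h`
and `g` inserts `h ⌣ g`. This term lies on the diagonal of the double sum in the Leibniz homotopy.
-/
theorem lowD_pcomp_pcomp {p q r n v : ℕ} (hn : r + q = n + 1) (hv : v < r) (f g h : SeqFun A) :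
    pcomp p v (pcomp q (v + 1) (lowD k r (v + 1) f) g) h =
      pcomp p v (lowD k n v (pcomp q v f g)) h - (-1 : k) ^ v • pcomp (p + q) v f (cupS p h g) := by
  rw [pcomp_lowD_succ hn hv, ← pcompL_apply (k := k) p v (_ - _), map_sub, map_smul, pcompL_apply,
    pcompL_apply]
  congr 2
  have := pcomp_pcomp_seq (i := v) (j := 0) p (m := p + q) (q := q + 1) (by omega) (by omega) f
    (coface k q 0 g) h
  rwa [add_zero, pcomp_coface_zero_zero] at this

variable (k) in
/-- The homotopy for the Leibniz rule: a signed sum of the double insertions of `f` and `g` into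
`c`. -/
def leibnizHomotopy (p q r : ℕ) (c f g : SeqFun A) : SeqFun A :=
  ∑ w ∈ Finset.range r, ((-1 : k) ^ (q + 1)) ^ w •
    ∑ v ∈ Finset.range w, ((-1 : k) ^ (p + 1)) ^ v • pcomp p v (pcomp q w c g) f

theorem sum_Ico_telescope {M : Type*} [AddCommGroup M] [Module k M] {e : k} (he : e * e = 1)
    (P : ℕ → M) {m n : ℕ} (h : m ≤ n) : ∑ v ∈ Finset.Ico m n, e ^ v • (P (v + 1) - e • P v)
      = e • (e ^ n • P n - e ^ m • P m) := by
  rw [Finset.sum_Ico_eq_sub _ h, sum_telescope he, sum_telescope he]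
  module

/-- For cocycles, the differential of the double insertion telescopes in both slots `v < w`. The end
`v = 0` gives `f ⌣ (c ∘ g)`, the end `w = r` gives `(c ∘ f) ⌣ g`, and on the diagonal
`lowD_pcomp_pcomp` leaves `c ∘ (f ⌣ g)`. -/
theorem dS_leibnizHomotopy {p q r n : ℕ} (hn : 2 ≤ r → r + q + p = n + 2) {c f g : SeqFun A}
    (hc : IsCochain k r c) (hf : IsCochain k p f) (hg : IsCochain k q g)
    (hdc : dS k r c = 0) (hdf : dS k p f = 0) (hdg : dS k q g = 0) :
    circS k r (p + q) c (cupS p f g) =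
      cupS (r + p - 1) (circS k r p c f) g + (-1 : k) ^ ((r + 1) * p) • cupS p f (circS k r q c g)
      + ((-1 : k) ^ ((p + q + 1) * (r + 1)) * (-1) ^ (p + 1)) •
          dS k n (leibnizHomotopy k p q r c f g) := by
  have hC : (-1 : k) ^ (p + q + 1) = -1 * ((-1) ^ (p + 1) * (-1) ^ (q + 1)) := by ring
  have hD : (-1 : k) ^ ((r + 1) * p) = ((-1) ^ (p + 1)) ^ (r + 1) * (-1) ^ (r + 1) := by
    rw [← pow_mul, ← pow_add]; refine neg_one_pow_congr ?_
    push_cast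
    generalize (p : ZMod 2) = p, (r : ZMod 2) = r
    revert p r; decide
  have hw : ∀ w ∈ Finset.range r, dS k (r + q - 1) (pcomp q w c g) =
      pcomp q (w + 1) (lowD k r (w + 1) c) g
        - (-1 : k) ^ (q + 1) • pcomp q w (lowD k r w c) g := fun w hw => by
    have hw := Finset.mem_range.1 hw
    obtain ⟨L, hL⟩ := hc.linear (q + 1) hw
    rw [dS_pcomp (by omega) hw hc hg.hasArity, hdc, hdg, ← hL, map_zero,
      ← pcompL_apply (k := k) q w 0, map_zero]
    module
  have hwv : ∀ w ∈ Finset.range r, ∀ v ∈ Finset.range w,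
      dS k n (pcomp p v (pcomp q w c g) f) =
        pcomp p (v + 1) (lowD k (r + q - 1) (v + 1) (pcomp q w c g)) f
        - (-1 : k) ^ (p + 1) • pcomp p v (lowD k (r + q - 1) v (pcomp q w c g)) f
        + (-1 : k) ^ (p + 1) • (pcomp p v (pcomp q (w + 1) (lowD k r (w + 1) c) g) f
        - (-1 : k) ^ (q + 1) • pcomp p v (pcomp q w (lowD k r w c) g) f) := fun w hw' v hv => by
    have hw'' := Finset.mem_range.1 hw'
    have hv := Finset.mem_range.1 hv
    have hcw : IsCochain k (r + q - 1) (pcomp q w c g) := hc.pcomp (by omega) hw'' hg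
    obtain ⟨L, hL⟩ := hcw.linear (p + 1) (show v < r + q - 1 by omega)
    rw [dS_pcomp (by omega) (by omega) hcw hf.hasArity, hdf, ← hL, map_zero, hw w hw']
    simp only [← pcompL_apply (k := k) p, map_sub, map_smul]
    module
  have hlast : ∀ v < r, pcomp p v (pcomp q r (lowD k r r c) g) f
      = (-1 : k) ^ r • cupS (r + p - 1) (pcomp p v c f) g := fun v hv => by
    rw [lowD_pcomp_last q hc.hasArity, hdc, ← pcompL_apply (k := k) p, map_add, map_smul,
      pcompL_apply, pcompL_apply, pcomp_cupS_left (n := r + p - 1) (by omega) hv]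
    simp [← pcompL_apply (k := k)]
  have hdiag := fun v (hv : v < r) =>
    lowD_pcomp_pcomp (k := k) (p := p) (q := q) (n := r + q - 1) (by omega) hv c g f
  rw [leibnizHomotopy]
  simp only [map_smul, map_sum, circS_eq, hC, hD]
  rw [pow_mul, hC]
  have ha := neg_one_pow_mul_self (k := k) (p + 1)
  have hb := neg_one_pow_mul_self (k := k) (q + 1)
  generalize (-1 : k) ^ (p + 1) = a at *
  generalize (-1 : k) ^ (q + 1) = b at *
  -- Telescoping in the slot `v` of `f`, for fixed `w`.
  have e1 : ∑ w ∈ Finset.range r, b ^ w • ∑ v ∈ Finset.range w,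
        a ^ v • dS k n (pcomp p v (pcomp q w c g) f)
      = ∑ w ∈ Finset.range r, b ^ w • (a • (a ^ w •
          pcomp p w (lowD k (r + q - 1) w (pcomp q w c g)) f - cupS p f (pcomp q w c g)))
        + a • ∑ w ∈ Finset.range r, ∑ v ∈ Finset.range w, (a ^ v * b ^ w) •
          pcompL k p v f (pcomp q (w + 1) (lowD k r (w + 1) c) g
            - b • pcomp q w (lowD k r w c) g) := by
    rw [Finset.smul_sum, ← Finset.sum_add_distrib]
    refine Finset.sum_congr rfl fun w hw => ?_
    rw [← pcomp_coface_zero_zero (k := k) (r + q - 1), ← lowD_zero,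
      ← sum_telescope ha fun v => pcomp p v (lowD k (r + q - 1) v (pcomp q w c g)) f,
      Finset.smul_sum, Finset.smul_sum, Finset.smul_sum, ← Finset.sum_add_distrib]
    refine Finset.sum_congr rfl fun v hv => ?_
    rw [hwv w hw v hv, map_sub, map_smul, pcompL_apply, pcompL_apply]
    module
  -- Telescoping in the slot `w` of `g`, after exchanging the sums; `w` now runs from `v + 1` to `r
  -- - 1`.
  have e2 : ∑ w ∈ Finset.range r, ∑ v ∈ Finset.range w, (a ^ v * b ^ w) •
          pcompL k p v f (pcomp q (w + 1) (lowD k r (w + 1) c) g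
            - b • pcomp q w (lowD k r w c) g)
      = ∑ v ∈ Finset.range r, (a ^ v * b) • ((b ^ r * (-1) ^ r) •
          cupS (r + p - 1) (pcomp p v c f) g - b ^ (v + 1) •
          (pcomp p v (lowD k (r + q - 1) v (pcomp q v c g)) f
            - (-1 : k) ^ v • pcomp (p + q) v c (cupS p f g))) := by
    simp only [Finset.range_eq_Ico]
    rw [← Finset.sum_Ico_Ico_comm']
    refine Finset.sum_congr rfl fun v hv => ?_
    have hv := (Finset.mem_Ico.1 hv).2
    have := sum_Ico_telescope hb (fun w => pcomp q w (lowD k r w c) g) (show v + 1 ≤ r from hv)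
    simp only [mul_smul]
    rw [← Finset.smul_sum, ← hdiag v hv, ← hlast v hv, ← pcompL_apply (k := k) p,
      ← pcompL_apply (k := k) p]
    simp only [← map_smul, ← map_sum, ← map_sub]
    rw [this]
  rw [e1, e2]
  simp only [← cupL_apply (k := k), map_smul, map_sum, LinearMap.smul_apply, LinearMap.sum_apply,
    Finset.smul_sum]
  rw [← Finset.sum_add_distrib, ← Finset.sum_add_distrib, Finset.smul_sum, ← Finset.sum_add_distrib]
  refine Finset.sum_congr rfl fun v _ => ?_
  have hA : a ^ r * a ^ r = 1 := by rw [← mul_pow, ha, one_pow]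
  have hB : b ^ r * b ^ r = 1 := by rw [← mul_pow, hb, one_pow]
  have hs := neg_one_pow_mul_self (k := k) r
  simp only [mul_pow, pow_succ]
  generalize a ^ r = A, b ^ r = B, (-1 : k) ^ r = s, a ^ v = x, b ^ v = y, (-1 : k) ^ v = t at *
  linear_combination (norm := module)
    (s * A * a * B * b * t * x * y * (b * b * ha + hb)) • pcomp (p + q) v c (cupL k p f g)
    + (A * a * x * (B * B * a * a * b * b * hs + a * a * b * b * hB + b * b * ha + hb)) •
      cupL k (r + p - 1) (pcomp p v c f) g
    + (-s * A * a * B * b * y * ha) • cupL k p f (pcomp q v c g)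
    + (-s * A * a * B * b * a * a * x * y * hb) •
      pcomp p v (lowD k (r + q - 1) v (pcomp q v c g)) f

end Bracket

end Hochschild

/-! ### Hochschild cohomology as a Gerstenhaber algebra. -/

namespace Hochschild

section Cohomology

variable {k A : Type*} [CommRing k] [Ring A] [Algebra k A]

variable (k) in
/-- Cocycles among the functions of sequences. -/
def IsCocycle (n : ℕ) (F : SeqFun A) : Prop := ∃ f : cocycles k A n, ev n (f : Cochain k A n) = F

variable (k) in
/-- Coboundaries among the functions of sequences. -/
def IsBoundary : ℕ → SeqFun A → Prop
  | 0, F => F = 0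
  | n + 1, F => ∃ H, IsCochain k n H ∧ dS k n H = F

theorem isCocycle_iff {n : ℕ} {F : SeqFun A} :
    IsCocycle k n F ↔ IsCochain k n F ∧ dS k n F = 0 := by
  constructor
  · rintro ⟨⟨f, hf⟩, rfl⟩
    refine ⟨isCochain_ev f, ?_⟩
    rw [← ev_d, show d n f = 0 from hf, map_zero]
  · rintro ⟨⟨f, rfl⟩, h⟩
    refine ⟨⟨f, ?_⟩, rfl⟩
    rw [← ev_d] at h
    exact ev_injective _ (h.trans (map_zero _).symm)

theorem isCocycle_ev {n : ℕ} (f : cocycles k A n) : IsCocycle k n (ev n (f : Cochain k A n)) :=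
  ⟨f, rfl⟩

theorem IsCocycle.isCochain {n : ℕ} {F : SeqFun A} (h : IsCocycle k n F) : IsCochain k n F :=
  (isCocycle_iff.1 h).1

theorem IsCocycle.dS {n : ℕ} {F : SeqFun A} (h : IsCocycle k n F) : dS k n F = 0 :=
  (isCocycle_iff.1 h).2

theorem IsCocycle.add {n : ℕ} {F G : SeqFun A} (hF : IsCocycle k n F) (hG : IsCocycle k n G) :
    IsCocycle k n (F + G) :=
  isCocycle_iff.2 ⟨hF.isCochain.add hG.isCochain, by rw [map_add, hF.dS, hG.dS, add_zero]⟩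

theorem IsCocycle.sub {n : ℕ} {F G : SeqFun A} (hF : IsCocycle k n F) (hG : IsCocycle k n G) :
    IsCocycle k n (F - G) :=
  isCocycle_iff.2 ⟨hF.isCochain.sub hG.isCochain, by rw [map_sub, hF.dS, hG.dS, sub_zero]⟩

theorem IsCocycle.smul {n : ℕ} {F : SeqFun A} (hF : IsCocycle k n F) (c : k) :
    IsCocycle k n (c • F) :=
  isCocycle_iff.2 ⟨hF.isCochain.smul c, by rw [map_smul, hF.dS, smul_zero]⟩

theorem isCocycle_zero (n : ℕ) : IsCocycle k n (0 : SeqFun A) := ⟨0, map_zero _⟩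

theorem isBoundary_ev {n : ℕ} {f : Cochain k A n} :
    IsBoundary k n (ev n f) ↔ f ∈ coboundaries k A n := by
  cases n with
  | zero =>
    simp only [IsBoundary, coboundaries, Submodule.mem_bot]
    exact ⟨fun h => ev_injective _ (h.trans (map_zero _).symm), fun h => by rw [h, map_zero]⟩
  | succ n =>
    simp only [IsBoundary, coboundaries, LinearMap.mem_range]
    constructor
    · rintro ⟨_, ⟨h, rfl⟩, e⟩
      exact ⟨h, ev_injective _ (by rw [ev_d, e])⟩
    · rintro ⟨h, rfl⟩
      exact ⟨ev n h, isCochain_ev h, (ev_d h).symm⟩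

theorem IsBoundary.smul {n : ℕ} {F : SeqFun A} (h : IsBoundary k n F) (c : k) :
    IsBoundary k n (c • F) := by
  cases n with
  | zero => rw [show F = 0 from h, smul_zero]; rfl
  | succ n =>
    obtain ⟨H, hH, rfl⟩ := h
    exact ⟨c • H, hH.smul c, map_smul _ _ _⟩

/-- The class of a cocycle as a linear map. -/
def clsL (n : ℕ) : cocycles k A n →ₗ[k] TotalHH k A :=
  DirectSum.lof k ℕ (HH k A) n ∘ₗ proj n

theorem cls_eq_zero {n : ℕ} {f : cocycles k A n} (h : IsBoundary k n (ev n (f : Cochain k A n))) :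
    cls f = 0 := by
  have : proj n f = 0 :=
    (Submodule.Quotient.mk_eq_zero _).2 (Submodule.mem_comap.2 (isBoundary_ev.1 h))
  rw [cls, this, map_zero]

open Classical in
variable (k) in
/-- The cohomology class of a function of sequences, zero unless it is a cocycle. -/
noncomputable def clsS (n : ℕ) (F : SeqFun A) : TotalHH k A :=
  if h : IsCocycle k n F then cls h.choose else 0

theorem clsS_ev {n : ℕ} (f : cocycles k A n) : clsS k n (ev n (f : Cochain k A n)) = cls f := by
  rw [clsS, dif_pos (isCocycle_ev f)]
  congr 1
  exact Subtype.ext (ev_injective _ (isCocycle_ev f).choose_spec)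

theorem clsS_add {n : ℕ} {F G : SeqFun A} (hF : IsCocycle k n F) (hG : IsCocycle k n G) :
    clsS k n (F + G) = clsS k n F + clsS k n G := by
  obtain ⟨f, rfl⟩ := hF
  obtain ⟨g, rfl⟩ := hG
  rw [← map_add, clsS_ev, clsS_ev, ← Submodule.coe_add, clsS_ev]
  exact map_add (clsL n) f g

theorem clsS_smul {n : ℕ} {F : SeqFun A} (hF : IsCocycle k n F) (c : k) :
    clsS k n (c • F) = c • clsS k n F := by
  obtain ⟨f, rfl⟩ := hF
  rw [← map_smul, clsS_ev, ← Submodule.coe_smul, clsS_ev]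
  exact map_smul (clsL n) c f

theorem clsS_zero (n : ℕ) : clsS k n (0 : SeqFun A) = 0 := by
  have := clsS_smul (isCocycle_zero (k := k) (A := A) n) 0
  rwa [zero_smul, zero_smul] at this

theorem clsS_eq_zero {n : ℕ} {F : SeqFun A} (h : IsBoundary k n F) : clsS k n F = 0 := by
  by_cases hF : IsCocycle k n F
  · obtain ⟨f, rfl⟩ := hF
    rw [clsS_ev, cls_eq_zero h]
  · rw [clsS, dif_neg hF]

theorem clsS_eq {n : ℕ} {F G : SeqFun A} (hF : IsCocycle k n F) (hG : IsCocycle k n G)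
    (h : IsBoundary k n (F - G)) : clsS k n F = clsS k n G := by
  have := clsS_add (hF.sub hG) hG
  rw [clsS_eq_zero h, sub_add_cancel, zero_add] at this
  exact this

theorem mem_grading_iff {n : ℕ} {x : TotalHH k A} :
    x ∈ grading k A n ↔ ∃ F, IsCocycle k n F ∧ clsS k n F = x := by
  constructor
  · rintro ⟨y, rfl⟩
    obtain ⟨f, rfl⟩ := Submodule.Quotient.mk_surjective _ y
    exact ⟨_, isCocycle_ev f, clsS_ev f⟩
  · rintro ⟨F, ⟨f, rfl⟩, rfl⟩
    rw [clsS_ev]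
    exact ⟨_, rfl⟩

theorem clsS_mem {n : ℕ} (F : SeqFun A) : clsS k n F ∈ grading k A n := by
  by_cases h : IsCocycle k n F
  · exact mem_grading_iff.2 ⟨F, h, rfl⟩
  · rw [clsS, dif_neg h]; exact Submodule.zero_mem _

/-- Induction over classes of homogeneous cocycles. -/
theorem totalHH_induction {motive : TotalHH k A → Prop} (x : TotalHH k A)
    (hcls : ∀ (n : ℕ) (F : SeqFun A), IsCocycle k n F → motive (clsS k n F))
    (hadd : ∀ x y, motive x → motive y → motive (x + y)) : motive x := by
  induction x using DirectSum.induction_on with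
  | zero =>
    have := hcls 0 0 (isCocycle_zero 0)
    rwa [clsS_zero] at this
  | of n y =>
    obtain ⟨F, hF, e⟩ := mem_grading_iff.1 (show DirectSum.lof k ℕ (HH k A) n y ∈ grading k A n
      from ⟨y, rfl⟩)
    have := hcls n F hF
    rwa [e] at this
  | add x y hx hy => exact hadd x y hx hy

theorem isInternal_grading : DirectSum.IsInternal (grading k A) := by
  let e : (⨁ n, HH k A n) ≃ₗ[k] ⨁ n, grading k A n :=
    DFinsupp.mapRange.linearEquiv fun n =>
      LinearEquiv.ofInjective (DirectSum.lof k ℕ (HH k A) n) (DirectSum.of_injective n)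
  have h : (DirectSum.coeLinearMap (grading k A)) ∘ₗ e.toLinearMap = LinearMap.id := by
    ext n x : 2
    have h1 : e (DirectSum.lof k ℕ (HH k A) n x) = DirectSum.lof k ℕ (fun n => grading k A n) n
        ⟨DirectSum.lof k ℕ (HH k A) n x, x, rfl⟩ :=
      DFinsupp.mapRange_single (hf := fun _ => map_zero _)
    show DirectSum.coeLinearMap (grading k A) (e (DirectSum.lof k ℕ (HH k A) n x)) = _
    rw [h1, DirectSum.coeLinearMap_lof]
    rfl
  have h2 : ⇑(DirectSum.coeLinearMap (grading k A)) = e.symm := by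
    funext x
    obtain ⟨y, rfl⟩ := e.surjective x
    rw [e.symm_apply_apply]
    exact LinearMap.congr_fun h y
  show Function.Bijective (DirectSum.coeLinearMap (grading k A))
  rw [h2]
  exact e.symm.bijective

/-! ### Operations induced on cohomology -/

/-- A bilinear operation on cocycles that vanishes if one argument is a coboundary induces a bilinear
operation on the total cohomology. -/
theorem exists_bilinear (φ : ∀ p q : ℕ, cocycles k A p →ₗ[k] cocycles k A q →ₗ[k] TotalHH k A)
    (h1 : ∀ (p q) (f : cocycles k A p) (g : cocycles k A q), (f : Cochain k A p) ∈ coboundaries k A p → φ p q f g = 0)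
    (h2 : ∀ (p q) (f : cocycles k A p) (g : cocycles k A q), (g : Cochain k A q) ∈ coboundaries k A q → φ p q f g = 0) :
    ∃ Φ : TotalHH k A →ₗ[k] TotalHH k A →ₗ[k] TotalHH k A,
      ∀ (p q : ℕ) (f : cocycles k A p) (g : cocycles k A q), Φ (cls f) (cls g) = φ p q f g := by
  let ψ : ∀ p q : ℕ, HH k A p →ₗ[k] HH k A q →ₗ[k] TotalHH k A := fun p q =>
    Submodule.liftQ _ (LinearMap.flip (Submodule.liftQ _ (φ p q).flip (fun g hg =>
      LinearMap.mem_ker.2 (LinearMap.ext fun f => h2 p q f g hg)))) (fun f hf => by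
        refine LinearMap.mem_ker.2 (LinearMap.ext fun x => ?_)
        obtain ⟨g, rfl⟩ := Submodule.Quotient.mk_surjective _ x
        exact h1 p q f g hf)
  refine ⟨DirectSum.toModule k ℕ _ fun p => LinearMap.flip (DirectSum.toModule k ℕ _ fun q =>
    (ψ p q).flip), fun p q f g => ?_⟩
  simp only [cls, DirectSum.toModule_lof, LinearMap.flip_apply]
  rfl

theorem exists_linear (φ : ∀ p : ℕ, HH k A p →ₗ[k] TotalHH k A) :
    ∃ Φ : TotalHH k A →ₗ[k] TotalHH k A,
      ∀ (p : ℕ) (f : cocycles k A p), Φ (cls f) = φ p (proj p f) :=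
  ⟨DirectSum.toModule k ℕ _ φ, fun p f => by rw [cls, DirectSum.toModule_lof]⟩

theorem cupS_isCocycle {p q n : ℕ} (h : p + q = n) {F G : SeqFun A} (hF : IsCocycle k p F)
    (hG : IsCocycle k q G) : IsCocycle k n (cupS p F G) := by
  subst h
  refine isCocycle_iff.2 ⟨hF.isCochain.cupS rfl hG.isCochain, ?_⟩
  rw [dS_cupS hF.isCochain.hasArity, hF.dS, hG.dS]
  simp [← cupL_apply (k := k)]

theorem bracketS_zero_left {p q : ℕ} {G : SeqFun A} (hG : IsCochain k q G) :
    bracketS k p q 0 G = 0 := by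
  obtain ⟨L, hL⟩ := circS_linear_left (k := k) p q G
  obtain ⟨M, hM⟩ := hG.circS_linear p
  rw [bracketS, ← hL, ← hM]
  simp

theorem bracketS_zero_right {p q : ℕ} {F : SeqFun A} (hF : IsCochain k p F) :
    bracketS k p q F 0 = 0 := by
  rw [bracketS_antisymm, bracketS_zero_left hF, smul_zero, neg_zero]

theorem bracketS_isCocycle {p q n : ℕ} (hn : 0 < p + q → p + q = n + 1) {F G : SeqFun A}
    (hF : IsCocycle k p F) (hG : IsCocycle k q G) : IsCocycle k n (bracketS k p q F G) := by
  refine isCocycle_iff.2 ⟨hF.isCochain.bracketS hn hG.isCochain, ?_⟩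
  rw [dS_bracketS hn hF.isCochain hG.isCochain, hF.dS, hG.dS, bracketS_zero_left hG.isCochain,
    bracketS_zero_right hF.isCochain, smul_zero, add_zero]

theorem exists_cup : ∃ Φ : TotalHH k A →ₗ[k] TotalHH k A →ₗ[k] TotalHH k A,
    ∀ (p q : ℕ) (F G : SeqFun A), IsCocycle k p F → IsCocycle k q G →
      Φ (clsS k p F) (clsS k q G) = clsS k (p + q) (cupS p F G) := by
  refine Exists.imp (fun Φ hΦ => ?_) (exists_bilinear (k := k) (A := A) (fun p q =>
    LinearMap.mk₂ k (fun f g => clsS k (p + q)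
      (cupS p (ev p (f : Cochain k A p)) (ev q (g : Cochain k A q))))
      (fun f f' g => by
        rw [← clsS_add (cupS_isCocycle rfl (isCocycle_ev _) (isCocycle_ev _))
          (cupS_isCocycle rfl (isCocycle_ev _) (isCocycle_ev _))]
        simp [← cupL_apply (k := k)])
      (fun c f g => by
        rw [← clsS_smul (cupS_isCocycle rfl (isCocycle_ev _) (isCocycle_ev _))]
        simp [← cupL_apply (k := k)])
      (fun f g g' => by
        rw [← clsS_add (cupS_isCocycle rfl (isCocycle_ev _) (isCocycle_ev _))
          (cupS_isCocycle rfl (isCocycle_ev _) (isCocycle_ev _))]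
        simp [← cupL_apply (k := k)])
      (fun c f g => by
        rw [← clsS_smul (cupS_isCocycle rfl (isCocycle_ev _) (isCocycle_ev _))]
        simp [← cupL_apply (k := k)])) ?_ ?_)
  · rintro p q F G ⟨f, rfl⟩ ⟨g, rfl⟩
    rw [clsS_ev, clsS_ev, hΦ]
    rfl
  · intro p q f g hf
    refine clsS_eq_zero ?_
    rw [← isBoundary_ev] at hf
    have hg := isCocycle_ev g
    generalize ev p (f : Cochain k A p) = F, ev q (g : Cochain k A q) = G at *
    cases p with
    | zero =>
      rw [show F = 0 from hf]
      cases q <;> [skip; exact ⟨0, Submodule.zero_mem _, by simp [← cupL_apply (k := k)]⟩]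
      simp [IsBoundary, ← cupL_apply (k := k)]
    | succ p =>
      obtain ⟨H, hH, rfl⟩ := hf
      rw [Nat.succ_add]
      refine ⟨cupS p H G, hH.cupS rfl hg.isCochain, ?_⟩
      rw [dS_cupS hH.hasArity, hg.dS]
      simp [← cupL_apply (k := k)]
  · intro p q f g hg
    refine clsS_eq_zero ?_
    rw [← isBoundary_ev] at hg
    have hf := isCocycle_ev f
    generalize ev p (f : Cochain k A p) = F, ev q (g : Cochain k A q) = G at *
    cases q with
    | zero =>
      rw [show G = 0 from hg]
      cases p <;> [skip; exact ⟨0, Submodule.zero_mem _, by simp [← cupL_apply (k := k)]⟩]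
      simp [IsBoundary, ← cupL_apply (k := k)]
    | succ q =>
      obtain ⟨H, hH, rfl⟩ := hg
      refine ⟨(-1 : k) ^ p • cupS p F H, (hf.isCochain.cupS rfl hH).smul _, ?_⟩
      change dS k (p + q) _ = _
      rw [map_smul, dS_cupS hf.isCochain.hasArity, hf.dS]
      simp [← cupL_apply (k := k), smul_smul, neg_one_pow_mul_self]

theorem isBoundary_bracketS {p q n : ℕ} (hn : 0 < p + q → p + q = n + 1) {F G : SeqFun A}
    (hF : IsBoundary k p F) (hG : IsCocycle k q G) : IsBoundary k n (bracketS k p q F G) := by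
  cases p with
  | zero =>
    rw [show F = 0 from hF, bracketS_zero_left hG.isCochain]
    cases n with
    | zero => rfl
    | succ n => exact ⟨0, Submodule.zero_mem _, map_zero _⟩
  | succ p =>
    obtain ⟨H, hH, rfl⟩ := hF
    have key : ∀ m, (0 < p + q → p + q = m + 1) →
        dS k m (bracketS k p q H G) = bracketS k (p + 1) q (dS k p H) G := fun m hm => by
      rw [dS_bracketS hm hH hG.isCochain, hG.dS, bracketS_zero_right hH, smul_zero, add_zero]
    cases n with
    | zero =>
      -- The target has degree `0`, where a coboundary must be zero. It is the differential of the
      -- bracket of two `0`-cochains, and that bracket vanishes.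
      obtain ⟨rfl, rfl⟩ : p = 0 ∧ q = 0 := by omega
      rw [← key 0 (by omega), bracketS_zero_zero, map_zero]
      rfl
    | succ n => exact ⟨_, hH.bracketS (by omega) hG.isCochain, key n (by omega)⟩

theorem bracketS_add_left {p q : ℕ} (F F' : SeqFun A) {G : SeqFun A} (hG : IsCochain k q G) :
    bracketS k p q (F + F') G = bracketS k p q F G + bracketS k p q F' G := by
  obtain ⟨L, hL⟩ := circS_linear_left (k := k) p q G
  obtain ⟨M, hM⟩ := hG.circS_linear p
  simp only [bracketS, ← hL, ← hM, map_add]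
  module

theorem bracketS_smul_left {p q : ℕ} (c : k) (F : SeqFun A) {G : SeqFun A}
    (hG : IsCochain k q G) : bracketS k p q (c • F) G = c • bracketS k p q F G := by
  obtain ⟨L, hL⟩ := circS_linear_left (k := k) p q G
  obtain ⟨M, hM⟩ := hG.circS_linear p
  simp only [bracketS, ← hL, ← hM, map_smul]
  module

theorem exists_bracket : ∃ Φ : TotalHH k A →ₗ[k] TotalHH k A →ₗ[k] TotalHH k A,
    ∀ (p q : ℕ) (F G : SeqFun A), IsCocycle k p F → IsCocycle k q G →
      Φ (clsS k p F) (clsS k q G) = clsS k (p + q - 1) (bracketS k p q F G) := by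
  have hcoc : ∀ (p q : ℕ) (f : cocycles k A p) (g : cocycles k A q), IsCocycle k (p + q - 1)
      (bracketS k p q (ev p (f : Cochain k A p)) (ev q (g : Cochain k A q))) :=
    fun p q f g => bracketS_isCocycle (by omega) (isCocycle_ev f) (isCocycle_ev g)
  refine Exists.imp (fun Φ hΦ => ?_) (exists_bilinear (k := k) (A := A) (fun p q =>
    LinearMap.mk₂ k (fun f g => clsS k (p + q - 1)
      (bracketS k p q (ev p (f : Cochain k A p)) (ev q (g : Cochain k A q))))
      (fun f f' g => by
        rw [← clsS_add (hcoc _ _ _ _) (hcoc _ _ _ _), ← bracketS_add_left _ _ (isCochain_ev _),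
          ← map_add]
        rfl)
      (fun c f g => by
        rw [← clsS_smul (hcoc _ _ _ _), ← bracketS_smul_left _ _ (isCochain_ev _), ← map_smul]
        rfl)
      (fun f g g' => by
        rw [← clsS_add (hcoc _ _ _ _) (hcoc _ _ _ _)]
        congr 1
        rw [bracketS_antisymm, bracketS_antisymm p q _ (ev q (g : Cochain k A q)),
          bracketS_antisymm p q _ (ev q (g' : Cochain k A q)), Submodule.coe_add, map_add,
          bracketS_add_left _ _ (isCochain_ev _)]
        module)
      (fun c f g => by
        rw [← clsS_smul (hcoc _ _ _ _)]
        congr 1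
        rw [bracketS_antisymm, bracketS_antisymm p q _ (ev q (g : Cochain k A q)),
          Submodule.coe_smul, map_smul, bracketS_smul_left _ _ (isCochain_ev _)]
        module)) ?_ ?_)
  · rintro p q F G ⟨f, rfl⟩ ⟨g, rfl⟩
    rw [clsS_ev, clsS_ev, hΦ]
    rfl
  · intro p q f g hf
    exact clsS_eq_zero (isBoundary_bracketS (by omega) (isBoundary_ev.2 hf) (isCocycle_ev g))
  · intro p q f g hg
    refine clsS_eq_zero ?_
    rw [bracketS_antisymm, ← neg_one_smul k, smul_smul]
    exact (isBoundary_bracketS (by omega) (isBoundary_ev.2 hg) (isCocycle_ev f)).smul _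

/-! ### The Gerstenhaber algebra -/

/-- The unit as a function of sequences. -/
def oneS (A : Type*) [Ring A] : SeqFun A := fun _ => 1

theorem isCocycle_oneS : IsCocycle k 0 (oneS A) := by
  refine isCocycle_iff.2 ⟨⟨MultilinearMap.constOfIsEmpty k (fun _ : Fin 0 => A) 1, rfl⟩, ?_⟩
  rw [dS_eq]
  funext x
  simp [pcomp, ins, mulS, oneS]

/-- A form of the homotopy criterion adapted to truncated degrees `m = n - 1`: for `n = 0` there is
no room for a homotopy, so `H` has to vanish. -/
theorem clsS_eq_of_sub_eq_dS {n m : ℕ} {F G H : SeqFun A} (hF : IsCocycle k n F)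
    (hG : IsCocycle k n G) (hH : n = m + 1 → IsCochain k m H) (h : F - G = dS k m H)
    (h0 : n = 0 → H = 0) (hn : n ≤ m + 1) (hm : 0 < n → n = m + 1) : clsS k n F = clsS k n G := by
  refine clsS_eq hF hG ?_
  cases n with
  | zero =>
    rw [h, h0 rfl, map_zero]
    rfl
  | succ n =>
    obtain rfl : n = m := by have := hm (by omega); omega
    exact ⟨H, hH rfl, h.symm⟩

theorem IsCochain.leibnizHomotopy {p q r n : ℕ} (hn : 2 ≤ r → r + q + p = n + 2)
    {c f g : SeqFun A} (hc : IsCochain k r c) (hf : IsCochain k p f) (hg : IsCochain k q g) :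
    IsCochain k n (leibnizHomotopy k p q r c f g) := by
  refine isCochain_sum _ fun w hw => (isCochain_sum _ fun v hv => ?_).smul _
  have hw := Finset.mem_range.1 hw
  have hv := Finset.mem_range.1 hv
  have hcw : IsCochain k (r + q - 1) (Hochschild.pcomp q w c g) := hc.pcomp (by omega) hw hg
  exact (hcw.pcomp (by omega) (by omega) hf).smul _

theorem leibnizHomotopy_eq_zero {p q r : ℕ} (hr : r ≤ 1) (c f g : SeqFun A) :
    leibnizHomotopy k p q r c f g = 0 := by
  refine Finset.sum_eq_zero fun w hw => ?_
  obtain rfl : w = 0 := by have := Finset.mem_range.1 hw; omega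
  simp

theorem clsS_cupS_comm {p q : ℕ} {F G : SeqFun A} (hF : IsCocycle k p F) (hG : IsCocycle k q G) :
    clsS k (p + q) (cupS p F G) = (-1 : k) ^ (p * q) • clsS k (q + p) (cupS q G F) := by
  have e := dS_circS (n := p + q - 1) (by omega) hF.isCochain hG.isCochain.hasArity
  obtain ⟨L, hL⟩ := circS_linear_left (k := k) (p + 1) q G
  obtain ⟨M, hM⟩ := hF.isCochain.circS_linear (q + 1)
  -- For cocycles only the two cup products survive in the differential of `F ∘ G`.
  rw [hF.dS, hG.dS, ← hL, ← hM, map_zero, map_zero, smul_zero, zero_add, zero_add] at e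
  have hFG := cupS_isCocycle (k := k) (n := p + q) rfl hF hG
  have hGF := cupS_isCocycle (k := k) (n := p + q) (add_comm q p) hG hF
  rw [add_comm q p, ← clsS_smul hGF]
  refine clsS_eq_of_sub_eq_dS (m := p + q - 1) (H := (-1 : k) ^ p • circS k p q F G) hFG
    (hGF.smul _) (fun h => (hF.isCochain.circS (by omega) hG.isCochain).smul _) ?_ ?_ (by omega)
    (by omega)
  · rw [map_smul, e]
    have h1 : (-1 : k) ^ ((q + 1) * p) = (-1) ^ (p * q) * (-1) ^ p := by ring
    have h2 := neg_one_pow_mul_self (k := k) p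
    rw [h1]
    linear_combination (norm := module) (-h2) • cupS p F G
      + ((-1 : k) ^ (p * q) * h2) • cupS q G F
  · intro h
    obtain ⟨rfl, rfl⟩ : p = 0 ∧ q = 0 := by omega
    rw [circS_zero_left, smul_zero]

/-- Truncated subtraction can make the two degrees differ only if `r = p = 0`; then the bracket
vanishes and the class is zero in either degree. The next three lemmas rest on the same observation.
-/
theorem bracketS_cupS_degree {p q r n : ℕ} (hn : n = r + p + q - 1) {C F G : SeqFun A}
    (hC : IsCocycle k r C) (hF : IsCocycle k p F) (hG : IsCocycle k q G) :
    IsCocycle k n (cupS (r + p - 1) (bracketS k r p C F) G) ∧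
      clsS k (r + p - 1 + q) (cupS (r + p - 1) (bracketS k r p C F) G) =
        clsS k n (cupS (r + p - 1) (bracketS k r p C F) G) := by
  subst hn
  rcases Nat.eq_zero_or_pos (r + p) with h | h
  · obtain ⟨rfl, rfl⟩ : r = 0 ∧ p = 0 := by omega
    rw [bracketS_zero_zero, show cupS (0 + 0 - 1) 0 G = 0 by simp [← cupL_apply (k := k)],
      clsS_zero, clsS_zero]
    exact ⟨isCocycle_zero _, rfl⟩
  · have e : r + p + q - 1 = r + p - 1 + q := by omega
    rw [e]
    exact ⟨cupS_isCocycle rfl (bracketS_isCocycle (by omega) hC hF) hG, rfl⟩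

theorem cupS_bracketS_degree {p q r n : ℕ} (hn : n = r + p + q - 1) {C F G : SeqFun A}
    (hC : IsCocycle k r C) (hF : IsCocycle k p F) (hG : IsCocycle k q G) :
    IsCocycle k n (cupS p F (bracketS k r q C G)) ∧
      clsS k (p + (r + q - 1)) (cupS p F (bracketS k r q C G)) =
        clsS k n (cupS p F (bracketS k r q C G)) := by
  subst hn
  rcases Nat.eq_zero_or_pos (r + q) with h | h
  · obtain ⟨rfl, rfl⟩ : r = 0 ∧ q = 0 := by omega
    rw [bracketS_zero_zero, show cupS p F 0 = 0 by simp [← cupL_apply (k := k)],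
      clsS_zero, clsS_zero]
    exact ⟨isCocycle_zero _, rfl⟩
  · have e : r + p + q - 1 = p + (r + q - 1) := by omega
    rw [e]
    exact ⟨cupS_isCocycle rfl hF (bracketS_isCocycle (by omega) hC hG), rfl⟩

theorem bracketS_bracketS_degree_right {p q r n : ℕ} (hn : n = p + q + r - 2) {F G H : SeqFun A}
    (hF : IsCocycle k p F) (hG : IsCocycle k q G) (hH : IsCocycle k r H) :
    IsCocycle k n (bracketS k p (q + r - 1) F (bracketS k q r G H)) ∧
      clsS k (p + (q + r - 1) - 1) (bracketS k p (q + r - 1) F (bracketS k q r G H)) =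
        clsS k n (bracketS k p (q + r - 1) F (bracketS k q r G H)) := by
  subst hn
  rcases Nat.eq_zero_or_pos (q + r) with h | h
  · obtain ⟨rfl, rfl⟩ : q = 0 ∧ r = 0 := by omega
    rw [bracketS_zero_zero, bracketS_zero_right hF.isCochain, clsS_zero, clsS_zero]
    exact ⟨isCocycle_zero _, rfl⟩
  · have e : p + q + r - 2 = p + (q + r - 1) - 1 := by omega
    rw [e]
    exact ⟨bracketS_isCocycle (by omega) hF (bracketS_isCocycle (by omega) hG hH), rfl⟩

theorem bracketS_bracketS_degree_left {p q r n : ℕ} (hn : n = p + q + r - 2) {F G H : SeqFun A}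
    (hF : IsCocycle k p F) (hG : IsCocycle k q G) (hH : IsCocycle k r H) :
    IsCocycle k n (bracketS k (p + q - 1) r (bracketS k p q F G) H) ∧
      clsS k (p + q - 1 + r - 1) (bracketS k (p + q - 1) r (bracketS k p q F G) H) =
        clsS k n (bracketS k (p + q - 1) r (bracketS k p q F G) H) := by
  subst hn
  rcases Nat.eq_zero_or_pos (p + q) with h | h
  · obtain ⟨rfl, rfl⟩ : p = 0 ∧ q = 0 := by omega
    rw [bracketS_zero_zero, bracketS_zero_left hH.isCochain, clsS_zero, clsS_zero]
    exact ⟨isCocycle_zero _, rfl⟩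
  · have e : p + q + r - 2 = p + q - 1 + r - 1 := by omega
    rw [e]
    exact ⟨bracketS_isCocycle (by omega) (bracketS_isCocycle (by omega) hF hG) hH, rfl⟩

/-- Insertion of `C` into the cup product distributes exactly by `circS_cupS_left`, insertion of the
cup product into `C` up to the Leibniz homotopy. -/
theorem clsS_bracketS_cupS {p q r : ℕ} {C F G : SeqFun A} (hC : IsCocycle k r C)
    (hF : IsCocycle k p F) (hG : IsCocycle k q G) :
    clsS k (r + (p + q) - 1) (bracketS k r (p + q) C (cupS p F G)) =
      clsS k (r + p - 1 + q) (cupS (r + p - 1) (bracketS k r p C F) G)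
      + (-1 : k) ^ ((r + 1) * p) • clsS k (p + (r + q - 1)) (cupS p F (bracketS k r q C G)) := by
  have hY := bracketS_cupS_degree (n := r + (p + q) - 1) (by omega) hC hF hG
  have hZ := cupS_bracketS_degree (n := r + (p + q) - 1) (by omega) hC hF hG
  have hX := bracketS_isCocycle (n := r + (p + q) - 1) (by omega) hC (cupS_isCocycle rfl hF hG)
  have hom : IsCochain k (r + p + q - 2) (leibnizHomotopy k p q r C F G) :=
    IsCochain.leibnizHomotopy (by omega) hC.isCochain hF.isCochain hG.isCochain
  have e := dS_leibnizHomotopy (n := r + p + q - 2) (by omega) hC.isCochain hF.isCochain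
    hG.isCochain hC.dS hF.dS hG.dS
  have e' := circS_cupS_left (k := k) (q := q) (r := r) (g := G) (h := C) hF.isCochain.hasArity
    (n := p + r - 1) (by omega)
  rw [hY.2, hZ.2, ← clsS_smul hZ.1, ← clsS_add hY.1 (hZ.1.smul _)]
  refine clsS_eq_of_sub_eq_dS (m := r + p + q - 2)
    (H := ((-1 : k) ^ ((p + q + 1) * (r + 1)) * (-1) ^ (p + 1)) • leibnizHomotopy k p q r C F G)
    hX (hY.1.add (hZ.1.smul _)) (fun _ => hom.smul _) ?_ (fun h => ?_) (by omega) (by omega)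
  · rw [map_smul, ← sub_eq_iff_eq_add'.2 e, bracketS, e', bracketS, bracketS, add_comm r p]
    simp only [← cupL_apply (k := k), map_sub, map_smul, LinearMap.sub_apply,
      LinearMap.smul_apply]
    have h1 : (-1 : k) ^ ((r + 1) * (p + q + 1)) * (-1) ^ ((r + 1) * q) =
        (-1) ^ ((r + 1) * (p + 1)) := by
      rw [← pow_add]; refine neg_one_pow_congr ?_
      push_cast
      generalize (p : ZMod 2) = p, (q : ZMod 2) = q, (r : ZMod 2) = r
      revert p q r; decide
    have h2 : (-1 : k) ^ ((r + 1) * (p + q + 1)) =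
        (-1) ^ ((r + 1) * p) * (-1) ^ ((r + 1) * (q + 1)) := by ring
    linear_combination (norm := module) (-h1) • cupL k (p + r - 1) (circS k p r F C) G
      - h2 • cupL k p F (circS k q r G C)
  · rw [leibnizHomotopy_eq_zero (by omega), smul_zero]

variable (k A) in
/-- The canonical Gerstenhaber algebra structure on Hochschild cohomology. -/
theorem exists_gerstenhaberAlgebra :
    ∃ S : GerstenhaberAlgebra k (TotalHH k A) (grading k A),
      (∀ (p q : ℕ) (F G : SeqFun A), IsCocycle k p F → IsCocycle k q G →
        S.mul (clsS k p F) (clsS k q G) = clsS k (p + q) (cupS p F G)) ∧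
      (∀ (p q : ℕ) (F G : SeqFun A), IsCocycle k p F → IsCocycle k q G →
        S.bracket (clsS k p F) (clsS k q G) = clsS k (p + q - 1) (bracketS k p q F G)) ∧
      IsCanonical S := by
  obtain ⟨m, hm⟩ := exists_cup (k := k) (A := A)
  obtain ⟨b, hb⟩ := exists_bracket (k := k) (A := A)
  let S : GerstenhaberAlgebra k (TotalHH k A) (grading k A) :=
    { mul := m
      one := clsS k 0 (oneS A)
      bracket := b
      isInternal := isInternal_grading
      one_mem := clsS_mem _
      mul_mem := by
        intro p q x y hx hy
        obtain ⟨F, hF, rfl⟩ := mem_grading_iff.1 hx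
        obtain ⟨G, hG, rfl⟩ := mem_grading_iff.1 hy
        rw [hm p q F G hF hG]
        exact clsS_mem _
      one_mul := by
        intro x
        induction x using totalHH_induction with
        | hadd x y hx hy => rw [map_add, hx, hy]
        | hcls n F hF =>
        rw [hm 0 n _ _ isCocycle_oneS hF, zero_add]
        congr 1
        funext x
        simp [cupS, oneS]
      mul_one := by
        intro x
        induction x using totalHH_induction with
        | hadd x y hx hy => rw [map_add, LinearMap.add_apply, hx, hy]
        | hcls n F hF =>
        rw [hm n 0 _ _ hF isCocycle_oneS, add_zero]
        congr 1
        funext x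
        simp [cupS, oneS]
      mul_assoc := by
        intro x y z
        induction x using totalHH_induction with
        | hadd x x' hx hx' => simp only [map_add, LinearMap.add_apply, hx, hx']
        | hcls p F hF =>
        induction y using totalHH_induction with
        | hadd x x' hx hx' => simp only [map_add, LinearMap.add_apply, hx, hx']
        | hcls q G hG =>
        induction z using totalHH_induction with
        | hadd x x' hx hx' => simp only [map_add, hx, hx']
        | hcls r H hH =>
        rw [hm p q F G hF hG, hm _ _ _ _ (cupS_isCocycle rfl hF hG) hH, hm q r G H hG hH,
          hm _ _ _ _ hF (cupS_isCocycle rfl hG hH), cupS_assoc, add_assoc]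
      mul_comm := by
        intro p q x y hx hy
        obtain ⟨F, hF, rfl⟩ := mem_grading_iff.1 hx
        obtain ⟨G, hG, rfl⟩ := mem_grading_iff.1 hy
        rw [hm p q F G hF hG, hm q p G F hG hF, clsS_cupS_comm hF hG]
      bracket_mem := by
        intro p q r x y h hx hy
        obtain ⟨F, hF, rfl⟩ := mem_grading_iff.1 hx
        obtain ⟨G, hG, rfl⟩ := mem_grading_iff.1 hy
        obtain rfl : r = p + q - 1 := by omega
        rw [hb p q F G hF hG]
        exact clsS_mem _
      bracket_zero_zero := by
        intro x y hx hy
        obtain ⟨F, hF, rfl⟩ := mem_grading_iff.1 hx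
        obtain ⟨G, hG, rfl⟩ := mem_grading_iff.1 hy
        rw [hb 0 0 F G hF hG, bracketS_zero_zero, clsS_zero]
      bracket_antisymm := by
        intro p q x y hx hy
        obtain ⟨F, hF, rfl⟩ := mem_grading_iff.1 hx
        obtain ⟨G, hG, rfl⟩ := mem_grading_iff.1 hy
        rw [hb p q F G hF hG, hb q p G F hG hF, bracketS_antisymm, ← neg_one_smul k (_ • _),
          smul_smul, add_comm p q, clsS_smul (bracketS_isCocycle (by omega) hG hF), mul_smul,
          neg_one_smul]
      bracket_self := by
        intro p x hp hx
        obtain ⟨F, hF, rfl⟩ := mem_grading_iff.1 hx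
        rw [hb p p F F hF hF, bracketS_self hp, clsS_zero]
      jacobi := by
        intro p q x y hx hy z
        obtain ⟨F, hF, rfl⟩ := mem_grading_iff.1 hx
        obtain ⟨G, hG, rfl⟩ := mem_grading_iff.1 hy
        induction z using totalHH_induction with
        | hadd x x' hx hx' => simp only [map_add, hx, hx']; module
        | hcls r H hH =>
        have h1 := bracketS_bracketS_degree_right (n := p + q + r - 2) rfl hF hG hH
        have h2 := bracketS_bracketS_degree_left (n := p + q + r - 2) rfl hF hG hH
        have h3 := bracketS_bracketS_degree_right (n := p + q + r - 2) (by omega) hG hF hH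
        have hFG := bracketS_isCocycle (n := p + q - 1) (by omega) hF hG
        have hGH := bracketS_isCocycle (n := q + r - 1) (by omega) hG hH
        have hFH := bracketS_isCocycle (n := p + r - 1) (by omega) hF hH
        rw [hb p q F G hF hG, hb q r G H hG hH, hb p r F H hF hH, hb _ _ _ _ hF hGH,
          hb _ _ _ _ hFG hH, hb _ _ _ _ hG hFH, h1.2, h2.2, h3.2,
          bracketS_jacobi hF.isCochain hG.isCochain hH.isCochain, ← clsS_smul h3.1,
          ← clsS_add h2.1 (h3.1.smul _)]
      bracket_bracket_self := by
        intro p x hp hx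
        obtain ⟨F, hF, rfl⟩ := mem_grading_iff.1 hx
        rw [hb p p F F hF hF, hb _ _ _ _ hF (bracketS_isCocycle (by omega) hF hF),
          bracketS_bracketS_self hp hF.isCochain, clsS_zero]
      leibniz := by
        intro r p z x hz hx y
        obtain ⟨C, hC, rfl⟩ := mem_grading_iff.1 hz
        obtain ⟨F, hF, rfl⟩ := mem_grading_iff.1 hx
        induction y using totalHH_induction with
        | hadd x x' hx hx' => simp only [map_add, hx, hx']; module
        | hcls q G hG =>
        rw [hm p q F G hF hG, hb _ _ _ _ hC (cupS_isCocycle rfl hF hG), hb r p C F hC hF,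
          hb r q C G hC hG, hm _ _ _ _ (bracketS_isCocycle (by omega) hC hF) hG,
          hm _ _ _ _ hF (bracketS_isCocycle (by omega) hC hG), clsS_bracketS_cupS hC hF hG] }
  refine ⟨S, hm, hb, ⟨?_, ?_, ?_⟩⟩
  · have h : MultilinearMap.constOfIsEmpty k (fun _ : Fin 0 => A) (1 : A) ∈ cocycles k A 0 := by
      obtain ⟨⟨f, hf⟩, e⟩ := isCocycle_oneS (k := k) (A := A)
      rwa [← ev_injective 0 (e.trans (show oneS A = ev 0 (MultilinearMap.constOfIsEmpty k
        (fun _ : Fin 0 => A) (1 : A)) from rfl))]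
    exact ⟨h, clsS_ev (⟨_, h⟩ : cocycles k A 0)⟩
  · intro p q f g
    obtain ⟨⟨h, hh⟩, e⟩ := cupS_isCocycle (k := k) rfl (isCocycle_ev f) (isCocycle_ev g)
    obtain rfl := ev_injective _ (e.trans (ev_cup _ _).symm)
    exact ⟨hh, by rw [← clsS_ev f, ← clsS_ev g, ← clsS_ev, hm _ _ _ _ (isCocycle_ev f) (isCocycle_ev g), ← e]⟩
  · intro p q r e' f g
    obtain ⟨⟨h, hh⟩, e⟩ := bracketS_isCocycle (k := k) (n := r) (by omega) (isCocycle_ev f) (isCocycle_ev g)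
    obtain rfl := ev_injective _ (e.trans (ev_gBracket e' _ _).symm)
    obtain rfl : r = p + q - 1 := by omega
    exact ⟨hh, by rw [← clsS_ev f, ← clsS_ev g, ← clsS_ev, hb _ _ _ _ (isCocycle_ev f) (isCocycle_ev g), ← e]⟩

end Cohomology

end Hochschild

/-! ### Multilinear forms, rotations and the twisted cyclic differential. -/

namespace Hochschild

section Forms

variable {k A : Type*} [Field k] [Ring A] [Algebra k A]

/-- Functionals of a sequence. -/
abbrev SeqForm (k A : Type*) := (ℕ → A) → k

/-- The multilinear form `ε (h (x_0, …, x_{n-1}) x_n)` of a cochain `h` of degree `n`. -/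
def form (ε : A →ₗ[k] k) (n : ℕ) : SeqFun A →ₗ[k] SeqForm k A where
  toFun h := fun x => ε (h x * x n)
  map_add' f g := by funext x; simp [add_mul]
  map_smul' c f := by funext x; simp

/-- The periodic extension of `x_0, …, x_{N-1}` with twist `σ⁻¹`. -/
def twistExt (σ : A ≃ₐ[k] A) (N : ℕ) (x : ℕ → A) : ℕ → A := fun i =>
  if i < N then x i else σ.symm (x (i - N))

/-- The form `ε (h (x_u, …, x_{N-1}, σ⁻¹ x_0, …, σ⁻¹ x_{u-1}))`. -/
def rotForm (ε : A →ₗ[k] k) (σ : A ≃ₐ[k] A) (N u : ℕ) : SeqFun A →ₗ[k] SeqForm k A where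
  toFun h := fun x => ε (h fun j => twistExt σ N x (u + j))
  map_add' f g := by funext x; simp
  map_smul' c f := by funext x; simp

theorem form_apply (ε : A →ₗ[k] k) (n : ℕ) (h : SeqFun A) (x : ℕ → A) :
    form ε n h x = ε (h x * x n) := rfl

theorem rotForm_apply (ε : A →ₗ[k] k) (σ : A ≃ₐ[k] A) (N u : ℕ) (h : SeqFun A) (x : ℕ → A) :
    rotForm ε σ N u h x = ε (h fun j => twistExt σ N x (u + j)) := rfl

/-- The differential of the twisted cyclic cochain complex. -/
def dForm (σ : A ≃ₐ[k] A) (n : ℕ) : SeqForm k A →ₗ[k] SeqForm k A where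
  toFun φ := fun x => φ (fun j => if j + 1 = n then x n * σ.symm (x 0) else x (j + 1))
    + ∑ i ∈ Finset.range n, (-1 : k) ^ (i + 1) * φ (ins 2 i (x i * x (i + 1)) x)
  map_add' f g := by
    funext x; simp [mul_add, Finset.sum_add_distrib]; ring
  map_smul' c f := by
    funext x; simp [mul_add, Finset.mul_sum, mul_left_comm]

theorem dForm_apply (σ : A ≃ₐ[k] A) (n : ℕ) (φ : SeqForm k A) (x : ℕ → A) :
    dForm σ n φ x = φ (fun j => if j + 1 = n then x n * σ.symm (x 0) else x (j + 1))
      + ∑ i ∈ Finset.range n, (-1 : k) ^ (i + 1) * φ (ins 2 i (x i * x (i + 1)) x) := rfl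

/-- The signed sum of all rotations. -/
def rotSum (ε : A →ₗ[k] k) (σ : A ≃ₐ[k] A) (n : ℕ) : SeqFun A →ₗ[k] SeqForm k A :=
  ∑ u ∈ Finset.range n, ((-1 : k) ^ (n + 1)) ^ u • rotForm ε σ n u

theorem rotSum_apply (ε : A →ₗ[k] k) (σ : A ≃ₐ[k] A) (n : ℕ) (h : SeqFun A) :
    rotSum ε σ n h = ∑ u ∈ Finset.range n, ((-1 : k) ^ (n + 1)) ^ u • rotForm ε σ n u h := by
  simp [rotSum]

/-- Conjugation of a cochain by `σ`. -/
def twist (σ : A ≃ₐ[k] A) : SeqFun A →ₗ[k] SeqFun A where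
  toFun h := fun x => σ (h fun i => σ.symm (x i))
  map_add' f g := by funext x; simp
  map_smul' c f := by funext x; simp

theorem twist_apply (σ : A ≃ₐ[k] A) (h : SeqFun A) (x : ℕ → A) :
    twist σ h x = σ (h fun i => σ.symm (x i)) := rfl

theorem apply_symm_of_twist_eq {σ : A ≃ₐ[k] A} {h : SeqFun A} (hh : twist σ h = h) (x : ℕ → A) :
    h (fun i => σ.symm (x i)) = σ.symm (h x) := by
  have := congrFun hh x
  rw [twist_apply] at this
  rw [← this, AlgEquiv.symm_apply_apply]

theorem twist_pcomp (σ : A ≃ₐ[k] A) (q v : ℕ) (f g : SeqFun A) :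
    twist σ (pcomp q v f g) = pcomp q v (twist σ f) (twist σ g) := by
  funext x
  simp only [twist_apply, pcomp]
  congr 2
  funext j
  simp only [ins]
  split_ifs <;> simp

theorem twist_cupS (σ : A ≃ₐ[k] A) (p : ℕ) (f g : SeqFun A) :
    twist σ (cupS p f g) = cupS p (twist σ f) (twist σ g) := by
  funext x
  simp [twist_apply, cupS]

theorem twist_mulS (σ : A ≃ₐ[k] A) : twist σ (mulS A) = mulS A := by
  funext x
  simp [twist_apply, mulS]

theorem twist_oneS (σ : A ≃ₐ[k] A) : twist σ (oneS A) = oneS A := by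
  funext x
  simp [twist_apply, oneS]

theorem twist_coface (σ : A ≃ₐ[k] A) (n i : ℕ) (f : SeqFun A) :
    twist σ (coface k n i f) = coface k n i (twist σ f) := by
  simp only [coface, LinearMap.coe_mk, AddHom.coe_mk]
  split_ifs <;> rw [twist_pcomp, twist_mulS]

theorem twist_dS (σ : A ≃ₐ[k] A) (n : ℕ) (f : SeqFun A) :
    twist σ (dS k n f) = dS k n (twist σ f) := by
  simp only [dS, lowD_apply, map_sum, map_smul, twist_coface]

variable {ε : A →ₗ[k] k} {σ : A ≃ₐ[k] A}

theorem IsNakayamaAutomorphism.apply_apply (hσ : IsNakayamaAutomorphism ε σ) (a : A) :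
    ε (σ a) = ε a := by
  have := hσ 1 a
  rw [one_mul, mul_one] at this
  exact this.symm

theorem IsNakayamaAutomorphism.mul_symm (hσ : IsNakayamaAutomorphism ε σ) (a b : A) :
    ε (a * σ.symm b) = ε (b * a) := by
  rw [hσ, AlgEquiv.apply_symm_apply]

theorem IsNakayamaAutomorphism.symm_apply (hσ : IsNakayamaAutomorphism ε σ) (a : A) :
    ε (σ.symm a) = ε a := by
  rw [← IsNakayamaAutomorphism.apply_apply hσ, AlgEquiv.apply_symm_apply]

/-- The Nakayama relation moves the outer factor `x_0` of the first face to the end, where it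
multiplies the last argument as `σ⁻¹ x_0`. The last face becomes the merging of the last two
arguments. -/
theorem form_dS (hσ : IsNakayamaAutomorphism ε σ) {m : ℕ} {f : SeqFun A} (hf : HasArity m f) :
    form ε (m + 1) (dS k m f) = dForm σ (m + 1) (form ε m f) := by
  funext x
  rw [dS_eq, dForm_apply, Finset.sum_range_succ, ← add_assoc]
  simp only [map_add, map_sum, map_smul]
  simp only [Pi.add_apply, Finset.sum_apply, Pi.smul_apply, smul_eq_mul, form_apply]
  congr 1
  · congr 1
    · simp only [if_true, ← mul_assoc]
      rw [IsNakayamaAutomorphism.mul_symm hσ, ← mul_assoc]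
      congr 2
      simp only [pcomp, mulS, ins, zero_lt_one, if_true, lt_irrefl, if_false]
      congr 1
      refine hf _ _ fun l hl => ?_
      rw [if_neg (by omega), add_comm]
    · refine Finset.sum_congr rfl fun i hi => ?_
      have hi := Finset.mem_range.1 hi
      congr 2
      simp only [pcomp, mulS, add_zero]
      congr 1
      simp only [ins]
      rw [if_neg (by omega), if_neg (by omega)]
      congr 1
  · congr 2
    simp only [pcomp, mulS, ins, lt_irrefl, if_false, if_true, zero_add, one_ne_zero,
      add_tsub_cancel_left, not_lt_zero, mul_assoc]
    congr 1
    · refine hf _ _ fun l hl => ?_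
      simp [ins, hl]

/-- Cut the circle of arguments before `x_u`. Merging neighbours to the right of the cut is an inner
coface of `h`, read from the cut `u`. Merging neighbours to the left shifts the cut to `u + 1`, and
so does merging `x_n` with `σ⁻¹ x_0`; these are the next two lemmas. -/
theorem rotForm_merge_ge {n u l : ℕ} (hl : u + l < n) {h : SeqFun A} (hh : HasArity n h)
    (x : ℕ → A) : rotForm ε σ n u h (ins 2 (u + l) (x (u + l) * x (u + l + 1)) x)
      = rotForm ε σ (n + 1) u (coface k n (l + 1) h) x := by
  rw [coface_succ (by omega), rotForm_apply, rotForm_apply, pcomp]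
  congr 1
  refine hh _ _ fun j hj => ?_
  simp only [twistExt, ins, mulS, add_zero]
  rw [if_pos (show u + l < n + 1 by omega), if_pos (show u + (l + 1) < n + 1 by omega)]
  rcases lt_trichotomy j l with hjl | rfl | hjl
  · rw [if_pos (by omega), if_pos (by omega), if_pos hjl, if_pos (by omega)]
  · rw [if_pos (by omega), if_neg (by omega), if_pos rfl, if_neg (by omega), if_pos rfl, add_assoc]
  · rw [if_neg (show ¬ j < l by omega), if_neg (show ¬ j = l by omega)]
    by_cases hjn : u + j < n
    · rw [if_pos hjn, if_neg (by omega), if_neg (by omega), if_pos (by omega)]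
      congr 1
    · rw [if_neg hjn, if_pos (by omega), if_neg (by omega)]
      congr 2
      omega

theorem rotForm_merge_lt {n u m i : ℕ} (hn : n = u + 1 + m) (hi : i < u) {h : SeqFun A}
    (hh : HasArity n h) (x : ℕ → A) : rotForm ε σ n u h (ins 2 i (x i * x (i + 1)) x)
      = rotForm ε σ (n + 1) (u + 1) (coface k n (m + 1 + i + 1) h) x := by
  rw [coface_succ (by omega), rotForm_apply, rotForm_apply, pcomp]
  congr 1
  refine hh _ _ fun j hj => ?_
  simp only [twistExt, ins, mulS, add_zero]
  rw [if_neg (show ¬ u + 1 + (m + 1 + i) < n + 1 by omega),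
    if_neg (show ¬ u + 1 + (m + 1 + i + 1) < n + 1 by omega)]
  by_cases hjn : u + j < n
  · rw [if_pos hjn, if_neg (by omega), if_neg (by omega), if_pos (by omega), if_pos (by omega)]
    congr 1
    omega
  · rw [if_neg hjn]
    rcases lt_trichotomy j (m + 1 + i) with hji | hji | hji
    · rw [if_pos (by omega), if_pos hji, if_neg (by omega)]
      congr 2
      omega
    · rw [if_neg (by omega), if_pos (by omega), if_neg (by omega), if_pos hji, map_mul]
      congr 3 <;> omega
    · rw [if_neg (by omega), if_neg (by omega), if_neg (by omega), if_neg (by omega),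
        if_neg (by omega)]
      congr 2
      omega

theorem rotForm_merge_cyclic {n u m : ℕ} (hn : n = u + 1 + m) {h : SeqFun A}
    (hh : HasArity n h) (x : ℕ → A) :
    rotForm ε σ n u h (fun j => if j + 1 = n then x n * σ.symm (x 0) else x (j + 1))
      = rotForm ε σ (n + 1) (u + 1) (coface k n (m + 1) h) x := by
  rw [coface_succ (by omega), rotForm_apply, rotForm_apply, pcomp]
  congr 1
  refine hh _ _ fun j hj => ?_
  simp only [twistExt, ins, mulS, add_zero]
  rw [if_pos (show u + 1 + m < n + 1 by omega), if_neg (show ¬ u + 1 + (m + 1) < n + 1 by omega)]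
  rcases lt_trichotomy j m with hjm | hjm | hjm
  · rw [if_pos (by omega), if_neg (by omega), if_pos hjm, if_pos (by omega)]
    congr 1
    omega
  · rw [if_pos (by omega), if_pos (by omega), if_neg (by omega), if_pos hjm, hn]
    congr 3
    omega
  · rw [if_neg (by omega), if_neg (by omega), if_neg (by omega), if_neg (by omega),
      if_neg (by omega)]
    congr 2
    omega

/-- The Nakayama relation moves the factor `x_u` in front of `h` behind it as `σ⁻¹ x_u`, which is
the outer argument on the right when reading starts at `u + 1`. -/
theorem rotForm_coface_zero (hσ : IsNakayamaAutomorphism ε σ) {n u : ℕ} (hu : u ≤ n)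
    (h : SeqFun A) : rotForm ε σ (n + 1) u (coface k n 0 h)
      = rotForm ε σ (n + 1) (u + 1) (coface k n (n + 1) h) := by
  funext x
  rw [rotForm_apply, rotForm_apply, coface_zero_apply, coface_last_apply]
  have : twistExt σ (n + 1) x (u + 1 + n) = σ.symm (twistExt σ (n + 1) x (u + 0)) := by
    simp only [twistExt, add_zero]
    rw [if_neg (by omega), if_pos (by omega)]
    congr 2
    omega
  rw [this, IsNakayamaAutomorphism.mul_symm hσ]
  simp only [add_assoc]

/-- The differential of a rotated form. -/
theorem dForm_rotForm (hσ : IsNakayamaAutomorphism ε σ) {n u m : ℕ} (hn : n = u + 1 + m)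
    {h : SeqFun A} (hh : HasArity n h) :
    dForm σ n (rotForm ε σ n u h) =
      (-1 : k) ^ u • rotForm ε σ (n + 1) u (lowD k n (m + 1) h)
      + (-1 : k) ^ (n + u) • rotForm ε σ (n + 1) (u + 1) (dS k n h - lowD k n m h) := by
  have e1 : lowD k n (m + 1) h = coface k n 0 h
      + ∑ l ∈ Finset.range (m + 1), (-1 : k) ^ (l + 1) • coface k n (l + 1) h := by
    rw [lowD_apply, Finset.sum_range_succ', add_comm, pow_zero, one_smul]
  have e2 : dS k n h - lowD k n m h = (-1 : k) ^ (m + 1) • coface k n (m + 1) h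
      + ∑ i ∈ Finset.range u, (-1 : k) ^ (m + i) • coface k n (m + 1 + i + 1) h
      + (-1 : k) ^ (n + 1) • coface k n (n + 1) h := by
    rw [dS, lowD_succ, lowD_apply, show n + 1 = m + 1 + (u + 1) by omega, Finset.sum_range_add,
      ← lowD_apply, Finset.sum_range_succ']
    have : ∀ i, (-1 : k) ^ (m + 1 + (i + 1)) = (-1) ^ (m + i) := fun i => by ring
    simp only [this]
    simp only [← add_assoc, add_zero]
    abel
  funext x
  rw [dForm_apply, rotForm_merge_cyclic hn hh, e1, e2]
  simp only [map_add, map_sum, map_smul, Pi.add_apply, Finset.sum_apply, Pi.smul_apply,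
    smul_eq_mul]
  -- The left side has no outer faces. Those on the right are now equal and cancel by `g2`.
  rw [rotForm_coface_zero hσ (by omega : u ≤ n)]
  conv_lhs => rw [show Finset.range n = Finset.range (u + (m + 1)) by rw [hn, add_assoc, add_comm 1]]
  rw [Finset.sum_range_add]
  have s1 : ∑ i ∈ Finset.range u, (-1 : k) ^ (i + 1) *
        rotForm ε σ n u h (ins 2 i (x i * x (i + 1)) x)
      = (-1 : k) ^ (n + u) * ∑ i ∈ Finset.range u, (-1 : k) ^ (m + i) *
        rotForm ε σ (n + 1) (u + 1) (coface k n (m + 1 + i + 1) h) x := by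
    rw [Finset.mul_sum]
    refine Finset.sum_congr rfl fun i hi => ?_
    rw [rotForm_merge_lt hn (Finset.mem_range.1 hi) hh, ← mul_assoc, ← pow_add, hn]
    congr 1
    refine neg_one_pow_congr ?_
    push_cast
    generalize (u : ZMod 2) = u, (m : ZMod 2) = m, (i : ZMod 2) = i
    revert u m i; decide
  have s2 : ∑ l ∈ Finset.range (m + 1), (-1 : k) ^ (u + l + 1) *
        rotForm ε σ n u h (ins 2 (u + l) (x (u + l) * x (u + l + 1)) x)
      = (-1 : k) ^ u * ∑ l ∈ Finset.range (m + 1), (-1 : k) ^ (l + 1) *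
        rotForm ε σ (n + 1) u (coface k n (l + 1) h) x := by
    rw [Finset.mul_sum]
    refine Finset.sum_congr rfl fun l hl => ?_
    have := Finset.mem_range.1 hl
    rw [rotForm_merge_ge (by omega) hh, ← mul_assoc, ← pow_add, add_assoc]
  rw [s1, s2]
  have g1 : (-1 : k) ^ (n + u) * (-1) ^ (m + 1) = 1 := by
    rw [hn, ← pow_add, show u + 1 + m + u + (m + 1) = 2 * (u + m + 1) by ring, pow_mul]; simp
  have g2 : (-1 : k) ^ (n + u) * (-1) ^ (n + 1) = - (-1) ^ u := by
    rw [← pow_add, show n + u + (n + 1) = 2 * n + (u + 1) by ring, pow_add, pow_mul]; simp [pow_succ]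
  linear_combination (-rotForm ε σ (n + 1) (u + 1) (coface k n (m + 1) h) x) * g1
    - rotForm ε σ (n + 1) (u + 1) (coface k n (n + 1) h) x * g2

theorem rotForm_coface_last (n : ℕ) {h : SeqFun A} (hh : HasArity n h) :
    rotForm ε σ (n + 1) 0 (coface k n (n + 1) h) = form ε n h := by
  funext x
  rw [rotForm_apply, coface_last_apply, form_apply]
  congr 2
  · refine hh _ _ fun l hl => ?_
    simp [twistExt, show l < n + 1 by omega]
  · simp [twistExt]

/-- From the cut `n` every argument of `h` carries `σ⁻¹`, and moving `x_n` behind the value of `h`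
applies `σ` to that value. This is the source of the twist in `dForm_rotSum`. -/
theorem rotForm_coface_zero_last (hσ : IsNakayamaAutomorphism ε σ) (n : ℕ) (h : SeqFun A) :
    rotForm ε σ (n + 1) n (coface k n 0 h) = form ε n (twist σ h) := by
  funext x
  rw [rotForm_apply, coface_zero_apply, form_apply, twist_apply, ← IsNakayamaAutomorphism.mul_symm hσ,
    ← IsNakayamaAutomorphism.apply_apply hσ, map_mul, AlgEquiv.apply_symm_apply]
  have : ∀ l, twistExt σ (n + 1) x (n + (1 + l)) = σ.symm (x l) := fun l => by
    simp only [twistExt]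
    rw [if_neg (by omega)]
    congr 2
    omega
  simp only [this]
  simp [twistExt]

/-- The rotation sum anticommutes with the differential up to the action of `σ`. -/
theorem dForm_rotSum (hσ : IsNakayamaAutomorphism ε σ) {n : ℕ} {h : SeqFun A}
    (hh : HasArity n h) : dForm σ n (rotSum ε σ n h) =
      rotSum ε σ (n + 1) (dS k n h) + (-1 : k) ^ n • (form ε n h - form ε n (twist σ h)) := by
  have key : ∀ u ∈ Finset.range n,
      ((-1 : k) ^ (n + 1)) ^ u • dForm σ n (rotForm ε σ n u h) =
        ((-1 : k) ^ n) ^ (u + 1) • rotForm ε σ (n + 1) (u + 1) (dS k n h)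
        - (((-1 : k) ^ n) ^ (u + 1) • rotForm ε σ (n + 1) (u + 1) (lowD k n (n - (u + 1)) h)
        - ((-1 : k) ^ n) ^ u • rotForm ε σ (n + 1) u (lowD k n (n - u) h)) := fun u hu => by
    have hu := Finset.mem_range.1 hu
    rw [dForm_rotForm hσ (show n = u + 1 + (n - (u + 1)) by omega) hh,
      show n - (u + 1) + 1 = n - u by omega, map_sub]
    have g1 : ((-1 : k) ^ (n + 1)) ^ u = ((-1 : k) ^ n) ^ u * (-1) ^ u := by
      rw [pow_succ, mul_pow]
    have g2 := neg_one_pow_mul_self (k := k) u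
    rw [g1, pow_add, pow_succ _ u]
    generalize ((-1 : k) ^ n) ^ u = a at *
    linear_combination (norm := module) (a * g2) • rotForm ε σ (n + 1) u (lowD k n (n - u) h)
      + ((-1 : k) ^ n * a * g2) •
        (rotForm ε σ (n + 1) (u + 1) (dS k n h)
          - rotForm ε σ (n + 1) (u + 1) (lowD k n (n - (u + 1)) h))
  rw [rotSum_apply, map_sum]
  simp only [map_smul]
  -- The partial differentials telescope over the cuts. The end `u = n` gives the form of the
  -- conjugate of `h`; the end `u = 0` gives the form of `h` and the missing summand `u = 0` of
  -- `rotSum (d h)`.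
  rw [Finset.sum_congr rfl key, Finset.sum_sub_distrib,
    Finset.sum_range_sub fun u => ((-1 : k) ^ n) ^ u • rotForm ε σ (n + 1) u (lowD k n (n - u) h),
    rotSum_apply, Finset.sum_range_succ']
  have g3 : (-1 : k) ^ (n + 1 + 1) = (-1) ^ n := by ring
  have g4 : ((-1 : k) ^ n) ^ n = (-1) ^ n := by
    rw [← pow_mul]; refine neg_one_pow_congr ?_
    push_cast
    generalize (n : ZMod 2) = n
    revert n; decide
  rw [g3, g4, Nat.sub_self, lowD_zero, rotForm_coface_zero_last hσ, Nat.sub_zero, dS, lowD_succ,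
    map_add, map_smul, rotForm_coface_last n hh, pow_succ _ n]
  module

end Forms

end Hochschild

/-! ### Cochains representing rotation sums, and the square of the operator. -/

namespace Hochschild

section Rotation

variable {k A : Type*} [Field k] [Ring A] [Algebra k A] {ε : A →ₗ[k] k} {σ : A ≃ₐ[k] A}

/-! ### Cochains and multilinear forms -/

variable (k A) in
/-- Multilinear forms as functionals of sequences. -/
def evForm (n : ℕ) : MultilinearMap k (fun _ : Fin n => A) k →ₗ[k] SeqForm k A where
  toFun M := fun x => M fun i => x i
  map_add' _ _ := rfl
  map_smul' _ _ := rfl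

theorem evForm_apply {n : ℕ} (M : MultilinearMap k (fun _ : Fin n => A) k) (x : ℕ → A) :
    evForm k A n M x = M fun i => x i := rfl

theorem form_injective (hε : IsFrobeniusFunctional ε) {n : ℕ} {f g : SeqFun A}
    (hf : HasArity n f) (hg : HasArity n g) (h : form ε n f = form ε n g) : f = g := by
  funext x
  refine hε.1 (LinearMap.ext fun a => ?_)
  have := congrFun h fun j => if j < n then x j else a
  rw [form_apply, form_apply, if_neg (lt_irrefl n),
    hf _ x (fun l hl => if_pos hl), hg _ x (fun l hl => if_pos hl)] at this
  exact this

/-- Since `a ↦ ε (a · )` is bijective, the last argument of a form can be traded for the value of a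
cochain. -/
theorem exists_form_eq (hε : IsFrobeniusFunctional ε) {n : ℕ} {φ : SeqForm k A}
    (h : φ ∈ LinearMap.range (evForm k A (n + 1))) : ∃ b, IsCochain k n b ∧ form ε n b = φ := by
  obtain ⟨M, rfl⟩ := h
  let L : A →ₗ[k] Module.Dual k A :=
    { toFun := fun a => ε ∘ₗ LinearMap.mulLeft k a
      map_add' := fun a b => by ext; simp [add_mul]
      map_smul' := fun c a => by ext; simp }
  let e : A ≃ₗ[k] Module.Dual k A := LinearEquiv.ofBijective L hε
  let M' : MultilinearMap k (fun _ : Fin (n + 1) => A) k := M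
  refine ⟨ev n (e.symm.toLinearMap.compMultilinearMap M'.curryRight), isCochain_ev _, ?_⟩
  funext x
  have h1 : ∀ (φ : Module.Dual k A) (y : A), ε (e.symm φ * y) = φ y := fun φ y =>
    LinearMap.congr_fun (e.apply_symm_apply φ) y
  rw [form_apply, evForm_apply, ev_apply, LinearMap.compMultilinearMap_apply]
  refine (h1 _ _).trans ?_
  rw [MultilinearMap.curryRight_apply]
  show M _ = M _
  congr 1
  funext i
  refine Fin.lastCases ?_ (fun i => ?_) i <;> simp

theorem rotForm_mem {n u : ℕ} (hu : u < n) {h : SeqFun A} (hh : IsCochain k n h) :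
    rotForm ε σ n u h ∈ LinearMap.range (evForm k A n) := by
  obtain ⟨f, rfl⟩ := hh
  obtain ⟨m, rfl⟩ : ∃ m, n = m + 1 := ⟨n - 1, by omega⟩
  -- Addition in `Fin (m + 1)` wraps around and thus realises the rotation.
  let e : Fin (m + 1) ≃ Fin (m + 1) := Equiv.addLeft ⟨u, hu⟩
  have he : ∀ j : Fin (m + 1), (e j : ℕ) = if u + j < m + 1 then u + (j : ℕ) else u + j - (m + 1) :=
    fun j => by
      have h1 : (e j : ℕ) = (u + j) % (m + 1) := rfl
      rw [h1]
      split_ifs with h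
      · exact Nat.mod_eq_of_lt h
      · rw [Nat.mod_eq_sub_mod (by omega), Nat.mod_eq_of_lt (by omega)]
  refine ⟨((ε.compMultilinearMap f).compLinearMap fun j : Fin (m + 1) =>
    if u + j < m + 1 then LinearMap.id else σ.symm.toLinearMap).domDomCongr e, ?_⟩
  funext x
  rw [rotForm_apply, evForm_apply, MultilinearMap.domDomCongr_apply,
    MultilinearMap.compLinearMap_apply, LinearMap.compMultilinearMap_apply, ev_apply]
  congr 2
  funext j
  simp only [he, twistExt]
  split_ifs <;> simp

theorem rotSum_mem {n : ℕ} {h : SeqFun A} (hh : IsCochain k n h) :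
    rotSum ε σ n h ∈ LinearMap.range (evForm k A n) := by
  rw [rotSum_apply]
  exact Submodule.sum_mem _ fun u hu =>
    Submodule.smul_mem _ _ (rotForm_mem (Finset.mem_range.1 hu) hh)

/-- The cochain `b` is the value of the operator up to sign. For `n = 0` the rotation sum is empty,
and the truncated degree does no harm because `b = 0`. -/
theorem exists_rotSum (hε : IsFrobeniusFunctional ε) (σ : A ≃ₐ[k] A) {n : ℕ} {h : SeqFun A}
    (hh : IsCochain k n h) : ∃ b, IsCochain k (n - 1) b ∧ form ε (n - 1) b = rotSum ε σ n h := by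
  cases n with
  | zero => exact ⟨0, Submodule.zero_mem _, by simp [rotSum]⟩
  | succ n => exact exists_form_eq hε (rotSum_mem hh)

theorem rotForm_comp_symm (hσ : IsNakayamaAutomorphism ε σ) {N u : ℕ} {h : SeqFun A}
    (hh : twist σ h = h) (x : ℕ → A) :
    rotForm ε σ N u h (fun i => σ.symm (x i)) = rotForm ε σ N u h x := by
  have h1 : (h fun j => twistExt σ N (fun i => σ.symm (x i)) (u + j))
      = σ.symm (h fun j => twistExt σ N x (u + j)) := by
    rw [← apply_symm_of_twist_eq hh]
    congr 1
    funext j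
    simp only [twistExt]
    split_ifs <;> rfl
  rw [rotForm_apply, rotForm_apply, h1, IsNakayamaAutomorphism.symm_apply hσ]

/-- As `ε ∘ σ⁻¹ = ε`, the rotation sum of an invariant cochain does not change if `σ⁻¹` is applied
to all arguments; injectivity of `form` passes this on to `b`. -/
theorem twist_of_form_eq_rotSum (hε : IsFrobeniusFunctional ε) (hσ : IsNakayamaAutomorphism ε σ)
    {m n : ℕ} {h b : SeqFun A} (hh : twist σ h = h) (hb : HasArity m b)
    (hform : form ε m b = rotSum ε σ n h) : twist σ b = b := by
  refine form_injective hε (n := m) (fun x y hxy => ?_) hb ?_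
  · rw [twist_apply, twist_apply, hb _ _ fun l hl => by rw [hxy l hl]]
  · funext x
    have h1 := congrFun hform fun i => σ.symm (x i)
    rw [form_apply] at h1
    rw [form_apply, twist_apply, ← IsNakayamaAutomorphism.symm_apply hσ, map_mul,
      AlgEquiv.symm_apply_apply, h1, hform, rotSum_apply]
    simp only [Finset.sum_apply, Pi.smul_apply, rotForm_comp_symm hσ hh]

/-- A full turn applies `σ⁻¹` to all arguments, hence to the value of an invariant `h`, where `ε`
does not see it. This closes the cycle when a rotation sum is reindexed. -/
theorem rotForm_full (hσ : IsNakayamaAutomorphism ε σ) {n : ℕ} {h : SeqFun A}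
    (ha : HasArity n h) (hh : twist σ h = h) : rotForm ε σ n n h = rotForm ε σ n 0 h := by
  funext x
  rw [rotForm_apply, rotForm_apply]
  have h1 : (h fun j => twistExt σ n x (n + j)) = σ.symm (h x) := by
    rw [← apply_symm_of_twist_eq hh]
    congr 1
    funext j
    simp [twistExt]
  rw [h1, IsNakayamaAutomorphism.symm_apply hσ]
  congr 1
  refine ha _ _ fun l hl => ?_
  simp [twistExt, hl]

/-! ### The square of the operator -/

/-- Rotating the arguments shifts the summands `u` to `u + 1` cyclically; the sign is the ratio of
consecutive coefficients. -/
theorem form_cyclic (hσ : IsNakayamaAutomorphism ε σ) {m : ℕ} {f b : SeqFun A}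
    (hf : HasArity (m + 1) f) (hft : twist σ f = f) (hform : form ε m b = rotSum ε σ (m + 1) f)
    (x : ℕ → A) :
    form ε m b (fun j => twistExt σ (m + 1) x (1 + j)) = (-1 : k) ^ m * form ε m b x := by
  have h1 : ∀ u < m + 1, rotForm ε σ (m + 1) u f (fun j => twistExt σ (m + 1) x (1 + j))
      = rotForm ε σ (m + 1) (u + 1) f x := fun u hu => by
    rw [rotForm_apply, rotForm_apply]
    congr 1
    refine hf _ _ fun j hj => ?_
    simp only [twistExt]
    by_cases h : u + j < m + 1
    · rw [if_pos h, show 1 + (u + j) = u + 1 + j by omega]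
    · rw [if_neg h, if_pos (by omega), if_neg (by omega)]
      congr 2
      omega
  rw [hform, rotSum_apply]
  simp only [Finset.sum_apply, Pi.smul_apply, smul_eq_mul]
  have e1 := Finset.sum_range_succ' (fun u => ((-1 : k) ^ (m + 1 + 1)) ^ u *
    rotForm ε σ (m + 1) u f x) (m + 1)
  rw [Finset.sum_range_succ, rotForm_full hσ hf hft] at e1
  have g : ((-1 : k) ^ (m + 1 + 1)) ^ (m + 1) = 1 := by
    rw [← pow_mul, mul_comm]; exact (Nat.even_mul_succ_self (m + 1)).neg_one_pow
  rw [g, pow_zero] at e1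
  rw [add_right_cancel e1, Finset.mul_sum]
  refine Finset.sum_congr rfl fun u hu => ?_
  rw [h1 u (Finset.mem_range.1 hu)]
  have g2 := neg_one_pow_mul_self (k := k) m
  have g3 : (-1 : k) ^ (m + 1 + 1) = (-1) ^ m := by ring
  rw [g3, pow_succ]
  linear_combination (-((-1 : k) ^ m) ^ u * rotForm ε σ (m + 1) (u + 1) f x) * g2

/-- Multiplication by the inserted unit returns `f` twice with opposite signs. As `d f = 0`, only
the zeroth coface is left. -/
theorem dS_pcomp_oneS {m : ℕ} {f : SeqFun A} (hf : IsCochain k (m + 1) f)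
    (hd : dS k (m + 1) f = 0) :
    dS k m (pcomp 0 0 f (oneS A)) = coface k m 0 (pcomp 0 0 f (oneS A)) := by
  obtain ⟨L, hL⟩ := hf.linear 1 (Nat.succ_pos m)
  have h1 : pcomp 1 0 f (coface k 0 0 (oneS A)) = f := by
    funext x
    simp only [pcomp, coface_zero_apply, oneS, mul_one]
    congr 1
    funext j
    simp only [ins]
    rcases j with _ | j <;> simp
  rw [dS_pcomp (p := m + 1) (q := 0) (by omega) (by omega) hf
      (isCocycle_oneS (k := k)).isCochain.hasArity,
    pcomp_lowD_succ (n := m) (by omega) (by omega), hd, isCocycle_oneS.dS, lowD_zero, lowD_zero,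
    pcomp_coface_zero_zero, zero_add, ← hL 0, map_zero, h1, ← pcompL_apply (k := k) 0 0 0, map_zero]
  have h2 : cupS 0 (oneS A) f = f := by
    funext x
    simp [cupS, oneS]
  rw [h2]
  module

/-- Cyclic invariance of the form of `b` moves the unit from the first argument to the last, where
it disappears from the product. What remains is a rotation of `b` with the cut shifted by one. -/
theorem rotSum_coface_zero (hσ : IsNakayamaAutomorphism ε σ) {m : ℕ} {f b : SeqFun A}
    (hf : HasArity (m + 2) f) (hft : twist σ f = f) (hb : HasArity (m + 1) b)
    (hbt : twist σ b = b) (hform : form ε (m + 1) b = rotSum ε σ (m + 2) f) :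
    rotSum ε σ (m + 1) (coface k m 0 (pcomp 0 0 b (oneS A))) = -rotSum ε σ (m + 1) b := by
  have key : ∀ u < m + 1, rotForm ε σ (m + 1) u (coface k m 0 (pcomp 0 0 b (oneS A)))
      = (-1 : k) ^ (m + 1) • rotForm ε σ (m + 1) (u + 1) b := fun u hu => by
    funext x
    -- The relevant arguments are `1, x_{u+1}, …, σ⁻¹ x_u`: the factor in front of `b (1, …)` has
    -- been moved to the end.
    let z : ℕ → A := fun j => if j = 0 then 1 else twistExt σ (m + 1) x (u + j)
    have h1 : rotForm ε σ (m + 1) u (coface k m 0 (pcomp 0 0 b (oneS A))) x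
        = form ε (m + 1) b z := by
      have h3 : z (m + 1) = σ.symm (twistExt σ (m + 1) x (u + 0)) := by
        simp only [z, twistExt]
        rw [if_neg (by omega), if_neg (by omega), if_pos (by omega)]
        congr 2
        omega
      rw [rotForm_apply, coface_zero_apply, form_apply, h3, IsNakayamaAutomorphism.mul_symm hσ]
      congr 2
      simp only [pcomp, oneS]
      congr 1
      funext j
      simp only [ins, z]
      rcases j with _ | j
      · simp
      · simp [add_comm]
    have h2 := form_cyclic hσ hf hft hform z
    have h4 : form ε (m + 1) b (fun j => twistExt σ (m + 2) z (1 + j))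
        = rotForm ε σ (m + 1) (u + 1) b x := by
      rw [form_apply, rotForm_apply]
      have h5 : twistExt σ (m + 2) z (1 + (m + 1)) = 1 := by
        simp only [twistExt, z]
        rw [if_neg (by omega), if_pos (by omega), map_one]
      rw [h5, mul_one]
      congr 1
      refine hb _ _ fun j hj => ?_
      simp only [twistExt, z]
      rw [if_pos (by omega), if_neg (by omega), add_assoc]
    rw [h4] at h2
    rw [h1, Pi.smul_apply, h2, smul_eq_mul, ← mul_assoc, neg_one_pow_mul_self, one_mul]
  rw [rotSum_apply, rotSum_apply]
  have e1 := Finset.sum_range_succ' (fun u => ((-1 : k) ^ (m + 1 + 1)) ^ u •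
    rotForm ε σ (m + 1) u b) (m + 1)
  rw [Finset.sum_range_succ, rotForm_full hσ hb hbt] at e1
  have g : ((-1 : k) ^ (m + 1 + 1)) ^ (m + 1) = 1 := by
    rw [← pow_mul, mul_comm]; exact (Nat.even_mul_succ_self (m + 1)).neg_one_pow
  rw [g, pow_zero] at e1
  rw [add_right_cancel e1, ← Finset.sum_neg_distrib]
  refine Finset.sum_congr rfl fun u hu => ?_
  rw [key u (Finset.mem_range.1 hu), smul_smul, ← neg_one_smul k (_ • _), smul_smul]
  congr 1
  ring

/-- The square of the operator is a coboundary on invariant cocycles. -/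
theorem isBoundary_rotSum_rotSum (hε : IsFrobeniusFunctional ε) (hσ : IsNakayamaAutomorphism ε σ)
    {m : ℕ} {f b c : SeqFun A} (hf : IsCochain k (m + 2) f) (hft : twist σ f = f)
    (hb : IsCochain k (m + 1) b) (hdb : dS k (m + 1) b = 0)
    (hbf : form ε (m + 1) b = rotSum ε σ (m + 2) f) (hc : IsCochain k m c)
    (hcf : form ε m c = rotSum ε σ (m + 1) b) : IsBoundary k m c := by
  have hbt := twist_of_form_eq_rotSum hε hσ hft hb.hasArity hbf
  -- The rotation sum of `b (1, ·)` is the homotopy: by the two preceding lemmas its differential is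
  -- `-rotSum b`.
  have hh : IsCochain k m (pcomp 0 0 b (oneS A)) :=
    hb.pcomp (by omega) (by omega) isCocycle_oneS.isCochain
  have hht : twist σ (pcomp 0 0 b (oneS A)) = pcomp 0 0 b (oneS A) := by
    rw [twist_pcomp, hbt, twist_oneS]
  have h1 := dForm_rotSum hσ hh.hasArity
  rw [hht, sub_self, smul_zero, add_zero, dS_pcomp_oneS hb hdb,
    rotSum_coface_zero hσ hf.hasArity hft hb.hasArity hbt hbf, ← hcf] at h1
  cases m with
  | zero =>
    refine form_injective hε hc.hasArity (fun _ _ _ => rfl : HasArity 0 (0 : SeqFun A)) ?_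
    rw [map_zero, ← neg_eq_zero, ← h1]
    simp [rotSum]
  | succ m =>
    obtain ⟨e, he, hef⟩ := exists_rotSum hε σ hh
    simp only [Nat.add_sub_cancel] at he hef
    refine ⟨(-1 : k) • e, he.smul _, ?_⟩
    refine form_injective hε (n := m + 1) (he.smul (-1)).dS.hasArity hc.hasArity ?_
    rw [map_smul, map_smul, form_dS hσ he.hasArity, hef, h1]
    module

end Rotation

end Hochschild

/-! ### The rotation sum of a cup product generates the bracket. -/

namespace Hochschild

/-- Over the triangle `w < v < p` the differences of `G` telescope in `w` and those of `Q` in `v`.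
Two sides and the diagonal of the triangle remain. -/
theorem sum_triangle_telescope {M : Type*} [AddCommGroup M] (G Q : ℕ → ℕ → M) (p : ℕ) :
    ∑ v ∈ Finset.range p, ∑ w ∈ Finset.range v,
        ((G (w + 1) v - G w v) + (Q w (v + 1) - Q w v))
      = ∑ v ∈ Finset.range p, (-G 0 v + Q v p + (G v v - Q v (v + 1))) := by
  induction p with
  | zero => simp
  | succ p ih =>
    have h : ∑ w ∈ Finset.range p, ((G (w + 1) p - G w p) + (Q w (p + 1) - Q w p))
        = G p p - G 0 p + (∑ w ∈ Finset.range p, Q w (p + 1) - ∑ w ∈ Finset.range p, Q w p) := by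
      rw [Finset.sum_add_distrib, Finset.sum_range_sub (fun w => G w p), Finset.sum_sub_distrib]
    rw [Finset.sum_range_succ, ih, Finset.sum_range_succ, h]
    simp only [Finset.sum_add_distrib]
    abel

section Generator

variable {k A : Type*} [Field k] [Ring A] [Algebra k A] {ε : A →ₗ[k] k} {σ : A ≃ₐ[k] A}

/-- The part of the rotation sum of `f ⌣ g` in which the arguments of `f` are not broken up. -/
def rotPart (ε : A →ₗ[k] k) (σ : A ≃ₐ[k] A) (p n : ℕ) (h : SeqFun A) : SeqForm k A :=
  ∑ v ∈ Finset.range p, ((-1 : k) ^ n) ^ (v + 1) • rotForm ε σ (n + 1) (n - v) h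

/-- For `u < q` the arguments of `f` do not wrap around, so its value moves to the end as a whole by
the Nakayama relation; invariance pulls the resulting `σ⁻¹` into the arguments. -/
theorem rotForm_cupS_comm (hσ : IsNakayamaAutomorphism ε σ) {p q n u : ℕ} (hn : p + q = n + 1)
    (hu : u < q) {f : SeqFun A} (hf : HasArity p f) (hft : twist σ f = f) (g : SeqFun A) :
    rotForm ε σ (n + 1) u (cupS p f g) = rotForm ε σ (n + 1) (u + p) (cupS q g f) := by
  funext x
  rw [rotForm_apply, rotForm_apply, cupS, cupS]
  have h1 : (f fun l => twistExt σ (n + 1) x (u + p + (q + l)))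
      = σ.symm (f fun j => twistExt σ (n + 1) x (u + j)) := by
    rw [← apply_symm_of_twist_eq hft]
    refine hf _ _ fun l hl => ?_
    simp only [twistExt]
    rw [if_neg (by omega), if_pos (by omega)]
    congr 2
    omega
  rw [h1, IsNakayamaAutomorphism.mul_symm hσ]
  simp only [add_assoc]

/-- Every cut leaves one block of arguments in one piece: for `u ≥ q` all arguments of `g` have
wrapped around, for `u < q` those of `f` stay together. In the second case `rotForm_cupS_comm`
exchanges the roles of `f` and `g`. -/
theorem rotSum_cupS (hσ : IsNakayamaAutomorphism ε σ) {p q n : ℕ} (hn : p + q = n + 1)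
    {f : SeqFun A} (hf : HasArity p f) (hft : twist σ f = f) (g : SeqFun A) :
    rotSum ε σ (n + 1) (cupS p f g) = rotPart ε σ p n (cupS p f g)
      + (-1 : k) ^ (p * q) • rotPart ε σ q n (cupS q g f) := by
  rw [rotSum_apply, ← hn, add_comm p q, Finset.sum_range_add, add_comm, rotPart, rotPart, add_comm q,
    hn]
  congr 1
  · rw [← Finset.sum_range_reflect]
    refine Finset.sum_congr rfl fun v hv => ?_
    have hv := Finset.mem_range.1 hv
    rw [show q + (p - 1 - v) = n - v by omega]
    congr 1
    obtain ⟨m, rfl⟩ : ∃ m, n = v + m := ⟨n - v, by omega⟩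
    rw [← pow_mul, ← pow_mul, Nat.add_sub_cancel_left]
    refine neg_one_pow_congr ?_
    push_cast
    generalize (v : ZMod 2) = v, (m : ZMod 2) = m
    revert v m; decide
  · rw [Finset.smul_sum, ← Finset.sum_range_reflect]
    refine Finset.sum_congr rfl fun v hv => ?_
    have hv := Finset.mem_range.1 hv
    rw [rotForm_cupS_comm hσ hn (by omega) hf hft, show q - 1 - v + p = n - v by omega, smul_smul]
    congr 1
    obtain ⟨m, rfl⟩ : ∃ m, q = v + 1 + m := ⟨q - 1 - v, by omega⟩
    obtain rfl : n = p + v + m := by omega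
    rw [show v + 1 + m - 1 - v = m by omega, ← pow_mul, ← pow_mul, ← pow_add]
    refine neg_one_pow_congr ?_
    push_cast
    generalize (v : ZMod 2) = v, (m : ZMod 2) = m, (p : ZMod 2) = p
    revert v m p; decide

/-- From the cut `n - v` the slot `v` of `f` holds `x_n g (σ⁻¹ x_0, …, σ⁻¹ x_{q-1})`. The expression
is therefore a rotation of `f` alone, with this product as last argument. -/
theorem rotForm_pcomp_coface_zero {p q n v : ℕ} (hn : p + q = n + 1) (hv : v < p)
    {f : SeqFun A} (hf : HasArity p f) {g : SeqFun A} (hg : HasArity q g) (x : ℕ → A) :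
    rotForm ε σ (n + 1) (n - v) (pcomp (q + 1) v f (coface k q 0 g)) x
      = rotForm ε σ p (p - 1 - v) f
        (fun j => if j + 1 = p then x n * g (fun i => σ.symm (x i)) else x (q + j)) := by
  rw [rotForm_apply, rotForm_apply, pcomp]
  congr 1
  refine hf _ _ fun j hj => ?_
  rcases lt_trichotomy j v with hjv | rfl | hjv
  · simp only [ins, twistExt]
    rw [if_pos hjv, if_pos (by omega), if_pos (by omega), if_neg (by omega)]
    congr 1
    omega
  · simp only [ins, twistExt]
    rw [if_neg (lt_irrefl _), if_pos trivial, coface_zero_apply, if_pos (by omega),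
      if_pos (by omega), if_pos (by omega)]
    congr 1
    · congr 1
      omega
    · refine hg _ _ fun l hl => ?_
      rw [if_neg (by omega)]
      congr 2
      omega
  · simp only [ins, twistExt]
    rw [if_neg (by omega), if_neg (by omega), if_neg (by omega), if_neg (by omega),
      if_neg (by omega)]
    congr 2
    omega

/-- Together these rotations make up the rotation sum of `f`, hence the form of `b`; the Nakayama
relation then brings `g` to the front. -/
theorem sum_rotForm_pcomp (hσ : IsNakayamaAutomorphism ε σ) {p q n : ℕ} (hn : p + q = n + 1)
    {f b g : SeqFun A} (hf : HasArity p f) (hb : HasArity (p - 1) b)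
    (hbf : form ε (p - 1) b = rotSum ε σ p f) (hg : HasArity q g) (hgt : twist σ g = g)
    (hp : 0 < p) :
    ∑ v ∈ Finset.range p, (((-1 : k) ^ n) ^ (v + 1) * ((-1 : k) ^ (q + 1)) ^ v * (-1) ^ v) •
        rotForm ε σ (n + 1) (n - v) (pcomp (q + 1) v f (coface k q 0 g))
      = (-1 : k) ^ q • form ε n (cupS q g b) := by
  funext x
  have h1 : form ε n (cupS q g b) x = form ε (p - 1) b
      (fun j => if j + 1 = p then x n * g (fun i => σ.symm (x i)) else x (q + j)) := by
    rw [form_apply, form_apply, if_pos (by omega), apply_symm_of_twist_eq hgt, ← mul_assoc,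
      IsNakayamaAutomorphism.mul_symm hσ, cupS, mul_assoc]
    congr 3
    refine hb _ _ fun l hl => ?_
    rw [if_neg (by omega)]
  rw [Pi.smul_apply, h1, hbf, rotSum_apply,
    ← Finset.sum_range_reflect (fun u => ((-1 : k) ^ (p + 1)) ^ u • rotForm ε σ p u f)]
  simp only [Finset.sum_apply, Pi.smul_apply, Finset.smul_sum]
  refine Finset.sum_congr rfl fun v hv => ?_
  have hv := Finset.mem_range.1 hv
  rw [rotForm_pcomp_coface_zero hn hv hf hg, smul_smul]
  congr 1
  obtain ⟨m, rfl⟩ : ∃ m, p = v + 1 + m := ⟨p - 1 - v, by omega⟩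
  obtain rfl : n = q + v + m := by omega
  rw [show v + 1 + m - 1 - v = m by omega, ← pow_mul, ← pow_mul, ← pow_mul, ← pow_add, ← pow_add,
    ← pow_add]
  refine neg_one_pow_congr ?_
  push_cast
  generalize (v : ZMod 2) = v, (m : ZMod 2) = m, (q : ZMod 2) = q
  revert v m q; decide

/-- The homotopy that relates the bracket and the rotation sum of a cup product. -/
def rotHomotopy (ε : A →ₗ[k] k) (σ : A ≃ₐ[k] A) (p q n : ℕ) (f g : SeqFun A) : SeqForm k A :=
  ∑ v ∈ Finset.range p, ∑ w ∈ Finset.range v,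
    ((-1 : k) ^ (w + 1) * ((-1 : k) ^ n) ^ (w + 1) * ((-1 : k) ^ (q + 1)) ^ v) •
      rotForm ε σ n (n - (w + 1)) (pcomp q v f g)

/-- `dForm_rotForm` provides differences in `w`, and the differential of `f ∘_v g` provides
differences in `v`. The side `w = 0` of the triangle gives `f ∘ g`, the side `v = p` gives the
rotations of `f ⌣ g`, and the diagonal gives `g ⌣ b`. -/
theorem dForm_rotHomotopy (hσ : IsNakayamaAutomorphism ε σ) {p q n : ℕ} (hn : p + q = n + 1)
    {f b g : SeqFun A} (hf : IsCocycle k p f) (hft : twist σ f = f) (hb : HasArity (p - 1) b)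
    (hbf : form ε (p - 1) b = rotSum ε σ p f) (hg : IsCocycle k q g) (hgt : twist σ g = g)
    (hp : 0 < p) :
    dForm σ n (rotHomotopy ε σ p q n f g) =
      (-1 : k) ^ q • form ε n (cupS q g b)
        - ((-1 : k) ^ n * (-1 : k) ^ ((p + 1) * (q + 1))) • form ε n (circS k p q f g)
        + ((-1 : k) ^ ((p + 1) * (q + 1)) * (-1) ^ p) • rotPart ε σ p n (cupS p f g) := by
  have hE : ((-1 : k) ^ (q + 1)) * (-1 : k) ^ (q + 1) = 1 := neg_one_pow_mul_self _
  have hEp : ((-1 : k) ^ (q + 1)) ^ (p + 1) = (-1 : k) ^ ((p + 1) * (q + 1)) := by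
    rw [← pow_mul, mul_comm]
  let P : ℕ → SeqFun A := fun v => pcomp q v (lowD k p v f) g
  have hPp : P p = (-1 : k) ^ p • cupS p f g := by
    have := lowD_pcomp_last (k := k) q hf.isCochain.hasArity g
    rw [hf.dS, ← pcompL_apply (k := k) q p 0, map_zero, zero_add] at this
    exact this
  let G : ℕ → ℕ → SeqForm k A := fun w v =>
    (((-1 : k) ^ n) ^ (w + 1) * ((-1 : k) ^ (q + 1)) ^ v) •
      rotForm ε σ (n + 1) (n - w) (lowD k n w (pcomp q v f g))
  let Q : ℕ → ℕ → SeqForm k A := fun w v =>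
    (((-1 : k) ^ n) ^ (w + 1) * ((-1 : k) ^ (q + 1)) ^ (v + 1)) • rotForm ε σ (n + 1) (n - w) (P v)
  have key : ∀ v ∈ Finset.range p, ∀ w ∈ Finset.range v,
      ((-1 : k) ^ (w + 1) * ((-1 : k) ^ n) ^ (w + 1) * ((-1 : k) ^ (q + 1)) ^ v) •
        dForm σ n (rotForm ε σ n (n - (w + 1)) (pcomp q v f g))
      = (G (w + 1) v - G w v) + (Q w (v + 1) - Q w v) := fun v hv w hw => by
    have hv := Finset.mem_range.1 hv
    have hw := Finset.mem_range.1 hw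
    have ha : HasArity n (pcomp q v f g) := (hf.isCochain.pcomp hn hv hg.isCochain).hasArity
    have hd : dS k n (pcomp q v f g) = P (v + 1) - (-1 : k) ^ (q + 1) • P v := by
      rw [dS_pcomp hn hv hf.isCochain hg.isCochain.hasArity, hf.dS, hg.dS,
        ← pcompL_apply (k := k) q v 0, map_zero]
      obtain ⟨L, hL⟩ := hf.isCochain.linear (q + 1) hv
      rw [← hL, map_zero]
      module
    rw [dForm_rotForm hσ (m := w) (by omega) ha, show n - (w + 1) + 1 = n - w by omega, map_sub, hd,
      map_sub, map_smul]
    have g1 : (-1 : k) ^ (w + 1) * (-1) ^ (n - (w + 1)) = (-1) ^ n := by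
      rw [← pow_add]; congr 1; omega
    have g2 : (-1 : k) ^ (w + 1) * (-1) ^ (n + (n - (w + 1))) = 1 := by
      rw [pow_add _ n, mul_left_comm, g1, neg_one_pow_mul_self]
    simp only [G, Q]
    rw [pow_succ ((-1 : k) ^ n) (w + 1), pow_succ _ (v + 1), pow_succ _ v]
    generalize ((-1 : k) ^ n) ^ (w + 1) = a, ((-1 : k) ^ (q + 1)) ^ v = e at *
    linear_combination (norm := module)
      (a * e * g1) • rotForm ε σ (n + 1) (n - (w + 1)) (lowD k n (w + 1) (pcomp q v f g))
      + (a * e * g2) • (rotForm ε σ (n + 1) (n - w) (P (v + 1))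
        - (-1 : k) ^ (q + 1) • rotForm ε σ (n + 1) (n - w) (P v)
        - rotForm ε σ (n + 1) (n - w) (lowD k n w (pcomp q v f g)))
      - (a * e * hE) • rotForm ε σ (n + 1) (n - w) (P (v + 1))
  rw [rotHomotopy, map_sum]
  simp only [map_sum, map_smul]
  rw [Finset.sum_congr rfl fun v hv => Finset.sum_congr rfl (key v hv), sum_triangle_telescope,
    Finset.sum_add_distrib, Finset.sum_add_distrib, Finset.sum_neg_distrib]
  have s1 : ∑ v ∈ Finset.range p, G 0 v
      = ((-1 : k) ^ n * (-1 : k) ^ ((p + 1) * (q + 1))) • form ε n (circS k p q f g) := by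
    rw [circS_eq, hEp, map_smul, smul_smul, mul_assoc, neg_one_pow_mul_self, mul_one, map_sum,
      Finset.smul_sum]
    refine Finset.sum_congr rfl fun v hv => ?_
    simp only [G]
    rw [lowD_zero, Nat.sub_zero, rotForm_coface_zero_last hσ, twist_pcomp, hft, hgt, map_smul,
      smul_smul, zero_add, pow_one]
  have s2 : ∑ v ∈ Finset.range p, Q v p
      = ((-1 : k) ^ ((p + 1) * (q + 1)) * (-1) ^ p) • rotPart ε σ p n (cupS p f g) := by
    rw [rotPart, Finset.smul_sum]
    refine Finset.sum_congr rfl fun v hv => ?_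
    simp only [Q]
    rw [hPp, hEp, map_smul, smul_smul, smul_smul]
    congr 1
    ring
  have s3 : ∑ v ∈ Finset.range p, (G v v - Q v (v + 1))
      = (-1 : k) ^ q • form ε n (cupS q g b) := by
    rw [← sum_rotForm_pcomp hσ hn hf.isCochain.hasArity hb hbf hg.isCochain.hasArity hgt hp]
    refine Finset.sum_congr rfl fun v hv => ?_
    simp only [G, Q, P]
    rw [pcomp_lowD_succ hn (Finset.mem_range.1 hv), map_sub, map_smul,
      pow_succ ((-1 : k) ^ (q + 1)) (v + 1), pow_succ ((-1 : k) ^ (q + 1)) v]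
    generalize ((-1 : k) ^ n) ^ (v + 1) = a, ((-1 : k) ^ (q + 1)) ^ v = e at *
    linear_combination (norm := module)
      (-(a * e * hE)) • (rotForm ε σ (n + 1) (n - v) (lowD k n v (pcomp q v f g))
        - (-1 : k) ^ v • rotForm ε σ (n + 1) (n - v) (pcomp (q + 1) v f (coface k q 0 g)))
  rw [s1, s2, s3]
  abel

theorem rotHomotopy_mem {p q n : ℕ} (hn : p + q = n + 1) {f g : SeqFun A}
    (hf : IsCochain k p f) (hg : IsCochain k q g) :
    rotHomotopy ε σ p q n f g ∈ LinearMap.range (evForm k A n) :=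
  Submodule.sum_mem _ fun v hv => Submodule.sum_mem _ fun w hw => Submodule.smul_mem _ _ <| by
    have hv := Finset.mem_range.1 hv
    have hw := Finset.mem_range.1 hw
    exact rotForm_mem (by omega) (hf.pcomp hn hv hg)

theorem isBoundary_zero (n : ℕ) : IsBoundary k n (0 : SeqFun A) := by
  cases n with
  | zero => rfl
  | succ n => exact ⟨0, Submodule.zero_mem _, map_zero _⟩

theorem IsBoundary.add {n : ℕ} {F G : SeqFun A} (hF : IsBoundary k n F) (hG : IsBoundary k n G) :
    IsBoundary k n (F + G) := by
  cases n with
  | zero => rw [show F = 0 from hF, show G = 0 from hG, add_zero]; rfl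
  | succ n =>
    obtain ⟨F, hF, rfl⟩ := hF
    obtain ⟨G, hG, rfl⟩ := hG
    exact ⟨F + G, hF.add hG, map_add _ _ _⟩

theorem IsBoundary.isCochain {n : ℕ} {F : SeqFun A} (hF : IsBoundary k n F) : IsCochain k n F := by
  cases n with
  | zero => rw [show F = 0 from hF]; exact Submodule.zero_mem _
  | succ n =>
    obtain ⟨F, hF, rfl⟩ := hF
    exact hF.dS

theorem exists_form_eq_dForm (hε : IsFrobeniusFunctional ε) (hσ : IsNakayamaAutomorphism ε σ)
    {p q n : ℕ} (hn : p + q = n + 1) {f g : SeqFun A} (hf : IsCochain k p f)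
    (hg : IsCochain k q g) :
    ∃ e, IsBoundary k n e ∧ form ε n e = dForm σ n (rotHomotopy ε σ p q n f g) := by
  cases n with
  | zero =>
    refine ⟨0, isBoundary_zero 0, ?_⟩
    have : rotHomotopy ε σ p q 0 f g = 0 := by
      refine Finset.sum_eq_zero fun v hv => Finset.sum_eq_zero fun w hw => ?_
      have hv := Finset.mem_range.1 hv
      have hw := Finset.mem_range.1 hw
      omega
    rw [this, map_zero, map_zero]
  | succ n =>
    obtain ⟨a, ha, hform⟩ := exists_form_eq hε (rotHomotopy_mem (ε := ε) (σ := σ) hn hf hg)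
    exact ⟨dS k n a, ⟨a, ha, rfl⟩, by rw [form_dS hσ ha.hasArity, hform]⟩

theorem eq_zero_of_form_eq_rotSum_zero (hε : IsFrobeniusFunctional ε) {f b : SeqFun A}
    (hb : HasArity 0 b) (hbf : form ε 0 b = rotSum ε σ 0 f) : b = 0 :=
  form_injective hε (n := 0) hb (fun _ _ _ => rfl) (by rw [map_zero, hbf]; simp [rotSum])

theorem isCochain_cupS_rotSum (hε : IsFrobeniusFunctional ε) {p q n : ℕ} (hn : p + q = n + 1)
    {f g b : SeqFun A} (hb : IsCochain k (p - 1) b) (hbf : form ε (p - 1) b = rotSum ε σ p f)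
    (hg : IsCochain k q g) : IsCochain k n (cupS q g b) := by
  rcases Nat.eq_zero_or_pos p with rfl | hp
  · rw [eq_zero_of_form_eq_rotSum_zero hε hb.hasArity hbf, ← cupL_apply (k := k), map_zero]
    exact Submodule.zero_mem _
  · exact hg.cupS (by omega) hb

theorem exists_rotPart (hε : IsFrobeniusFunctional ε) (hσ : IsNakayamaAutomorphism ε σ) {p q n : ℕ}
    (hn : p + q = n + 1) {f b g : SeqFun A} (hf : IsCocycle k p f) (hft : twist σ f = f)
    (hb : HasArity (p - 1) b) (hbf : form ε (p - 1) b = rotSum ε σ p f) (hg : IsCocycle k q g)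
    (hgt : twist σ g = g) :
    ∃ e, IsBoundary k n e ∧ rotPart ε σ p n (cupS p f g) = form ε n
      (e + (-1 : k) ^ (p * q) • cupS q g b + (-1 : k) ^ (q + 1) • circS k p q f g) := by
  rcases Nat.eq_zero_or_pos p with rfl | hp
  · refine ⟨0, isBoundary_zero n, ?_⟩
    rw [eq_zero_of_form_eq_rotSum_zero hε hb hbf, circS_zero_left, ← cupL_apply (k := k) q, map_zero]
    simp [rotPart]
  · obtain ⟨e, he, hform⟩ := exists_form_eq_dForm hε hσ hn hf.isCochain hg.isCochain
    refine ⟨((-1 : k) ^ ((p + 1) * (q + 1)) * (-1) ^ p) • e, he.smul _, ?_⟩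
    rw [map_add, map_add, map_smul, map_smul, map_smul, hform,
      dForm_rotHomotopy hσ hn hf hft hb hbf hg hgt hp]
    have g1 := neg_one_pow_mul_self (k := k) ((p + 1) * (q + 1))
    have g2 := neg_one_pow_mul_self (k := k) p
    have g3 : (-1 : k) ^ ((p + 1) * (q + 1)) * (-1) ^ p * (-1) ^ q = -(-1) ^ (p * q) := by
      rw [← neg_one_mul ((-1 : k) ^ (p * q)), ← pow_succ', ← pow_add, ← pow_add]
      refine neg_one_pow_congr ?_
      push_cast
      generalize (p : ZMod 2) = p, (q : ZMod 2) = q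
      revert p q; decide
    have g4 : (-1 : k) ^ p * (-1) ^ n = (-1) ^ (q + 1) := by
      rw [← pow_add]
      refine neg_one_pow_congr ?_
      have := congrArg (Nat.cast (R := ZMod 2)) hn
      push_cast at this ⊢
      generalize (p : ZMod 2) = p, (q : ZMod 2) = q, (n : ZMod 2) = n at *
      revert p q n; decide
    generalize (-1 : k) ^ ((p + 1) * (q + 1)) = s, (-1 : k) ^ p = a, (-1 : k) ^ q = c,
      (-1 : k) ^ n = d at *
    linear_combination (norm := module)
      (-g3) • form ε n (cupS q g b) + (g1 * a * d + g4) • form ε n (circS k p q f g)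
      - (g1 * (a * a) + g2) • rotPart ε σ p n (cupS p f g)

/-- The two halves of `rotSum_cupS` contribute one cup product and one circle product each; the
circle products combine to the bracket. -/
theorem isBoundary_rotSum_cupS (hε : IsFrobeniusFunctional ε) (hσ : IsNakayamaAutomorphism ε σ)
    {p q n : ℕ} (hn : p + q = n + 1) {f g b b' c : SeqFun A}
    (hf : IsCocycle k p f) (hft : twist σ f = f) (hb : IsCochain k (p - 1) b)
    (hbf : form ε (p - 1) b = rotSum ε σ p f)
    (hg : IsCocycle k q g) (hgt : twist σ g = g) (hb' : IsCochain k (q - 1) b')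
    (hbg : form ε (q - 1) b' = rotSum ε σ q g)
    (hc : IsCochain k n c) (hcf : form ε n c = rotSum ε σ (n + 1) (cupS p f g)) :
    IsBoundary k n (c - ((-1 : k) ^ (p * q) • cupS q g b + cupS p f b'
      - (-1 : k) ^ q • bracketS k p q f g)) := by
  obtain ⟨e, he, h1⟩ := exists_rotPart hε hσ hn hf hft hb.hasArity hbf hg hgt
  obtain ⟨e', he', h2⟩ := exists_rotPart hε hσ ((add_comm q p).trans hn) hg hgt hb'.hasArity hbg
    hf hft
  have h3 : c = e + (-1 : k) ^ (p * q) • e' + ((-1 : k) ^ (p * q) • cupS q g b + cupS p f b'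
      - (-1 : k) ^ q • bracketS k p q f g) := by
    have i1 := isCochain_cupS_rotSum hε hn hb hbf hg.isCochain
    have i2 := isCochain_cupS_rotSum hε ((add_comm q p).trans hn) hb' hbg hf.isCochain
    have i3 : IsCochain k n (bracketS k p q f g) :=
      hf.isCochain.bracketS (fun _ => hn) hg.isCochain
    refine form_injective hε hc.hasArity (((he.isCochain.add (he'.isCochain.smul _)).add
      (((i1.smul _).add i2).sub (i3.smul _)) : IsCochain k n _).hasArity) ?_
    rw [hcf, rotSum_cupS hσ hn hf.isCochain.hasArity hft, h1, h2, bracketS]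
    simp only [map_add, map_sub, map_smul]
    have g1 := neg_one_pow_mul_self (k := k) (p * q)
    have g2 : (-1 : k) ^ (p * q) * (-1) ^ (p + 1) = (-1) ^ q * (-1) ^ ((p + 1) * (q + 1)) := by
      rw [← pow_add, ← pow_add]
      refine neg_one_pow_congr ?_
      push_cast
      generalize (p : ZMod 2) = p, (q : ZMod 2) = q
      revert p q; decide
    rw [mul_comm q p, pow_succ _ q]
    generalize (-1 : k) ^ ((p + 1) * (q + 1)) = s, (-1 : k) ^ (p + 1) = a, (-1 : k) ^ q = c,
      (-1 : k) ^ (p * q) = d at *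
    linear_combination (norm := module)
      g2 • form ε n (circS k q p g f) + g1 • form ε n (cupS p f b')
  rw [h3, add_sub_cancel_right]
  exact he.add (he'.smul _)

end Generator

end Hochschild

/-! ### Semisimplicity of conjugation by `σ` and invariant representatives. -/

section Diagonal

open Module

variable {k : Type*} [Field k]

theorem exists_inverse_off_kernel {ι V : Type*} [AddCommGroup V] [Module k V] (e : Basis ι k V)
    (D : V →ₗ[k] V) (χ : ι → k) (h : ∀ i, D (e i) = χ i • e i) :
    ∃ W : V →ₗ[k] V, (∀ x, W (D x) = D (W x)) ∧ ∀ x, D (D (W x)) = D x := by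
  -- As `0⁻¹ = 0`, this inverts `D` on the basis vectors with nonzero eigenvalue and kills the
  -- others.
  let W : V →ₗ[k] V := e.constr k fun i => (χ i)⁻¹ • e i
  have hW : ∀ i, W (e i) = (χ i)⁻¹ • e i := fun i => e.constr_basis k _ i
  refine ⟨W, fun x => ?_, fun x => ?_⟩
  · refine LinearMap.congr_fun (f := W ∘ₗ D) (g := D ∘ₗ W) (e.ext fun i => ?_) x
    simp only [LinearMap.comp_apply, h, hW, map_smul]
    rw [smul_comm]
  · refine LinearMap.congr_fun (f := D ∘ₗ D ∘ₗ W) (g := D) (e.ext fun i => ?_) x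
    simp only [LinearMap.comp_apply, h, hW, map_smul, smul_smul]
    by_cases h0 : χ i = 0
    · simp [h0]
    · rw [inv_mul_cancel₀ h0, one_mul]

variable {A : Type*} [Ring A] [Algebra k A] {ε : A →ₗ[k] k} {σ : A ≃ₐ[k] A}

/-- A vector space isomorphic to its full dual is finite dimensional. -/
theorem IsFrobeniusFunctional.finiteDimensional (hε : IsFrobeniusFunctional ε) :
    FiniteDimensional k A := by
  let L : A →ₗ[k] Module.Dual k A :=
    { toFun := fun a => ε ∘ₗ LinearMap.mulLeft k a
      map_add' := fun a b => by ext; simp [add_mul]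
      map_smul' := fun c a => by ext; simp }
  exact Basis.linearEquiv_dual_iff_finiteDimensional.1 ⟨LinearEquiv.ofBijective L hε⟩

theorem IsDiagonalisable.exists_basis.{u, v} {k : Type u} {A : Type v} [Field k] [Ring A]
    [Algebra k A] {σ : A ≃ₐ[k] A} (h : IsDiagonalisable σ) :
    ∃ (ι : Type (max u v)) (e : Basis ι k A) (c : ι → k), ∀ i, σ (e i) = c i • e i := by
  classical
  obtain ⟨S, -, hS⟩ := h
  have hS' : DirectSum.IsInternal
      fun c : S => Module.End.eigenspace (σ.toLinearMap : Module.End k A) c := by convert hS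
  let v := fun c : S =>
    Basis.ofVectorSpace k (Module.End.eigenspace (σ.toLinearMap : Module.End k A) (c : k))
  exact ⟨_, hS'.collectedBasis v, fun i => (i.1 : k), fun i =>
    Module.End.mem_eigenspace_iff.1 (hS'.collectedBasis_mem v i)⟩

namespace Hochschild

/-- Conjugation by `σ` on cochains. -/
def twistCochain (σ : A ≃ₐ[k] A) (n : ℕ) : Cochain k A n →ₗ[k] Cochain k A n where
  toFun f := σ.toLinearMap.compMultilinearMap (f.compLinearMap fun _ => σ.symm.toLinearMap)
  map_add' f g := by ext; simp
  map_smul' c f := by ext; simp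

theorem twistCochain_apply (σ : A ≃ₐ[k] A) {n : ℕ} (f : Cochain k A n) (x : Fin n → A) :
    twistCochain σ n f x = σ (f fun i => σ.symm (x i)) := rfl

theorem ev_twistCochain (σ : A ≃ₐ[k] A) {n : ℕ} (f : Cochain k A n) :
    ev n (twistCochain σ n f) = twist σ (ev n f) := rfl

/-- In an eigenbasis of `σ` the elementary cochains are eigenvectors of conjugation, with the
eigenvalue of the output divided by those of the inputs. They form a basis because `A` is finite
dimensional. -/
theorem exists_twist_inverse (hε : IsFrobeniusFunctional ε) (h : IsDiagonalisable σ) (n : ℕ) :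
    ∃ W : Cochain k A n →ₗ[k] Cochain k A n,
      (∀ f, W (twistCochain σ n f - f) = twistCochain σ n (W f) - W f) ∧
      ∀ f, twistCochain σ n (twistCochain σ n (W f) - W f) - (twistCochain σ n (W f) - W f)
        = twistCochain σ n f - f := by
  have := hε.finiteDimensional
  obtain ⟨ι, e, c, hc⟩ := h.exists_basis
  have : Finite ι := Module.Finite.finite_basis e
  have hr : ∀ a i, e.repr (σ a) i = c i * e.repr a i := fun a i => by
    refine LinearMap.congr_fun (f := e.coord i ∘ₗ σ.toLinearMap) (g := c i • e.coord i)
      (e.ext fun j => ?_) a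
    simp only [LinearMap.comp_apply, AlgEquiv.toLinearMap_apply, hc, map_smul, Basis.coord_apply,
      Basis.repr_self, LinearMap.smul_apply]
    by_cases hij : j = i
    · rw [hij]
    · simp [hij]
  have h0 : ∀ i, c i ≠ 0 := fun i h0 => by
    have := hc i
    rw [h0, zero_smul, EmbeddingLike.map_eq_zero_iff] at this
    exact e.ne_zero i this
  have hs : ∀ a i, e.repr (σ.symm a) i = (c i)⁻¹ * e.repr a i := fun a i => by
    have := hr (σ.symm a) i
    rw [AlgEquiv.apply_symm_apply] at this
    rw [this, inv_mul_cancel_left₀ (h0 i)]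
  let E := _root_.Basis.multilinearMap (fun _ : Fin n => e) e
  refine exists_inverse_off_kernel E (twistCochain σ n - LinearMap.id)
    (fun ii => (∏ j, (c (ii.1 j))⁻¹) * c ii.2 - 1) fun ii => ?_
  ext x
  simp only [LinearMap.sub_apply, LinearMap.id_apply, _root_.sub_apply, _root_.smul_apply,
    twistCochain_apply, E]
  simp only [_root_.Basis.multilinearMap_apply_apply, map_smul, hc, hs, Finset.prod_mul_distrib]
  module

theorem IsCochain.twist {n : ℕ} {f : SeqFun A} (hf : IsCochain k n f) (σ : A ≃ₐ[k] A) :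
    IsCochain k n (Hochschild.twist σ f) := by
  obtain ⟨f, rfl⟩ := hf
  exact ⟨twistCochain σ n f, ev_twistCochain σ f⟩

/-- With `D = twist σ - 1` and `D² W = D`, the choice `w = W f` gives `D (f - D w) = 0`. -/
theorem exists_twist_sub (hε : IsFrobeniusFunctional ε) (h : IsDiagonalisable σ) {n : ℕ}
    {f : SeqFun A} (hf : IsCochain k n f) :
    ∃ w, IsCochain k n w ∧ twist σ (f - (twist σ w - w)) = f - (twist σ w - w) := by
  obtain ⟨f, rfl⟩ := hf
  obtain ⟨W, -, hW⟩ := exists_twist_inverse hε h n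
  refine ⟨ev n (W f), isCochain_ev _, ?_⟩
  have := congrArg (ev n) (hW f)
  simp only [map_sub, ev_twistCochain] at this ⊢
  linear_combination (norm := module) -this

/-- Semisimplicity: `D² w = 0` forces `D w = D² W w = W D² w = 0`. -/
theorem twist_eq_of_twist_twist_sub (hε : IsFrobeniusFunctional ε) (h : IsDiagonalisable σ) {n : ℕ}
    {w : SeqFun A} (hw : IsCochain k n w) (hww : twist σ (twist σ w - w) = twist σ w - w) :
    twist σ w = w := by
  obtain ⟨f, rfl⟩ := hw
  obtain ⟨W, hW, hW'⟩ := exists_twist_inverse hε h n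
  have h1 : twistCochain σ n (twistCochain σ n f - f) = twistCochain σ n f - f :=
    ev_injective n (by rw [ev_twistCochain, map_sub, ev_twistCochain, hww])
  have h2 := hW' f
  rw [← hW, ← hW, h1, sub_self, map_zero, eq_comm, sub_eq_zero] at h2
  rw [← ev_twistCochain, h2]

theorem exists_invariant_cochain (hε : IsFrobeniusFunctional ε) (h : IsDiagonalisable σ) {n : ℕ}
    {f g : SeqFun A} (hg : IsCochain k n g) (hft : twist σ f = f) (hd : dS k n g = f) :
    ∃ u, IsCochain k n u ∧ twist σ u = u ∧ dS k n u = f := by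
  obtain ⟨w, hw, hwt⟩ := exists_twist_sub hε h hg
  refine ⟨_, hg.sub ((hw.twist σ).sub hw), hwt, ?_⟩
  have h1 := congrArg (dS k n) hwt
  -- Applying `d` to the invariance of `g - D w` gives `D² (d w) = D f = 0`, so `d w` is invariant
  -- and the correction does not change `d g`.
  have h2 : twist σ (dS k n w) = dS k n w := by
    refine twist_eq_of_twist_twist_sub hε h hw.dS ?_
    simp only [map_sub, ← twist_dS, hd, hft] at h1 ⊢
    linear_combination (norm := module) -h1
  rw [map_sub, map_sub, ← twist_dS, h2, hd, sub_self, sub_zero]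

/-- For a cocycle, `dForm_rotSum` presents the form of `w - twist σ w`, up to sign, as the
differential of the rotation sum. -/
theorem isBoundary_twist_sub (hε : IsFrobeniusFunctional ε) (hσ : IsNakayamaAutomorphism ε σ)
    {n : ℕ} {w : SeqFun A} (hw : IsCocycle k n w) : IsBoundary k n (twist σ w - w) := by
  have h1 := dForm_rotSum hσ hw.isCochain.hasArity
  rw [hw.dS, map_zero, zero_add, ← map_sub] at h1
  have hs : IsCochain k n (twist σ w - w) := (hw.isCochain.twist σ).sub hw.isCochain
  cases n with
  | zero =>
    refine form_injective hε hs.hasArity (fun _ _ _ => rfl : HasArity 0 (0 : SeqFun A)) ?_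
    have h2 : rotSum ε σ 0 w = 0 := by simp [rotSum]
    rw [h2, map_zero, pow_zero, one_smul] at h1
    rw [map_zero, ← neg_sub, map_neg, ← h1, neg_zero]
  | succ n =>
    obtain ⟨b, hb, hbw⟩ := exists_rotSum hε σ hw.isCochain
    simp only [Nat.add_sub_cancel] at hb hbw
    refine ⟨(-(-1 : k) ^ (n + 1)) • b, hb.smul _, ?_⟩
    refine form_injective hε (n := n + 1) (hb.smul _).dS.hasArity hs.hasArity ?_
    rw [map_smul, map_smul, form_dS hσ hb.hasArity, hbw, h1, smul_smul, neg_mul,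
      neg_one_pow_mul_self, ← map_smul]
    congr 1
    module

/-- Every cocycle is cohomologous to an invariant one. -/
theorem exists_invariant_cocycle (hε : IsFrobeniusFunctional ε) (hσ : IsNakayamaAutomorphism ε σ)
    (h : IsDiagonalisable σ) {n : ℕ} {f : SeqFun A} (hf : IsCocycle k n f) :
    ∃ u, IsCocycle k n u ∧ twist σ u = u ∧ IsBoundary k n (f - u) := by
  obtain ⟨w, hw, hwt⟩ := exists_twist_sub hε h hf.isCochain
  have h1 : twist σ (dS k n w) = dS k n w := by
    refine twist_eq_of_twist_twist_sub hε h hw.dS ?_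
    have h1 := congrArg (dS k n) hwt
    simp only [map_sub, ← twist_dS, hf.dS, map_zero] at h1 ⊢
    linear_combination (norm := module) -h1
  -- The cochain `w` need not be closed, so `isBoundary_twist_sub` does not apply to it. Splitting
  -- it once more gives `D w = D (D v)`, and `D v` is a cocycle.
  obtain ⟨v, hv, hvt⟩ := exists_twist_sub hε h hw
  have h2 : twist σ (dS k n v) = dS k n v := by
    refine twist_eq_of_twist_twist_sub hε h hv.dS ?_
    have h2 := congrArg (dS k n) hvt
    simp only [map_sub, ← twist_dS, h1] at h2 ⊢
    linear_combination (norm := module) -h2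
  have hz : IsCocycle k n (twist σ v - v) :=
    isCocycle_iff.2 ⟨(hv.twist σ).sub hv, by rw [map_sub, ← twist_dS, h2, sub_self]⟩
  have h3 : twist σ w - w = twist σ (twist σ v - v) - (twist σ v - v) := by
    simp only [map_sub] at hvt ⊢
    linear_combination (norm := module) hvt
  refine ⟨f - (twist σ w - w), isCocycle_iff.2 ⟨hf.isCochain.sub ((hw.twist σ).sub hw), ?_⟩, hwt, ?_⟩
  · rw [map_sub, map_sub, ← twist_dS, h1, hf.dS, sub_self, sub_zero]
  · rw [sub_sub_cancel, h3]
    exact isBoundary_twist_sub hε hσ hz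

end Hochschild

end Diagonal

/-! ### The BV operator on cohomology. -/

namespace Hochschild

section Operator

variable {k A : Type*} [Field k] [Ring A] [Algebra k A] {ε : A →ₗ[k] k} {σ : A ≃ₐ[k] A}

theorem isCocycle_of_form_eq_rotSum (hσ : IsNakayamaAutomorphism ε σ) {n : ℕ} {f b : SeqFun A}
    (hf : IsCocycle k (n + 1) f) (hft : twist σ f = f) (hb : IsCochain k n b)
    (hbf : form ε n b = rotSum ε σ (n + 1) f) (hε : IsFrobeniusFunctional ε) :
    IsCocycle k n b := by
  refine isCocycle_iff.2 ⟨hb, form_injective hε (n := n + 1) hb.dS.hasArity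
    (fun _ _ _ => rfl : HasArity (n + 1) (0 : SeqFun A)) ?_⟩
  rw [form_dS hσ hb.hasArity, hbf, dForm_rotSum hσ hf.isCochain.hasArity, hf.dS, hft, sub_self,
    map_zero, map_zero, smul_zero, add_zero]

/-- The primitive of `f` may be taken invariant, and on invariant cochains rotation sums commute
with the differential. -/
theorem isBoundary_of_rotSum (hε : IsFrobeniusFunctional ε) (hσ : IsNakayamaAutomorphism ε σ)
    (h : IsDiagonalisable σ) {n : ℕ} {f b : SeqFun A} (hf : IsBoundary k (n + 1) f)
    (hft : twist σ f = f) (hb : IsCochain k n b) (hbf : form ε n b = rotSum ε σ (n + 1) f) :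
    IsBoundary k n b := by
  obtain ⟨g, hg, hd⟩ := hf
  obtain ⟨u, hu, hut, rfl⟩ := exists_invariant_cochain hε h hg hft hd
  have h1 := dForm_rotSum hσ hu.hasArity
  rw [hut, sub_self, smul_zero, add_zero, ← hbf] at h1
  cases n with
  | zero =>
    refine form_injective hε hb.hasArity (fun _ _ _ => rfl : HasArity 0 (0 : SeqFun A)) ?_
    rw [← h1, map_zero]
    simp [rotSum]
  | succ n =>
    obtain ⟨e, he, hef⟩ := exists_rotSum hε σ hu
    simp only [Nat.add_sub_cancel] at he hef
    refine ⟨e, he, form_injective hε (n := n + 1) he.dS.hasArity hb.hasArity ?_⟩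
    rw [form_dS hσ he.hasArity, hef, h1]

/-- The operator lives on the space `Z` of invariant cocycles, which surjects onto cohomology;
cocycles in `Z` with trivial class have trivial image. -/
theorem exists_operator_degree (hε : IsFrobeniusFunctional ε) (hσ : IsNakayamaAutomorphism ε σ)
    (h : IsDiagonalisable σ) (n : ℕ) : ∃ φ : HH k A (n + 1) →ₗ[k] TotalHH k A,
      ∀ (f : cocycles k A (n + 1)) (b : SeqFun A),
        twist σ (ev (n + 1) f.1) = ev (n + 1) f.1 → IsCochain k n b →
        form ε n b = rotSum ε σ (n + 1) (ev (n + 1) f.1) →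
        φ (proj _ f) = clsS k n b := by
  let Z : Submodule k (cocycles k A (n + 1)) :=
    LinearMap.ker (((twist σ - LinearMap.id) ∘ₗ ev (n + 1)) ∘ₗ (cocycles k A (n + 1)).subtype)
  have hZ : ∀ f : cocycles k A (n + 1), f ∈ Z ↔ twist σ (ev (n + 1) f.1) = ev (n + 1) f.1 :=
    fun f => by simp [Z, sub_eq_zero]
  have hex : ∀ z : Z, ∃ b, IsCochain k n b ∧
      form ε n b = rotSum ε σ (n + 1) (ev (n + 1) z.1.1) :=
    fun z => exists_rotSum hε σ (isCochain_ev z.1.1)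
  choose β hβ hβ' using hex
  have hβc : ∀ z, IsCocycle k n (β z) := fun z =>
    isCocycle_of_form_eq_rotSum hσ (isCocycle_ev z.1) ((hZ _).1 z.2) (hβ z) (hβ' z) hε
  -- The cochains `β z` are merely chosen, but their forms determine them, and this makes the choice
  -- linear.
  let ψ : Z →ₗ[k] TotalHH k A :=
    { toFun := fun z => clsS k n (β z)
      map_add' := fun y z => by
        rw [← clsS_add (hβc y) (hβc z)]
        congr 1
        refine form_injective hε (hβ _).hasArity ((hβ y).add (hβ z)).hasArity ?_
        simp only [map_add, hβ', Submodule.coe_add]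
      map_smul' := fun c z => by
        rw [RingHom.id_apply, ← clsS_smul (hβc z)]
        congr 1
        refine form_injective hε (hβ _).hasArity ((hβ z).smul c).hasArity ?_
        simp only [map_smul, hβ', Submodule.coe_smul] }
  let π : Z →ₗ[k] HH k A (n + 1) := proj (n + 1) ∘ₗ Z.subtype
  have hker : ∀ z, π z = 0 → ψ z = 0 := fun z hz => by
    refine clsS_eq_zero (isBoundary_of_rotSum hε hσ h ?_ ((hZ _).1 z.2) (hβ z) (hβ' z))
    exact isBoundary_ev.2 (Submodule.mem_comap.1 ((Submodule.Quotient.mk_eq_zero _).1 hz))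
  have hπ : Function.Surjective π := fun y => by
    obtain ⟨f, rfl⟩ := Submodule.Quotient.mk_surjective _ y
    obtain ⟨u, ⟨u, rfl⟩, hut, hfu⟩ := exists_invariant_cocycle hε hσ h (isCocycle_ev f)
    refine ⟨⟨u, (hZ u).2 hut⟩, ((Submodule.Quotient.eq _).2 ?_).symm⟩
    refine Submodule.mem_comap.2 (isBoundary_ev.1 ?_)
    rw [← map_sub] at hfu
    exact hfu
  -- Over a field `π` has a linear section; by `hker` the operator does not depend on which one.
  obtain ⟨s, hs⟩ := π.exists_rightInverse_of_surjective (LinearMap.range_eq_top.2 hπ)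
  refine ⟨ψ ∘ₗ s, fun f b hft hb hbf => ?_⟩
  have h1 : ψ (s (proj _ f)) = ψ ⟨f, (hZ f).2 hft⟩ := by
    rw [← sub_eq_zero, ← map_sub]
    refine hker _ ?_
    rw [map_sub, sub_eq_zero]
    exact LinearMap.congr_fun hs _
  rw [LinearMap.comp_apply, h1]
  change clsS k n (β _) = _
  congr 1
  exact form_injective hε (hβ _).hasArity hb.hasArity ((hβ' _).trans hbf.symm)

/-- The operator on cohomology induced by the rotation sums. -/
theorem exists_operator (hε : IsFrobeniusFunctional ε) (hσ : IsNakayamaAutomorphism ε σ)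
    (h : IsDiagonalisable σ) : ∃ B : TotalHH k A →ₗ[k] TotalHH k A,
      ∀ (p : ℕ) (f b : SeqFun A), IsCocycle k p f → twist σ f = f → IsCochain k (p - 1) b →
        form ε (p - 1) b = rotSum ε σ p f →
        B (clsS k p f) = (-1 : k) ^ (p + 1) • clsS k (p - 1) b := by
  choose φ hφ using exists_operator_degree hε hσ h
  obtain ⟨B, hB⟩ := exists_linear (k := k) (A := A) fun p =>
    match p with
    -- The operator is zero in degree `0`; in degree `p = n + 1` it carries the sign `(-1)^(p+1)`
    -- demanded by the sign convention of the BV relation.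
    | 0 => 0
    | n + 1 => (-1 : k) ^ (n + 2) • φ n
  refine ⟨B, fun p f b hf hft hb hbf => ?_⟩
  obtain ⟨f, rfl⟩ := hf
  rw [clsS_ev, hB]
  cases p with
  | zero =>
    rw [eq_zero_of_form_eq_rotSum_zero hε hb.hasArity hbf, clsS_zero, smul_zero]
    rfl
  | succ n =>
    change ((-1 : k) ^ (n + 2) • φ n) _ = _
    rw [LinearMap.smul_apply, hφ n f b hft hb hbf]
    rfl

theorem exists_invariant_rep (hε : IsFrobeniusFunctional ε) (hσ : IsNakayamaAutomorphism ε σ)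
    (h : IsDiagonalisable σ) {p : ℕ} {f : SeqFun A} (hf : IsCocycle k p f) :
    ∃ u b, IsCocycle k p u ∧ twist σ u = u ∧ IsCocycle k (p - 1) b ∧
      form ε (p - 1) b = rotSum ε σ p u ∧ clsS k p f = clsS k p u := by
  obtain ⟨u, hu, hut, hfu⟩ := exists_invariant_cocycle hε hσ h hf
  obtain ⟨b, hb, hbu⟩ := exists_rotSum hε σ hu.isCochain
  refine ⟨u, b, hu, hut, ?_, hbu, clsS_eq hf hu hfu⟩
  cases p with
  | zero => rw [eq_zero_of_form_eq_rotSum_zero hε hb.hasArity hbu]; exact isCocycle_zero _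
  | succ n => exact isCocycle_of_form_eq_rotSum hσ hu hut hb hbu hε

/-- The relation between the operator, the cup product and the bracket. -/
theorem clsS_bracketS_eq (hε : IsFrobeniusFunctional ε) (hσ : IsNakayamaAutomorphism ε σ)
    {B : TotalHH k A →ₗ[k] TotalHH k A}
    (hB : ∀ (p : ℕ) (f b : SeqFun A), IsCocycle k p f → twist σ f = f → IsCochain k (p - 1) b →
        form ε (p - 1) b = rotSum ε σ p f →
        B (clsS k p f) = (-1 : k) ^ (p + 1) • clsS k (p - 1) b)
    (S : GerstenhaberAlgebra k (TotalHH k A) (grading k A))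
    (hmul : ∀ (p q : ℕ) (F G : SeqFun A), IsCocycle k p F → IsCocycle k q G →
        S.mul (clsS k p F) (clsS k q G) = clsS k (p + q) (cupS p F G))
    {p q : ℕ} {f b g b' : SeqFun A} (hf : IsCocycle k p f) (hft : twist σ f = f)
    (hb : IsCocycle k (p - 1) b) (hbf : form ε (p - 1) b = rotSum ε σ p f)
    (hg : IsCocycle k q g) (hgt : twist σ g = g)
    (hb' : IsCocycle k (q - 1) b') (hbg : form ε (q - 1) b' = rotSum ε σ q g) :
    clsS k (p + q - 1) (bracketS k p q f g) = (-1 : k) ^ p •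
      (B (S.mul (clsS k p f) (clsS k q g)) - S.mul (B (clsS k p f)) (clsS k q g)
        - (-1 : k) ^ p • S.mul (clsS k p f) (B (clsS k q g))) := by
  have hfg := cupS_isCocycle rfl hf hg
  have hfgt : twist σ (cupS p f g) = cupS p f g := by rw [twist_cupS, hft, hgt]
  obtain ⟨c, hc, hcf⟩ := exists_rotSum hε σ hfg.isCochain
  rw [hmul _ _ _ _ hf hg, hB _ _ _ hf hft hb.isCochain hbf, hB _ _ _ hg hgt hb'.isCochain hbg,
    hB _ _ _ hfg hfgt hc hcf]
  simp only [map_smul, LinearMap.smul_apply]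
  rcases Nat.eq_zero_or_pos (p + q) with h0 | h0
  · obtain rfl : p = 0 := by omega
    obtain rfl : q = 0 := by omega
    rw [eq_zero_of_form_eq_rotSum_zero hε hb.isCochain.hasArity hbf,
      eq_zero_of_form_eq_rotSum_zero hε hb'.isCochain.hasArity hbg,
      eq_zero_of_form_eq_rotSum_zero hε hc.hasArity hcf, bracketS_zero_zero]
    simp [clsS_zero]
  obtain ⟨n, hn⟩ : ∃ n, p + q = n + 1 := ⟨p + q - 1, by omega⟩
  rw [hn] at hc hcf hfg ⊢
  simp only [Nat.add_sub_cancel] at hc hcf ⊢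
  have hcc : IsCocycle k n c := isCocycle_of_form_eq_rotSum hσ hfg hfgt hc hcf hε
  have hbr : IsCocycle k n (bracketS k p q f g) := bracketS_isCocycle (fun _ => hn) hf hg
  have h1 : IsCocycle k n (cupS q g b) ∧
      clsS k n (cupS q g b) = ((-1 : k) ^ (p * q) * (-1) ^ q) •
        S.mul (clsS k (p - 1) b) (clsS k q g) := by
    rcases Nat.eq_zero_or_pos p with rfl | hp
    · rw [eq_zero_of_form_eq_rotSum_zero hε hb.isCochain.hasArity hbf, ← cupL_apply (k := k) q,
        map_zero, clsS_zero, clsS_zero, map_zero, LinearMap.zero_apply, smul_zero]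
      exact ⟨isCocycle_zero n, rfl⟩
    · refine ⟨cupS_isCocycle (by omega) hg hb, ?_⟩
      -- Rotation produces `g ⌣ b`; graded commutativity restores the order of the BV relation.
      rw [S.mul_comm (clsS_mem b) (clsS_mem g), hmul _ _ _ _ hg hb, smul_smul,
        show q + (p - 1) = n by omega]
      obtain ⟨m, rfl⟩ : ∃ m, p = m + 1 := ⟨p - 1, by omega⟩
      have : (-1 : k) ^ ((m + 1) * q) * (-1) ^ q * (-1) ^ ((m + 1 - 1) * q) = (-1) ^ 0 := by
        rw [Nat.add_sub_cancel, ← pow_add, ← pow_add]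
        refine neg_one_pow_congr ?_
        push_cast
        generalize (m : ZMod 2) = m, (q : ZMod 2) = q
        revert m q; decide
      rw [this, pow_zero, one_smul]
  have h2 : IsCocycle k n (cupS p f b') ∧
      clsS k n (cupS p f b') = S.mul (clsS k p f) (clsS k (q - 1) b') := by
    rcases Nat.eq_zero_or_pos q with rfl | hq
    · rw [eq_zero_of_form_eq_rotSum_zero hε hb'.isCochain.hasArity hbg, ← cupL_apply (k := k) p,
        map_zero, clsS_zero, clsS_zero, map_zero]
      exact ⟨isCocycle_zero n, rfl⟩
    · refine ⟨cupS_isCocycle (by omega) hf hb', ?_⟩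
      rw [hmul _ _ _ _ hf hb', show p + (q - 1) = n by omega]
  have h3 := clsS_eq hcc (((h1.1.smul _).add h2.1).sub (hbr.smul _))
    (isBoundary_rotSum_cupS hε hσ hn hf hft hb.isCochain hbf hg hgt hb'.isCochain hbg hc hcf)
  have h4 : clsS k n ((-1 : k) ^ (p * q) • cupS q g b + cupS p f b'
      - (-1 : k) ^ q • bracketS k p q f g) = (-1 : k) ^ (p * q) • clsS k n (cupS q g b)
        + clsS k n (cupS p f b') + (-(-1 : k) ^ q) • clsS k n (bracketS k p q f g) := by
    rw [← clsS_smul h1.1, ← clsS_add (h1.1.smul _) h2.1, ← clsS_smul hbr,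
      ← clsS_add ((h1.1.smul _).add h2.1) (hbr.smul _)]
    congr 1
    module
  rw [h3, h4, h1.2, h2.2, ← hn]
  have g1 := neg_one_pow_mul_self (k := k) (p * q)
  have g2 := neg_one_pow_mul_self (k := k) p
  have g3 := neg_one_pow_mul_self (k := k) q
  rw [pow_succ _ (p + q), pow_add, pow_succ _ p, pow_succ _ q]
  generalize (-1 : k) ^ (p * q) = a, (-1 : k) ^ p = d, (-1 : k) ^ q = e at *
  linear_combination (norm := module)
    (-(g2 * (e * e) + g3)) • clsS k n (bracketS k p q f g)
    + (g1 * (d * d * e * e) + g3 * (d * d)) • S.mul (clsS k (p - 1) b) (clsS k q g)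

end Operator

end Hochschild

theorem corollary6p3 {k : Type*} {A : Type*} [Field k] [Ring A] [Algebra k A]
    (ε : A →ₗ[k] k) (hε : IsFrobeniusFunctional ε)
    (σ : A ≃ₐ[k] A) (hσ : IsNakayamaAutomorphism ε σ) (hdiag : IsDiagonalisable σ) :
    ∃ S : BVAlgebra k (Hochschild.TotalHH k A) (Hochschild.grading k A),
      Hochschild.IsCanonical S.toGerstenhaberAlgebra := by
  obtain ⟨S, hmul, hbracket, hS⟩ := Hochschild.exists_gerstenhaberAlgebra k A
  obtain ⟨B, hB⟩ := Hochschild.exists_operator hε hσ hdiag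
  have hB0 : ∀ {x}, x ∈ Hochschild.grading k A 0 → B x = 0 := fun {x} hx => by
    obtain ⟨F, hF, rfl⟩ := Hochschild.mem_grading_iff.1 hx
    obtain ⟨f, b, hf, hft, hb, hbf, e⟩ := Hochschild.exists_invariant_rep hε hσ hdiag hF
    rw [e, hB _ _ _ hf hft hb.isCochain hbf,
      Hochschild.eq_zero_of_form_eq_rotSum_zero hε hb.isCochain.hasArity hbf,
      Hochschild.clsS_zero, smul_zero]
  refine ⟨{ S with
    B := B
    B_mem := fun {n x} hx => ?_
    B_zero := hB0
    B_B := fun x => ?_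
    bracket_eq := fun {p x} hx y => ?_ }, hS⟩
  · obtain ⟨F, hF, rfl⟩ := Hochschild.mem_grading_iff.1 hx
    obtain ⟨f, b, hf, hft, hb, hbf, e⟩ := Hochschild.exists_invariant_rep hε hσ hdiag hF
    rw [e, hB _ _ _ hf hft hb.isCochain hbf]
    exact Submodule.smul_mem _ _ (Hochschild.clsS_mem _)
  · induction x using Hochschild.totalHH_induction with
    | hadd x y hx hy => rw [map_add, map_add, hx, hy, add_zero]
    | hcls n F hF =>
      obtain ⟨f, b, hf, hft, hb, hbf, e⟩ := Hochschild.exists_invariant_rep hε hσ hdiag hF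
      rw [e, hB _ _ _ hf hft hb.isCochain hbf, map_smul]
      -- For `n ≤ 1` the cochain `b` has degree `0`, where the operator vanishes; only from `n = 2`
      -- on does the homotopy for the square enter.
      rcases n with _ | _ | n
      · rw [hB0 (Hochschild.clsS_mem b), smul_zero]
      · rw [hB0 (Hochschild.clsS_mem b), smul_zero]
      · have hbt := Hochschild.twist_of_form_eq_rotSum hε hσ hft hb.isCochain.hasArity hbf
        obtain ⟨c, hc, hcf⟩ := Hochschild.exists_rotSum hε σ hb.isCochain
        rw [hB _ _ _ hb hbt hc hcf, Hochschild.clsS_eq_zero, smul_zero, smul_zero]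
        exact Hochschild.isBoundary_rotSum_rotSum hε hσ hf.isCochain hft hb.isCochain hb.dS hbf hc
          hcf
  · obtain ⟨F, hF, rfl⟩ := Hochschild.mem_grading_iff.1 hx
    obtain ⟨f, b, hf, hft, hb, hbf, e⟩ := Hochschild.exists_invariant_rep hε hσ hdiag hF
    rw [e]
    induction y using Hochschild.totalHH_induction with
    | hadd y z hy hz =>
      simp only [map_add]
      rw [hy, hz]
      module
    | hcls q G hG =>
      obtain ⟨g, b', hg, hgt, hb', hbg, e'⟩ := Hochschild.exists_invariant_rep hε hσ hdiag hG
      rw [e']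
      exact (hbracket _ _ _ _ hf hg).trans
        (Hochschild.clsS_bracketS_eq hε hσ hB S hmul hf hft hb hbf hg hgt hb' hbg)
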